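/- **Models.** Let $0<p<1$ and $0<\rho\le 1$. Under $\mathcal P_0=\mathcal P_0^{(n)}$, $G_1,G_2$ are independent Erdős–Rényi graphs $\mathcal G(n,p)$ on $[n]$. Under $\mathcal P_1=\mathcal P_1^{(n)}$, a uniformly random permutation $\pi$ of $[n]$ is drawn and, given $\pi$, the pairs $(\mathbf 1\{uv\in E(G_1)\},\mathbf 1\{\pi(u)\pi(v)\in E(G_2)\})$, over unordered pairs $u\neq v$, are i.i.d. with Bernoulli($p$) marginals and correlation coefficient $\rho$. **Motifs.** For integers $d\ge 3$, $\ell\ge 1$ put $N_{\mathsf v}=\ell(d-1)+4$ and $N_{\mathsf e}=\binom d2\ell+d+1$. Let $\mathcal M(N_{\mathsf v},N_{\mathsf e},d)$ be the set of isomorphism classes of the following graphs on $N_{\mathsf v}$ vertices: there are two central vertices $v_{0,1},v_{0,2}$, two extremity vertices $v_{0,0},v_{0,3}$, and path vertices $v_{i,t}$ ($1\le i\le d-1$, $1\le t\le\ell$); the edges are $v_{0,0}v_{0,1}$, $v_{0,2}v_{0,3}$, the edges $v_{0,1}v_{i,1}$, $v_{i,t}v_{i,t+1}$ ($1\le t<\ell$)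 and $v_{i,\ell}v_{0,2}$ for every $i$, and, for every $i<j$, the $\ell$ edges of an arbitrary perfect matching between $\{v_{i,1},\dots,v_{i,\ell}\}$ and $\{v_{j,1},\dots,v_{j,\ell}\}$. (Each such graph has $N_{\mathsf e}$ edges.) **Statistic.** For a graph $M$ with $\mathsf v(M)$ vertices, $\mathsf e(M)$ edges and $\mathsf{aut}(M)$ automorphisms let $$\mathsf{inj}(M,\bar G)=\sum_{\varphi:V(M)\hookrightarrow[n]}\ \prod_{uv\in E(M)}\bigl(\mathbf 1\{\varphi(u)\varphi(v)\in E(G)\}-p\bigr),\qquad \omega_M=\frac{\rho^{\mathsf e(M)}\,(n-\mathsf v(M))!}{n!\,(p(1-p))^{\mathsf e(M)}\,\mathsf{aut}(M)},$$ $$\mathcal T=\mathcal T_{\mathcal M(N_{\mathsf v},N_{\mathsf e},d)}(G_1,G_2)=\sum_{M\in\mathcal M(N_{\mathsf v},N_{\mathsf e},d)}\omega_M\,\mathsf{inj}(M,\bar G_1)\,\mathsf{inj}(M,\bar G_2),\qquad \tau=\tfrac12\,\mathbb E_{\mathcal P_1}[\mathcal T].$$ **Theorem.** In all three parts $p=p_n$,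 $\rho=\rho_n\in(0,1]$ and $\ell=\ell_n\ge1$ (hence $N_{\mathsf e}=N_{\mathsf e}(n)$) may depend on $n$, $d$ is fixed, and it is assumed that, as $n\to\infty$, $$N_{\mathsf e}=o\!\left(\frac{\log n}{\max(\log\log n,\,-\log\rho)}\right).\qquad(*)$$ 1. For every integer $d$ there is a constant $C_1(d)>0$ such that, if $p=n^{-a}$ for a constant $0<a\le\frac23$ with $\lfloor 2/a\rfloor=d$ (so that $d\ge3$), $(*)$ holds and $N_{\mathsf e}\ge C_1(d)/\rho^{2d/(d-2)}$, then for all sufficiently large $n$ $$\mathcal P_0(\mathcal T\ge\tau)+\mathcal P_1(\mathcal T<\tau)\le 0.05 .$$ 2. For every $\epsilon>0$ there is a constant $C_2(\epsilon)>0$ such that, with $d=\lfloor 4/\epsilon\rfloor+3$, if $p=n^{-o(1)}$ and $1-p=n^{-o(1)}$, $(*)$ holds and $N_{\mathsf e}\ge C_2(\epsilon)/\rho^{2+\epsilon}$, then for all sufficiently large $n$ $$\mathcal P_0(\mathcal T\ge\tau)+\mathcal P_1(\mathcal T<\tau)\le 0.05 .$$ 3. $\mathcal T$ is computable in time $O(n^{N_{\mathsf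 e}})$: there are a single program for a real-number random access machine (unit cost for arithmetic on reals, for addition and truncated subtraction of natural numbers, for comparisons, for indirect memory access, and for adjacency queries to $G_1$, $G_2$) and a constant $K$ such that, for every $d\ge3$ and all sequences $p_n\in(0,1)$, $\rho_n\in(0,1]$, $\ell_n\ge1$ satisfying $(*)$, for all sufficiently large $n$ and all graphs $G_1,G_2$ on $[n]$ the program, on input $n,d,\ell_n,p_n,\rho_n$ and $G_1,G_2$, outputs $\mathcal T(G_1,G_2)$ after at most $K\,n^{N_{\mathsf e}}$ steps. -/

import Mathlib

open Filter Topology Asymptotics MeasureTheory unitInterval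
open scoped Nat NNReal ENNReal

namespace MotifCounting

/-! ### The two random graph models -/

/-- The bivariate Bernoulli law with both success probabilities `p` and correlation coefficient `ρ`
(the covariance of the two coordinates is `ρ p (1 - p)`). -/
noncomputable def bivariateBernoulli (p ρ : ℝ) : Measure (Bool × Bool) :=
  (p ^ 2 + ρ * p * (1 - p)).toNNReal • Measure.dirac (true, true)
    + ((1 - ρ) * p * (1 - p)).toNNReal • Measure.dirac (true, false)
    + ((1 - ρ) * p * (1 - p)).toNNReal • Measure.dirac (false, true)
    + ((1 - p) ^ 2 + ρ * p * (1 - p)).toNNReal • Measure.dirac (false, false)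

/-- The pair of graphs read off from a configuration `ω` of pairs of bits: the unordered pair `uv`
is an edge of the first graph according to the first bit of `ω uv`, and `π(u)π(v)` is an edge of
the second graph according to the second bit of `ω uv`. (Loops are discarded by `fromEdgeSet`.) -/
def graphPair {n : ℕ} (π : Equiv.Perm (Fin n)) (ω : Sym2 (Fin n) → Bool × Bool) :
    SimpleGraph (Fin n) × SimpleGraph (Fin n) :=
  (SimpleGraph.fromEdgeSet {e | (ω e).1 = true},
    SimpleGraph.fromEdgeSet (Sym2.map π '' {e | (ω e).2 = true}))

/-- The law of the pair of graphs given the latent bijection `π`: independent correlated pairs of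
edge indicators `(uv, π(u)π(v))`. -/
noncomputable def correlatedLawGiven (n : ℕ) (p ρ : ℝ) (π : Equiv.Perm (Fin n)) :
    Measure (SimpleGraph (Fin n) × SimpleGraph (Fin n)) :=
  Measure.map (graphPair π) (Measure.pi fun _ : Sym2 (Fin n) => bivariateBernoulli p ρ)

/-- The alternative: the correlated Erdős–Rényi model, with a uniformly random latent bijection. -/
noncomputable def correlatedLaw (n : ℕ) (p ρ : ℝ) :
    Measure (SimpleGraph (Fin n) × SimpleGraph (Fin n)) :=
  (n ! : ℝ≥0∞)⁻¹ • ∑ π : Equiv.Perm (Fin n), correlatedLawGiven n p ρ π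

/-- The null: two independent Erdős–Rényi graphs. -/
noncomputable def nullLaw (n : ℕ) (p : I) :
    Measure (SimpleGraph (Fin n) × SimpleGraph (Fin n)) :=
  (SimpleGraph.binomialRandom (Fin n) p).prod (SimpleGraph.binomialRandom (Fin n) p)

/-! ### Motif counting statistics -/

open Classical in
/-- Centered edge weight of the unordered pair `e` in `G`. -/
noncomputable def centeredWeight {n : ℕ} (p : ℝ) (G : SimpleGraph (Fin n)) (e : Sym2 (Fin n)) : ℝ :=
  (if e ∈ G.edgeSet then 1 else 0) - p

open Classical in
/-- The injective homomorphism number of `M` into the weighted graph obtained by centering `G`. -/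
noncomputable def inj {V : Type} [Fintype V] {n : ℕ} (p : ℝ) (M : SimpleGraph V)
    (G : SimpleGraph (Fin n)) : ℝ :=
  ∑ f : V ↪ Fin n, ∏ e ∈ M.edgeFinset, centeredWeight p G (e.map f)

/-- The number of automorphisms. -/
noncomputable def aut {V : Type} (M : SimpleGraph V) : ℕ := Nat.card (M ≃g M)

/-- The weight
`ρ ^ e(M) * (n - v(M))! / (n! * (p (1 - p)) ^ e(M) * aut(M))` of a motif.  (For `n < v(M)` it is
irrelevant, since then `inj` vanishes.) -/
noncomputable def weight {V : Type} [Fintype V] (n : ℕ) (p ρ : ℝ) (M : SimpleGraph V) : ℝ :=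
  ρ ^ M.edgeSet.ncard * ((n - Fintype.card V)! : ℝ)
    / ((n ! : ℝ) * (p * (1 - p)) ^ M.edgeSet.ncard * (aut M : ℝ))

/-- Graph isomorphism, as an equivalence relation on the graphs on `V`. -/
def isoSetoid (V : Type) : Setoid (SimpleGraph V) where
  r M M' := Nonempty (M ≃g M')
  iseqv := ⟨fun _ => ⟨RelIso.refl _⟩, fun ⟨f⟩ => ⟨f.symm⟩, fun ⟨f⟩ ⟨g⟩ => ⟨f.trans g⟩⟩

/-- A motif on `V`: an isomorphism class of graphs on `V`. -/
abbrev Motif (V : Type) : Type := Quotient (isoSetoid V)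

/-- The motif counting statistic of a family of motifs; the summand only depends on the isomorphism
class, so that the choice of representatives is immaterial. -/
noncomputable def motifStatistic {V : Type} [Fintype V] (𝓜 : Finset (Motif V)) (n : ℕ) (p ρ : ℝ)
    (G : SimpleGraph (Fin n) × SimpleGraph (Fin n)) : ℝ :=
  ∑ M ∈ 𝓜, weight n p ρ M.out * inj p M.out G.1 * inj p M.out G.2

/-! ### The special bounded degree family -/

/-- Vertices: `Sum.inl 0` and `Sum.inl 3` are the extremity vertices, `Sum.inl 1` and `Sum.inl 2`
the central vertices, `Sum.inr (i, t)` the `t`-th vertex of the `i`-th path. -/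
abbrev MotifVertex (d ℓ : ℕ) : Type := Fin 4 ⊕ (Fin (d - 1) × Fin ℓ)

/-- The edges (each in one orientation) of the motif whose cross edges between the paths `i < j`
are given by the perfect matching `z i j`. -/
def specialRel (d ℓ : ℕ) (z : Fin (d - 1) → Fin (d - 1) → Equiv.Perm (Fin ℓ)) :
    MotifVertex d ℓ → MotifVertex d ℓ → Prop
  | Sum.inl u, Sum.inl v => (u = 0 ∧ v = 1) ∨ (u = 2 ∧ v = 3)
  | Sum.inl u, Sum.inr (_, t) => (u = 1 ∧ (t : ℕ) = 0) ∨ (u = 2 ∧ (t : ℕ) + 1 = ℓ)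
  | Sum.inr (i, s), Sum.inr (j, t) => (i = j ∧ (s : ℕ) + 1 = t) ∨ (i < j ∧ z i j s = t)
  | Sum.inr _, Sum.inl _ => False

/-- The motif with cross edges `z`. -/
def specialGraph (d ℓ : ℕ) (z : Fin (d - 1) → Fin (d - 1) → Equiv.Perm (Fin ℓ)) :
    SimpleGraph (MotifVertex d ℓ) :=
  SimpleGraph.fromRel (specialRel d ℓ z)

open Classical in
/-- The special family: all isomorphism classes of the graphs `specialGraph d ℓ z`. -/
noncomputable def specialFamily (d ℓ : ℕ) : Finset (Motif (MotifVertex d ℓ)) :=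
  Finset.univ.image fun z => (Quotient.mk (isoSetoid _) (specialGraph d ℓ z))

/-- The number of edges of each motif of the special family. -/
def numEdges (d ℓ : ℕ) : ℕ := d.choose 2 * ℓ + d + 1

/-- The statistic of the special family. -/
noncomputable def specialStatistic (d ℓ n : ℕ) (p ρ : ℝ)
    (G : SimpleGraph (Fin n) × SimpleGraph (Fin n)) : ℝ :=
  motifStatistic (specialFamily d ℓ) n p ρ G

/-- The threshold: half of the mean of the statistic under the alternative. -/
noncomputable def threshold (d ℓ n : ℕ) (p ρ : ℝ) : ℝ :=
  (∫ G, specialStatistic d ℓ n p ρ G ∂(correlatedLaw n p ρ)) / 2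

/-- The sum of the Type I and Type II errors of the test that rejects the null when the statistic
is at least the threshold. -/
noncomputable def totalError (d ℓ n : ℕ) (p : I) (ρ : ℝ) : ℝ :=
  (nullLaw n p).real {G | threshold d ℓ n p ρ ≤ specialStatistic d ℓ n p ρ G}
    + (correlatedLaw n p ρ).real {G | specialStatistic d ℓ n p ρ G < threshold d ℓ n p ρ}

/-! ### Real random access machines with adjacency queries

A machine has a memory of natural numbers (used as counters and addresses) and a memory of real
numbers, both with indirect addressing. Each instruction and each test costs one step. -/

/-- The contents of the two memories. -/
structure RAMState where
  /-- The cells holding natural numbers. -/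
  nat : ℕ → ℕ
  /-- The cells holding real numbers. -/
  real : ℕ → ℝ

/-- The elementary instructions; the first argument is the destination. -/
inductive RAMInstr : Type
  | natConst (i c : ℕ)
  | natCopy (i j : ℕ)
  | natAdd (i j k : ℕ)
  | natSub (i j k : ℕ)
  | natLoad (i j : ℕ)
  | natStore (i j : ℕ)
  | realOfNat (i j : ℕ)
  | realCopy (i j : ℕ)
  | realAdd (i j k : ℕ)
  | realSub (i j k : ℕ)
  | realMul (i j k : ℕ)
  | realDiv (i j k : ℕ)
  | realLoad (i j : ℕ)
  | realStore (i j : ℕ)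
  | queryFst (i j k : ℕ)
  | querySnd (i j k : ℕ)

open Classical in
/-- The answer to an adjacency query. -/
noncomputable def adjQuery {n : ℕ} (G : SimpleGraph (Fin n)) (u v : ℕ) : ℕ :=
  if ∃ (hu : u < n) (hv : v < n), G.Adj ⟨u, hu⟩ ⟨v, hv⟩ then 1 else 0

/-- The effect of an instruction, on the input graphs `G`. Subtraction of naturals is truncated. -/
noncomputable def RAMInstr.run {n : ℕ} (G : SimpleGraph (Fin n) × SimpleGraph (Fin n)) :
    RAMInstr → RAMState → RAMState
  | natConst i c, s => { s with nat := Function.update s.nat i c }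
  | natCopy i j, s => { s with nat := Function.update s.nat i (s.nat j) }
  | natAdd i j k, s => { s with nat := Function.update s.nat i (s.nat j + s.nat k) }
  | natSub i j k, s => { s with nat := Function.update s.nat i (s.nat j - s.nat k) }
  | natLoad i j, s => { s with nat := Function.update s.nat i (s.nat (s.nat j)) }
  | natStore i j, s => { s with nat := Function.update s.nat (s.nat i) (s.nat j) }
  | realOfNat i j, s => { s with real := Function.update s.real i (s.nat j : ℝ) }
  | realCopy i j, s => { s with real := Function.update s.real i (s.real j) }
  | realAdd i j k, s => { s with real := Function.update s.real i (s.real j + s.real k) }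
  | realSub i j k, s => { s with real := Function.update s.real i (s.real j - s.real k) }
  | realMul i j k, s => { s with real := Function.update s.real i (s.real j * s.real k) }
  | realDiv i j k, s => { s with real := Function.update s.real i (s.real j / s.real k) }
  | realLoad i j, s => { s with real := Function.update s.real i (s.real (s.nat j)) }
  | realStore i j, s => { s with real := Function.update s.real (s.nat i) (s.real j) }
  | queryFst i j k, s =>
      { s with nat := Function.update s.nat i (adjQuery G.1 (s.nat j) (s.nat k)) }
  | querySnd i j k, s =>
      { s with nat := Function.update s.nat i (adjQuery G.2 (s.nat j) (s.nat k)) }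

/-- The tests. -/
inductive RAMTest : Type
  | natLt (i j : ℕ)
  | natEq (i j : ℕ)
  | realLe (i j : ℕ)

/-- The truth value of a test in a state. -/
def RAMTest.holds : RAMTest → RAMState → Prop
  | natLt i j, s => s.nat i < s.nat j
  | natEq i j, s => s.nat i = s.nat j
  | realLe i j, s => s.real i ≤ s.real j

/-- Programs. -/
inductive RAMProgram : Type
  | instr (c : RAMInstr)
  | seq (P Q : RAMProgram)
  | ite (b : RAMTest) (P Q : RAMProgram)
  | loop (b : RAMTest) (P : RAMProgram)

/-- `Exec G P s t s'`: on the input graphs `G`, the program `P` started in state `s` halts after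
exactly `t` steps in state `s'`. The command `loop b P` repeats `P` while `b` holds. -/
inductive Exec {n : ℕ} (G : SimpleGraph (Fin n) × SimpleGraph (Fin n)) :
    RAMProgram → RAMState → ℕ → RAMState → Prop
  | instr (c : RAMInstr) (s : RAMState) : Exec G (.instr c) s 1 (c.run G s)
  | seq {P Q : RAMProgram} {s s' s'' : RAMState} {t t' : ℕ} :
      Exec G P s t s' → Exec G Q s' t' s'' → Exec G (.seq P Q) s (t + t') s''
  | ite_true {b : RAMTest} {P Q : RAMProgram} {s s' : RAMState} {t : ℕ} :
      b.holds s → Exec G P s t s' → Exec G (.ite b P Q) s (t + 1) s'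
  | ite_false {b : RAMTest} {P Q : RAMProgram} {s s' : RAMState} {t : ℕ} :
      ¬ b.holds s → Exec G Q s t s' → Exec G (.ite b P Q) s (t + 1) s'
  | loop_false {b : RAMTest} {P : RAMProgram} {s : RAMState} :
      ¬ b.holds s → Exec G (.loop b P) s 1 s
  | loop_true {b : RAMTest} {P : RAMProgram} {s s' s'' : RAMState} {t t' : ℕ} :
      b.holds s → Exec G P s t s' → Exec G (.loop b P) s' t' s'' →
        Exec G (.loop b P) s (t + t' + 1) s''

/-- The initial state: the integers `n, d, ℓ` and the reals `p, ρ` are in the first cells, all other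
cells hold zero. (The two graphs are accessed by adjacency queries.) -/
def initialState (n d ℓ : ℕ) (p ρ : ℝ) : RAMState where
  nat i := if i = 0 then n else if i = 1 then d else if i = 2 then ℓ else 0
  real i := if i = 0 then p else if i = 1 then ρ else 0

/-- On the input `n, d, ℓ, p, ρ` and the graphs `G`, the program halts within `B` steps with the
value `x` in the real cell `0`. -/
def OutputsWithin {n : ℕ} (P : RAMProgram) (d ℓ : ℕ) (p ρ : ℝ)
    (G : SimpleGraph (Fin n) × SimpleGraph (Fin n)) (x B : ℝ) : Prop :=
  ∃ (t : ℕ) (s : RAMState),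
    Exec G P (initialState n d ℓ p ρ) t s ∧ s.real 0 = x ∧ (t : ℝ) ≤ B

/-- The growth condition `N = o(log n / max(log log n, -log ρ))` along sequences. -/
def SlowlyGrowing (N : ℕ → ℕ) (ρ : ℕ → ℝ) : Prop :=
  (fun n => (N n : ℝ)) =o[atTop]
    fun n : ℕ => Real.log n / max (Real.log (Real.log n)) (-Real.log (ρ n))

end MotifCounting

namespace MotifCounting

/-! ### Moments of a correlated pair of edges -/

/-! Write v and e for the numbers of vertices and edges of a motif, q = p(1-p), and S = |M| ρ^(2e)
with |M| the size of the family. The test works by Chebyshev's inequality (`totalError_le`). Edge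
bits are independent across pairs of vertices and centered, so a product of copies has nonzero mean
only if every edge is covered at least twice. For two copies this forces equal edge sets, and the
weights are normalized so that the mean under the alternative and the second moment under the null
are both S (`integral_bitStatistic`, `integral_nullLaw_sq_eq`). The second moment under the
alternative involves four copies. Those that coincide in two pairs contribute at most S² + 2S; all
others must be negligible.

The latter rests on `overlap_dichotomy`. Motifs are connected, of maximal degree d, with a leaf.
Counting degree deficits vertex by vertex shows that four copies that cover every edge twice but do
not pair up span 2v - k vertices with k ≥ 1 and at least 2e - dk/2 + 1/2 edges. Compared with paired
copies they lose a factor √q (n² q^d)^(-k/2). In the sparse regime da ≤ 2, so n² p^d ≥ 1 and √p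
gains a power of n; in the dense regime n² q^d ≥ n gains it. The number of overlap patterns, at most
(4v)^(4v), and the factor ρ^(-2e) are both n^(o(1)) by slow growth.

S is large because the family is large. There are (ℓ!)^C(d-1,2) choices of matchings, and an
isomorphism is determined along a spanning tree by few data, so one class absorbs at most v d^v of
them (`factorial_pow_le`). Thus log |M| is about C(d-1,2) ℓ log ℓ, to be compared with 2e |log ρ|,
about d(d-1) ℓ |log ρ|. The ratio 2d/(d-2) of the coefficients is the exponent of 1/ρ in the sparse
regime; it tends to 2 as d grows, whence the dense regime.

For the running time, isomorphism classes are never listed: the sum runs over all families of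
matchings, each term being divided by the number of isomorphisms onto its motif from the motifs of
all families (`specialStatistic_eq_sum`). Every loop has n^(o(1)) rounds, except those over the n^v
maps from the vertices to [n], and e ≥ v + 1 leaves a spare factor n. The program is compiled from
an expression, whose value and cost are computed separately. -/

theorem integral_bivariateBernoulli {p ρ : ℝ} (hp0 : 0 ≤ p) (hp1 : p ≤ 1) (hρ0 : 0 ≤ ρ)
    (hρ1 : ρ ≤ 1) (f : Bool × Bool → ℝ) :
    ∫ z, f z ∂(bivariateBernoulli p ρ) =
      (p ^ 2 + ρ * p * (1 - p)) * f (true, true) + (1 - ρ) * p * (1 - p) * f (true, false)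
        + (1 - ρ) * p * (1 - p) * f (false, true)
        + ((1 - p) ^ 2 + ρ * p * (1 - p)) * f (false, false) := by
  have hq : 0 ≤ 1 - p := by linarith
  have hr : 0 ≤ 1 - ρ := by linarith
  have h1 : 0 ≤ p ^ 2 + ρ * p * (1 - p) := by positivity
  have h2 : 0 ≤ (1 - ρ) * p * (1 - p) := by positivity
  have h3 : 0 ≤ (1 - p) ^ 2 + ρ * p * (1 - p) := by positivity
  have hi : ∀ (a : ℝ≥0) (z : Bool × Bool), Integrable f (a • Measure.dirac z) := fun a z =>
    Integrable.of_finite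
  unfold bivariateBernoulli
  rw [integral_add_measure ((hi _ _).add_measure (hi _ _) |>.add_measure (hi _ _)) (hi _ _),
    integral_add_measure ((hi _ _).add_measure (hi _ _)) (hi _ _),
    integral_add_measure (hi _ _) (hi _ _)]
  simp only [integral_smul_nnreal_measure, integral_dirac, NNReal.smul_def, smul_eq_mul,
    Real.coe_toNNReal _ h1, Real.coe_toNNReal _ h2, Real.coe_toNNReal _ h3]

theorem isProbabilityMeasure_bivariateBernoulli {p ρ : ℝ} (hp0 : 0 ≤ p) (hp1 : p ≤ 1) (hρ0 : 0 ≤ ρ)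
    (hρ1 : ρ ≤ 1) : IsProbabilityMeasure (bivariateBernoulli p ρ) := by
  have hfin : IsFiniteMeasure (bivariateBernoulli p ρ) := by
    unfold bivariateBernoulli; infer_instance
  have h := integral_bivariateBernoulli hp0 hp1 hρ0 hρ1 (fun _ => 1)
  rw [integral_const, smul_eq_mul, mul_one] at h
  have h' : (bivariateBernoulli p ρ).real Set.univ = 1 := by rw [h]; ring
  constructor
  rw [measureReal_def] at h'
  rw [← ENNReal.ofReal_toReal (measure_ne_top (bivariateBernoulli p ρ) Set.univ), h']
  simp

/-- The centered value of a bit. -/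
noncomputable def centeredBit (p : ℝ) (b : Bool) : ℝ := (if b = true then 1 else 0) - p

/-- Four bits read off from a pair: the even ones from the first coordinate, the odd ones from the
second. -/
def fourBits (z : Bool × Bool) : Fin 4 → Bool := ![z.1, z.2, z.1, z.2]

/-- The mixed moment of the bits selected by `b`. -/
noncomputable def edgeMoment (p ρ : ℝ) (b : Fin 4 → Prop) [DecidablePred b] : ℝ :=
  ∫ z, ∏ i, (if b i then centeredBit p (fourBits z i) else 1) ∂(bivariateBernoulli p ρ)

theorem edgeMoment_eq {p ρ : ℝ} (hp0 : 0 ≤ p) (hp1 : p ≤ 1) (hρ0 : 0 ≤ ρ)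
    (hρ1 : ρ ≤ 1) (b : Fin 4 → Prop) [DecidablePred b] :
    edgeMoment p ρ b =
      (p ^ 2 + ρ * p * (1 - p)) * ∏ i, (if b i then (1 - p) else 1)
        + (1 - ρ) * p * (1 - p) * ∏ i, (if b i then ![1 - p, -p, 1 - p, -p] i else 1)
        + (1 - ρ) * p * (1 - p) * ∏ i, (if b i then ![-p, 1 - p, -p, 1 - p] i else 1)
        + ((1 - p) ^ 2 + ρ * p * (1 - p)) * ∏ i, (if b i then (-p) else 1) := by
  rw [edgeMoment, integral_bivariateBernoulli hp0 hp1 hρ0 hρ1]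
  simp [Fin.prod_univ_four, fourBits, centeredBit]

theorem edgeMoment_eq_one {p ρ : ℝ} (hp0 : 0 ≤ p) (hp1 : p ≤ 1) (hρ0 : 0 ≤ ρ)
    (hρ1 : ρ ≤ 1) (b : Fin 4 → Prop) [DecidablePred b] (h : ∀ i, ¬ b i) :
    edgeMoment p ρ b = 1 := by
  rw [edgeMoment_eq hp0 hp1 hρ0 hρ1]
  simp [h]
  ring

/-- A single centered bit has mean zero. This is what forces every edge of a contributing
configuration to be covered at least twice. -/
theorem edgeMoment_eq_zero {p ρ : ℝ} (hp0 : 0 ≤ p) (hp1 : p ≤ 1) (hρ0 : 0 ≤ ρ)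
    (hρ1 : ρ ≤ 1) (b : Fin 4 → Prop) [DecidablePred b] {i : Fin 4} (hi : b i)
    (h : ∀ j, j ≠ i → ¬ b j) :
    edgeMoment p ρ b = 0 := by
  rw [edgeMoment_eq hp0 hp1 hρ0 hρ1]
  have hb : ∀ j, b j ↔ j = i := fun j => ⟨fun hj => by by_contra hne; exact h j hne hj,
    fun hj => hj ▸ hi⟩
  simp only [hb, Fin.prod_univ_four]
  fin_cases i <;> simp <;> ring

theorem edgeMoment_pair {p ρ : ℝ} (hp0 : 0 ≤ p) (hp1 : p ≤ 1) (hρ0 : 0 ≤ ρ)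
    (hρ1 : ρ ≤ 1) (b : Fin 4 → Prop) [DecidablePred b]
    (h : ((b 0 ∧ b 1) ∧ ¬ b 2 ∧ ¬ b 3) ∨ ((b 2 ∧ b 3) ∧ ¬ b 0 ∧ ¬ b 1)) :
    edgeMoment p ρ b = ρ * (p * (1 - p)) := by
  rw [edgeMoment_eq hp0 hp1 hρ0 hρ1]
  simp only [Fin.prod_univ_four]
  rcases h with ⟨⟨h0, h1⟩, h2, h3⟩ | ⟨⟨h2, h3⟩, h0, h1⟩ <;> simp [h0, h1, h2, h3] <;> ring

set_option maxHeartbeats 1000000 in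
theorem abs_edgeMoment_le {p ρ : ℝ} (hp0 : 0 ≤ p) (hp1 : p ≤ 1) (hρ0 : 0 ≤ ρ)
    (hρ1 : ρ ≤ 1) (b : Fin 4 → Prop) [DecidablePred b] {i j : Fin 4} (hij : i ≠ j) (hi : b i)
    (hj : b j) :
    |edgeMoment p ρ b| ≤ p * (1 - p) := by
  obtain ⟨q, rfl⟩ : ∃ q, p = 1 - q := ⟨1 - p, by ring⟩
  rw [edgeMoment_eq hp0 hp1 hρ0 hρ1, show 1 - (1 - q) = q by ring]
  have hq0 : 0 ≤ q := by linarith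
  have hq1 : q ≤ 1 := by linarith
  have hpq : 0 ≤ (1 - q) * q := mul_nonneg hp0 hq0
  have hpq4 : (1 - q) * q ≤ 1 / 4 := by nlinarith [sq_nonneg (1 - 2 * q)]
  have key : ∀ c : ℝ, |c| ≤ 1 → |(1 - q) * q * c| ≤ (1 - q) * q := fun c hc => by
    rw [abs_mul, abs_of_nonneg hpq]; nlinarith
  -- Up to the factor p(1-p), a moment of at least two bits is ρ or 1 (two bits), ρ(1-2p) (three
  -- bits) or ρ(1-2p)² + p(1-p) (four bits). Each of these has absolute value at most 1.
  have e1 : |ρ| ≤ 1 := by rw [abs_of_nonneg hρ0]; exact hρ1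
  have e2 : |ρ * (2 * q - 1)| ≤ 1 := by
    rw [abs_mul]
    have : |2 * q - 1| ≤ 1 := by rw [abs_le]; constructor <;> linarith
    nlinarith [abs_nonneg ρ, abs_nonneg (2 * q - 1)]
  have e3 : |ρ * (2 * q - 1) ^ 2 + (1 - q) * q| ≤ 1 := by
    have : 0 ≤ ρ * (2 * q - 1) ^ 2 := by positivity
    rw [abs_of_nonneg (by positivity)]
    nlinarith [mul_le_mul_of_nonneg_right hρ1 (sq_nonneg (2 * q - 1))]
  have e4 : |(1 : ℝ)| ≤ 1 := by simp
  simp only [Fin.prod_univ_four]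
  by_cases h0 : b 0 <;> by_cases h1 : b 1 <;> by_cases h2 : b 2 <;> by_cases h3 : b 3
  all_goals simp only [h0, h1, h2, h3, if_true, if_false, mul_one, one_mul, Matrix.cons_val]
  all_goals first
  | (exfalso; revert hi hj hij; fin_cases i <;> fin_cases j <;> simp [h0, h1, h2, h3]; done)
  | (refine le_of_eq_of_le (congrArg _ ?_) (key _ e1); ring; done)
  | (refine le_of_eq_of_le (congrArg _ ?_) (key _ e2); ring; done)
  | (refine le_of_eq_of_le (congrArg _ ?_) (key _ e3); ring; done)
  | (refine le_of_eq_of_le (congrArg _ ?_) (key _ e4); ring)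

/-! ### Products over edge sets -/

section QuadMean
variable {ι : Type} [Fintype ι] [DecidableEq ι] {p ρ : ℝ}

/-- The mean of the product of four centered monomials. -/
noncomputable def quadMean (p ρ : ℝ) (A : Fin 4 → Finset ι) : ℝ :=
  ∏ e, edgeMoment p ρ (fun i => e ∈ A i)

/-- Regrouping the product by edges instead of by copies makes it a product of independent factors.
-/
theorem integral_quad (hp0 : 0 ≤ p) (hp1 : p ≤ 1) (hρ0 : 0 ≤ ρ) (hρ1 : ρ ≤ 1)
    (A : Fin 4 → Finset ι) :
    ∫ ω : ι → Bool × Bool, ∏ i, ∏ e ∈ A i, centeredBit p (fourBits (ω e) i)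
      ∂(Measure.pi fun _ => bivariateBernoulli p ρ) = quadMean p ρ A := by
  have := isProbabilityMeasure_bivariateBernoulli hp0 hp1 hρ0 hρ1
  unfold quadMean edgeMoment
  rw [← integral_fintype_prod_eq_prod (𝕜 := ℝ)
    (f := fun e z => ∏ i, if e ∈ A i then centeredBit p (fourBits z i) else 1)]
  congr 1
  ext ω
  rw [Finset.prod_comm]
  refine Finset.prod_congr rfl fun i _ => ?_
  rw [Finset.prod_ite_mem, Finset.univ_inter]

theorem quadMean_eq_zero (hp0 : 0 ≤ p) (hp1 : p ≤ 1) (hρ0 : 0 ≤ ρ) (hρ1 : ρ ≤ 1)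
    (A : Fin 4 → Finset ι) {e : ι} {i : Fin 4} (hi : e ∈ A i) (h : ∀ j, j ≠ i → e ∉ A j) :
    quadMean p ρ A = 0 :=
  Finset.prod_eq_zero (Finset.mem_univ e) (edgeMoment_eq_zero hp0 hp1 hρ0 hρ1 _ hi h)

/-- A covered edge contributes at most p(1-p), whatever its multiplicity, so only the size of the
union of the copies matters. -/
theorem abs_quadMean_le (hp0 : 0 ≤ p) (hp1 : p ≤ 1) (hρ0 : 0 ≤ ρ) (hρ1 : ρ ≤ 1)
    (A : Fin 4 → Finset ι) (h : ∀ i, ∀ e ∈ A i, ∃ j, j ≠ i ∧ e ∈ A j) :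
    |quadMean p ρ A| ≤ (p * (1 - p)) ^ (Finset.univ.biUnion A).card := by
  have hpq : 0 ≤ p * (1 - p) := mul_nonneg hp0 (by linarith)
  rw [quadMean, Finset.abs_prod, ← Finset.prod_const, ← Finset.univ_inter (Finset.univ.biUnion A),
    ← Finset.prod_ite_mem]
  refine Finset.prod_le_prod (fun _ _ => abs_nonneg _) fun e _ => ?_
  split_ifs with he
  · obtain ⟨i, -, hi⟩ := Finset.mem_biUnion.1 he
    obtain ⟨j, hji, hj⟩ := h i e hi
    exact abs_edgeMoment_le hp0 hp1 hρ0 hρ1 _ hji hj hi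
  · rw [edgeMoment_eq_one hp0 hp1 hρ0 hρ1 _ fun i hi =>
      he (Finset.mem_biUnion.2 ⟨i, Finset.mem_univ _, hi⟩)]
    simp

theorem quadMean_pairs (hp0 : 0 ≤ p) (hp1 : p ≤ 1) (hρ0 : 0 ≤ ρ) (hρ1 : ρ ≤ 1)
    (A : Fin 4 → Finset ι) (h01 : A 0 = A 1) (h23 : A 2 = A 3) (hd : Disjoint (A 0) (A 2)) :
    quadMean p ρ A = (ρ * (p * (1 - p))) ^ ((A 0).card + (A 2).card) := by
  rw [quadMean, ← Finset.card_union_of_disjoint hd, ← Finset.prod_const,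
    ← Finset.univ_inter (A 0 ∪ A 2), ← Finset.prod_ite_mem]
  refine Finset.prod_congr rfl fun e _ => ?_
  have hdis : ¬ (e ∈ A 0 ∧ e ∈ A 2) := fun h => Finset.disjoint_left.1 hd h.1 h.2
  split_ifs with he
  · refine edgeMoment_pair hp0 hp1 hρ0 hρ1 _ ?_
    rw [← h01, ← h23]
    rcases Finset.mem_union.1 he with he | he <;> tauto
  · refine edgeMoment_eq_one hp0 hp1 hρ0 hρ1 _ fun i => ?_
    rw [Finset.mem_union, not_or] at he
    fin_cases i
    exacts [he.1, h01 ▸ he.1, he.2, h23 ▸ he.2]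

/-- The case of `integral_quad` in which two of the four copies are empty. -/
theorem integral_pair (hp0 : 0 ≤ p) (hp1 : p ≤ 1) (hρ0 : 0 ≤ ρ) (hρ1 : ρ ≤ 1)
    (A B : Finset ι) :
    ∫ ω : ι → Bool × Bool, (∏ e ∈ A, centeredBit p (ω e).1) * (∏ e ∈ B, centeredBit p (ω e).2)
      ∂(Measure.pi fun _ => bivariateBernoulli p ρ)
      = if A = B then (ρ * (p * (1 - p))) ^ A.card else 0 := by
  have h := integral_quad hp0 hp1 hρ0 hρ1 ![A, B, ∅, ∅]
  simp only [Fin.prod_univ_four, fourBits, Matrix.cons_val, Finset.prod_empty, mul_one] at h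
  rw [h]
  split_ifs with hAB
  · rw [quadMean_pairs hp0 hp1 hρ0 hρ1 _ (by simpa using hAB) (by simp) (by simp)]
    simp
  · obtain ⟨e, he⟩ : ∃ e, ¬ (e ∈ A ↔ e ∈ B) := by
      by_contra hc; push Not at hc; exact hAB (Finset.ext hc)
    by_cases hA : e ∈ A
    · refine quadMean_eq_zero hp0 hp1 hρ0 hρ1 _ (i := 0) (e := e) hA fun j hj => ?_
      fin_cases j <;> simp_all
    · refine quadMean_eq_zero hp0 hp1 hρ0 hρ1 _ (i := 1) (e := e) (by simp; tauto) fun j hj => ?_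
      fin_cases j <;> simp_all

end QuadMean

/-! ### Removing the latent bijection, and moments under the null. -/

section Reduction
variable {V : Type} [Fintype V] {n : ℕ}

open Classical in
/-- The edges of the copy of `M` placed by `f`. -/
noncomputable def imageEdges (M : SimpleGraph V) (f : V ↪ Fin n) : Finset (Sym2 (Fin n)) :=
  M.edgeFinset.map f.sym2Map

theorem mem_imageEdges {M : SimpleGraph V} {f : V ↪ Fin n} {e : Sym2 (Fin n)} :
    e ∈ imageEdges M f ↔ ∃ e' ∈ M.edgeSet, Sym2.map f e' = e := by
  simp [imageEdges]

theorem not_isDiag_of_mem_imageEdges {M : SimpleGraph V} {f : V ↪ Fin n} {e : Sym2 (Fin n)}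
    (h : e ∈ imageEdges M f) : ¬ e.IsDiag := by
  obtain ⟨e', he', rfl⟩ := mem_imageEdges.1 h
  have := M.not_isDiag_of_mem_edgeSet he'
  rwa [Sym2.isDiag_map f.injective]

theorem mk_mem_imageEdges {M : SimpleGraph V} {f : V ↪ Fin n} {a b : V} :
    s(f a, f b) ∈ imageEdges M f ↔ M.Adj a b := by
  rw [mem_imageEdges]
  constructor
  · rintro ⟨e', he', h⟩
    rw [← Sym2.map_mk] at h
    rw [Sym2.map.injective f.injective h] at he'
    exact he'
  · exact fun h => ⟨s(a, b), h, rfl⟩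

theorem exists_of_mk_mem_imageEdges {M : SimpleGraph V} {f : V ↪ Fin n} {x y : Fin n}
    (h : s(x, y) ∈ imageEdges M f) : ∃ a b, f a = x ∧ f b = y ∧ M.Adj a b := by
  obtain ⟨e', he', h⟩ := mem_imageEdges.1 h
  induction e' with
  | h a b =>
    rw [Sym2.map_mk, Sym2.eq_iff] at h
    rcases h with ⟨h1, h2⟩ | ⟨h1, h2⟩
    · exact ⟨a, b, h1, h2, he'⟩
    · exact ⟨b, a, h2, h1, M.adj_symm he'⟩

open Classical in
theorem card_imageEdges (M : SimpleGraph V) (f : V ↪ Fin n) :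
    (imageEdges M f).card = M.edgeFinset.card := by
  simp [imageEdges]

theorem card_imageEdges' (M : SimpleGraph V) (f : V ↪ Fin n) :
    (imageEdges M f).card = M.edgeSet.ncard := by
  classical
  rw [card_imageEdges, ← SimpleGraph.coe_edgeFinset, Set.ncard_coe_finset]

theorem inj_eq_sum_imageEdges (p : ℝ) (M : SimpleGraph V) (G : SimpleGraph (Fin n)) :
    inj p M G = ∑ f : V ↪ Fin n, ∏ e ∈ imageEdges M f, centeredWeight p G e := by
  classical
  unfold inj imageEdges
  simp only [Finset.prod_map]
  refine Finset.sum_congr rfl fun f _ => ?_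
  refine Finset.prod_congr ?_ fun e _ => rfl
  congr

theorem inj_graphPair_fst (p : ℝ) (M : SimpleGraph V) (π : Equiv.Perm (Fin n))
    (ω : Sym2 (Fin n) → Bool × Bool) :
    inj p M (graphPair π ω).1
      = ∑ f : V ↪ Fin n, ∏ e ∈ imageEdges M f, centeredBit p (ω e).1 := by
  rw [inj_eq_sum_imageEdges]
  refine Finset.sum_congr rfl fun f _ => Finset.prod_congr rfl fun e he => ?_
  have := not_isDiag_of_mem_imageEdges he
  simp [centeredWeight, centeredBit, graphPair, this]

/-- Composing all placements with `π` only permutes the terms of the sum, so the latent bijection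
disappears from the statistic. -/
theorem inj_graphPair_snd (p : ℝ) (M : SimpleGraph V) (π : Equiv.Perm (Fin n))
    (ω : Sym2 (Fin n) → Bool × Bool) :
    inj p M (graphPair π ω).2
      = ∑ f : V ↪ Fin n, ∏ e ∈ imageEdges M f, centeredBit p (ω e).2 := by
  classical
  rw [inj_eq_sum_imageEdges]
  rw [← Equiv.sum_comp (Equiv.embeddingCongr (Equiv.refl V) π)]
  refine Finset.sum_congr rfl fun f _ => ?_
  have himg : imageEdges M ((Equiv.embeddingCongr (Equiv.refl V) π) f)
      = (imageEdges M f).map π.toEmbedding.sym2Map := by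
    rw [imageEdges, imageEdges, Finset.map_map]
    congr 1
    ext e
    induction e with | h a b => simp
  rw [himg, Finset.prod_map]
  refine Finset.prod_congr rfl fun e he => ?_
  have := not_isDiag_of_mem_imageEdges he
  have h2 : Sym2.map π e ∈ Sym2.map π '' {e | (ω e).2 = true} ↔ (ω e).2 = true := by
    rw [(Sym2.map.injective π.injective).mem_set_image]; rfl
  have h3 : ¬ (Sym2.map π e).IsDiag := by rwa [Sym2.isDiag_map π.injective]
  simp only [Function.Embedding.sym2Map_apply, Equiv.coe_toEmbedding, centeredWeight, graphPair,
    SimpleGraph.edgeSet_fromEdgeSet, centeredBit]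
  congr 1
  refine if_congr ?_ rfl rfl
  rw [Set.mem_sdiff]
  simp [h2, h3]

/-- The statistic as a function of the configuration of bits, for the identity bijection. -/
noncomputable def bitStatistic (𝓜 : Finset (Motif V)) (n : ℕ) (p ρ : ℝ)
    (ω : Sym2 (Fin n) → Bool × Bool) : ℝ :=
  ∑ M ∈ 𝓜, weight n p ρ M.out * (∑ f : V ↪ Fin n, ∏ e ∈ imageEdges M.out f, centeredBit p (ω e).1)
    * (∑ f : V ↪ Fin n, ∏ e ∈ imageEdges M.out f, centeredBit p (ω e).2)

theorem motifStatistic_graphPair (𝓜 : Finset (Motif V)) (p ρ : ℝ) (π : Equiv.Perm (Fin n))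
    (ω : Sym2 (Fin n) → Bool × Bool) :
    motifStatistic 𝓜 n p ρ (graphPair π ω) = bitStatistic 𝓜 n p ρ ω := by
  simp only [motifStatistic, bitStatistic, inj_graphPair_fst, inj_graphPair_snd]

/-- On a finite space with measurable singletons every function is measurable and integrable against
a finite measure; this settles all measurability questions below. -/
instance : MeasurableSingletonClass (SimpleGraph (Fin n)) where
  measurableSet_singleton G := by
    have : ({G} : Set (SimpleGraph (Fin n))) = SimpleGraph.edgeSet ⁻¹' {G.edgeSet} := by
      ext H; simp
    rw [this]
    refine SimpleGraph.measurable_edgeSet ?_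
    exact measurableSet_eq

/-- Conditionally on any bijection the statistic has the same law, so the average over bijections is
trivial. The function `g` is later the identity and the square. -/
theorem integral_correlatedLaw {p ρ : ℝ} (hp0 : 0 ≤ p) (hp1 : p ≤ 1) (hρ0 : 0 ≤ ρ) (hρ1 : ρ ≤ 1)
    (𝓜 : Finset (Motif V)) (g : ℝ → ℝ) :
    ∫ G, g (motifStatistic 𝓜 n p ρ G) ∂(correlatedLaw n p ρ)
      = ∫ ω, g (bitStatistic 𝓜 n p ρ ω)
          ∂(Measure.pi fun _ : Sym2 (Fin n) => bivariateBernoulli p ρ) := by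
  have := isProbabilityMeasure_bivariateBernoulli hp0 hp1 hρ0 hρ1
  have hprob : ∀ π, IsFiniteMeasure (correlatedLawGiven n p ρ π) := fun π => by
    unfold correlatedLawGiven; infer_instance
  unfold correlatedLaw
  rw [integral_smul_measure, integral_finsetSum_measure fun π _ => Integrable.of_finite]
  have : ∀ π : Equiv.Perm (Fin n),
      ∫ G, g (motifStatistic 𝓜 n p ρ G) ∂(correlatedLawGiven n p ρ π)
      = ∫ ω, g (bitStatistic 𝓜 n p ρ ω)
          ∂(Measure.pi fun _ : Sym2 (Fin n) => bivariateBernoulli p ρ) := fun π => by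
    unfold correlatedLawGiven
    rw [integral_map (measurable_of_finite _).aemeasurable
      (measurable_of_finite _).aestronglyMeasurable]
    simp only [motifStatistic_graphPair]
  simp only [this, Finset.sum_const, Finset.card_univ, Fintype.card_perm, Fintype.card_fin,
    nsmul_eq_mul, smul_eq_mul]
  rw [← mul_assoc, ENNReal.toReal_inv, ENNReal.toReal_natCast, inv_mul_cancel₀, one_mul]
  exact_mod_cast (Nat.factorial_pos n).ne'

theorem isProbabilityMeasure_correlatedLaw {p ρ : ℝ} (hp0 : 0 ≤ p) (hp1 : p ≤ 1) (hρ0 : 0 ≤ ρ)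
    (hρ1 : ρ ≤ 1) : IsProbabilityMeasure (correlatedLaw n p ρ) := by
  have := isProbabilityMeasure_bivariateBernoulli hp0 hp1 hρ0 hρ1
  have hprob : ∀ π, IsProbabilityMeasure (correlatedLawGiven n p ρ π) := fun π => by
    unfold correlatedLawGiven
    exact Measure.isProbabilityMeasure_map (measurable_of_finite _).aemeasurable
  constructor
  unfold correlatedLaw
  simp only [Measure.smul_apply, Measure.finsetSum_apply, measure_univ, Finset.sum_const,
    Finset.card_univ, Fintype.card_perm, Fintype.card_fin, nsmul_eq_mul, mul_one, smul_eq_mul]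
  rw [ENNReal.inv_mul_cancel]
  · exact_mod_cast (Nat.factorial_pos n).ne'
  · exact ENNReal.natCast_ne_top _

/-- A pair covered by only one of the two sets contributes a centered factor of mean zero, and a
pair covered by both contributes the variance. Loops are excluded because they are never edges, so
their weight is the constant -p. -/
theorem integral_binomialRandom_pair (p : I) (A B : Finset (Sym2 (Fin n)))
    (hA : ∀ e ∈ A, ¬ e.IsDiag) (hB : ∀ e ∈ B, ¬ e.IsDiag) :
    ∫ G, (∏ e ∈ A, centeredWeight p G e) * (∏ e ∈ B, centeredWeight p G e)
      ∂(SimpleGraph.binomialRandom (Fin n) p)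
      = if A = B then ((p : ℝ) * (1 - p)) ^ A.card else 0 := by
  classical
  rw [SimpleGraph.binomialRandom_eq_map, ProbabilityTheory.setBernoulli_eq_map,
    Measure.infinitePi_eq_pi, integral_map (measurable_of_finite _).aemeasurable
      (measurable_of_finite _).aestronglyMeasurable,
    integral_map (measurable_of_finite _).aemeasurable
      (measurable_of_finite _).aestronglyMeasurable]
  set μ : Sym2 (Fin n) → Measure Prop := fun e =>
    toNNReal p • Measure.dirac (e ∈ Sym2.diagSetᶜ) + toNNReal (σ p) • Measure.dirac False with hμ
  have hfac : ∀ ω : Sym2 (Fin n) → Prop,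
      (∏ e ∈ A, centeredWeight (p : ℝ) (SimpleGraph.fromEdgeSet {i | ω i}) e)
        * (∏ e ∈ B, centeredWeight (p : ℝ) (SimpleGraph.fromEdgeSet {i | ω i}) e)
      = ∏ e, ((if e ∈ A then (if ω e then (1 : ℝ) else 0) - p else 1)
          * (if e ∈ B then (if ω e then (1 : ℝ) else 0) - p else 1)) := fun ω => by
    rw [Finset.prod_mul_distrib, Finset.prod_ite_mem, Finset.prod_ite_mem, Finset.univ_inter,
      Finset.univ_inter]
    congr 1 <;> refine Finset.prod_congr rfl fun e he => ?_
    · simp [centeredWeight, hA e he]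
    · simp [centeredWeight, hB e he]
  simp only [hfac]
  have hfin : ∀ e, IsFiniteMeasure (μ e) := fun e => by rw [hμ]; infer_instance
  refine (integral_fintype_prod_eq_prod (𝕜 := ℝ) (μ := μ) (fun (e : Sym2 (Fin n)) (x : Prop) =>
    ((if e ∈ A then (if x then (1 : ℝ) else 0) - p else 1)
          * (if e ∈ B then (if x then (1 : ℝ) else 0) - p else 1)))).trans ?_
  have hint : ∀ (e : Sym2 (Fin n)) (f : Prop → ℝ),
      ∫ x, f x ∂(μ e) = p * f (e ∈ Sym2.diagSetᶜ) + (1 - p) * f False := fun e f => by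
    rw [hμ, integral_add_measure Integrable.of_finite Integrable.of_finite]
    simp [integral_smul_nnreal_measure, NNReal.smul_def]
  simp only [hint]
  by_cases hAB : A = B
  · rw [if_pos hAB]
    subst hAB
    rw [← Finset.prod_const, ← Finset.univ_inter A, ← Finset.prod_ite_mem]
    refine Finset.prod_congr rfl fun e _ => ?_
    by_cases he : e ∈ A
    · simp [he, hA e he]; ring
    · simp [he]
  · rw [if_neg hAB]
    obtain ⟨e, he⟩ : ∃ e, ¬ (e ∈ A ↔ e ∈ B) := by
      by_contra hc; push Not at hc; exact hAB (Finset.ext hc)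
    refine Finset.prod_eq_zero (Finset.mem_univ e) ?_
    by_cases hA' : e ∈ A
    · have hB' : e ∉ B := by tauto
      simp [hA', hB', hA e hA']; ring
    · have hB' : e ∈ B := by tauto
      simp [hA', hB', hB e hB']; ring

-- The two graphs are independent with the same law, so for each pair of motifs the integral is the
-- square of a moment in one graph.
open Classical in
theorem integral_nullLaw_sq (p : I) (ρ : ℝ) (𝓜 : Finset (Motif V)) :
    ∫ G, motifStatistic 𝓜 n p ρ G ^ 2 ∂(nullLaw n p)
      = ∑ M ∈ 𝓜, ∑ M' ∈ 𝓜, weight n p ρ M.out * weight n p ρ M'.out *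
        (∑ f : V ↪ Fin n, ∑ g : V ↪ Fin n, if imageEdges M.out f = imageEdges M'.out g then
          ((p : ℝ) * (1 - p)) ^ (imageEdges M.out f).card else 0) ^ 2 := by
  have h1 : ∀ G : SimpleGraph (Fin n) × SimpleGraph (Fin n), motifStatistic 𝓜 n p ρ G ^ 2
      = ∑ M ∈ 𝓜, ∑ M' ∈ 𝓜, weight n p ρ M.out * weight n p ρ M'.out *
        ((inj p M.out G.1 * inj p M'.out G.1) * (inj p M.out G.2 * inj p M'.out G.2)) :=
    fun G => by
      rw [motifStatistic, sq, Finset.sum_mul_sum]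
      refine Finset.sum_congr rfl fun M _ => Finset.sum_congr rfl fun M' _ => ?_
      ring
  have h2 : ∀ M M' : Motif V, ∫ G, inj (p : ℝ) M.out G * inj (p : ℝ) M'.out G
      ∂(SimpleGraph.binomialRandom (Fin n) p)
      = ∑ f : V ↪ Fin n, ∑ g : V ↪ Fin n, if imageEdges M.out f = imageEdges M'.out g then
          ((p : ℝ) * (1 - p)) ^ (imageEdges M.out f).card else 0 := fun M M' => by
    simp only [inj_eq_sum_imageEdges, Finset.sum_mul_sum]
    rw [integral_finsetSum _ fun _ _ => Integrable.of_finite]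
    refine Finset.sum_congr rfl fun f _ => ?_
    rw [integral_finsetSum _ fun _ _ => Integrable.of_finite]
    refine Finset.sum_congr rfl fun g _ => ?_
    exact integral_binomialRandom_pair p _ _ (fun e => not_isDiag_of_mem_imageEdges)
      (fun e => not_isDiag_of_mem_imageEdges)
  have : IsProbabilityMeasure (nullLaw n p) := by unfold nullLaw; infer_instance
  simp only [h1]
  rw [integral_finsetSum _ fun _ _ => Integrable.of_finite]
  refine Finset.sum_congr rfl fun M _ => ?_
  rw [integral_finsetSum _ fun _ _ => Integrable.of_finite]
  refine Finset.sum_congr rfl fun M' _ => ?_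
  rw [integral_const_mul, nullLaw,
    integral_prod_mul (fun G => inj (p : ℝ) M.out G * inj (p : ℝ) M'.out G)
    (fun G => inj (p : ℝ) M.out G * inj (p : ℝ) M'.out G), h2, sq]

end Reduction

/-! ### Overlaps of four copies -/

section Overlap

/-- The vertices joined to `x` by an edge in `A`. -/
def nbr {α : Type} [Fintype α] [DecidableEq α] (A : Finset (Sym2 α)) (x : α) : Finset α :=
  Finset.univ.filter fun y => s(x, y) ∈ A

theorem mem_nbr {α : Type} [Fintype α] [DecidableEq α] {A : Finset (Sym2 α)} {x y : α} :
    y ∈ nbr A x ↔ s(x, y) ∈ A := by simp [nbr]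

theorem sum_card_nbr {α : Type} [Fintype α] [DecidableEq α] (A : Finset (Sym2 α))
    (hA : ∀ e ∈ A, ¬ e.IsDiag) : ∑ x, (nbr A x).card = 2 * A.card := by
  classical
  have h := (SimpleGraph.fromEdgeSet (A : Set (Sym2 α))).sum_degrees_eq_twice_card_edges
  have h1 : (SimpleGraph.fromEdgeSet (A : Set (Sym2 α))).edgeFinset.card = A.card := by
    congr 1
    ext e
    simp only [SimpleGraph.mem_edgeFinset, SimpleGraph.edgeSet_fromEdgeSet, Set.mem_sdiff,
      Finset.mem_coe, and_iff_left_iff_imp]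
    exact fun he => by simpa using hA e he
  rw [show A.card = _ from h1.symm]
  refine Eq.trans ?_ (h.trans (by congr!))
  refine Finset.sum_congr rfl fun x _ => ?_
  rw [← SimpleGraph.card_neighborFinset_eq_degree]
  congr 1
  ext y
  simp only [mem_nbr, SimpleGraph.mem_neighborFinset, SimpleGraph.fromEdgeSet_adj, Finset.mem_coe,
    ne_eq, iff_self_and]
  exact fun he hxy => hA _ he (by simp [hxy])

variable {V : Type} [Fintype V] {n : ℕ}

open Classical in
theorem card_nbr_imageEdges (M : SimpleGraph V) (f : V ↪ Fin n) (a : V) :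
    (nbr (imageEdges M f) (f a)).card = M.degree a := by
  rw [← SimpleGraph.card_neighborFinset_eq_degree, ← Finset.card_map f]
  congr 1
  ext y
  simp only [mem_nbr, Finset.mem_map, SimpleGraph.mem_neighborFinset]
  constructor
  · intro h
    obtain ⟨a', b', h1, h2, h3⟩ := exists_of_mk_mem_imageEdges h
    rw [f.injective h1] at h3
    exact ⟨b', h3, h2⟩
  · rintro ⟨b, h, rfl⟩
    exact mk_mem_imageEdges.2 h

open Classical in
/-- Four copies of connected graphs of maximal degree at most `d`, all of whose edges are covered
at least twice, either coincide in two pairs or have a small union. -/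
theorem overlap_dichotomy {d e : ℕ} (M : Fin 4 → SimpleGraph V) (F : Fin 4 → (V ↪ Fin n))
    (hconn : ∀ i, (M i).Preconnected) (hdeg : ∀ i a, (M i).degree a ≤ d)
    (hlow : ∀ i, ∃ a, (M i).degree a < d) (hpos : ∀ i a, ∃ b, (M i).Adj a b)
    (hcard : ∀ i, (M i).edgeSet.ncard = e)
    (hcov : ∀ i, ∀ x ∈ imageEdges (M i) (F i), ∃ j, j ≠ i ∧ x ∈ imageEdges (M j) (F j)) :
    let A := fun i => imageEdges (M i) (F i)
    ((A 0 = A 1 ∧ A 2 = A 3 ∧ Disjoint (A 0) (A 2)) ∨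
      (A 0 = A 2 ∧ A 1 = A 3 ∧ Disjoint (A 0) (A 1)) ∨
      (A 0 = A 3 ∧ A 1 = A 2 ∧ Disjoint (A 0) (A 1))) ∨
    ((Finset.univ.biUnion fun i => Finset.univ.map (F i)).card + 1 ≤ 2 * Fintype.card V ∧
      d * (Finset.univ.biUnion fun i => Finset.univ.map (F i)).card + 4 * e + 1
        ≤ 2 * Fintype.card V * d + 2 * (Finset.univ.biUnion A).card) := by
  intro A
  set W : Finset (Fin n) := Finset.univ.biUnion fun i => Finset.univ.map (F i) with hW
  set U : Finset (Sym2 (Fin n)) := Finset.univ.biUnion A with hU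
  have hAdiag : ∀ i, ∀ x ∈ A i, ¬ x.IsDiag := fun i x hx => not_isDiag_of_mem_imageEdges hx
  have hUdiag : ∀ x ∈ U, ¬ x.IsDiag := fun x hx => by
    obtain ⟨i, -, hi⟩ := Finset.mem_biUnion.1 hx
    exact hAdiag i x hi
  have hAU : ∀ i, A i ⊆ U := fun i => Finset.subset_biUnion_of_mem A (Finset.mem_univ i)
  have hend : ∀ {i x y}, s(x, y) ∈ A i → ∃ a b, F i a = x ∧ F i b = y ∧ (M i).Adj a b :=
    fun h => exists_of_mk_mem_imageEdges h
  -- the copies through a vertex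
  set K : Fin n → Finset (Fin 4) := fun x => Finset.univ.filter fun i => ∃ a, F i a = x with hK
  have hmemK : ∀ {x i}, i ∈ K x ↔ ∃ a, F i a = x := by simp [hK]
  have hKmem : ∀ i a, i ∈ K (F i a) := fun i a => hmemK.2 ⟨a, rfl⟩
  have hmemW : ∀ {x}, x ∈ W ↔ (K x).Nonempty := by
    intro x; simp [hW, hK, Finset.filter_nonempty_iff]
  have hNle : ∀ i x, (nbr (A i) x).card ≤ (nbr U x).card := fun i x =>
    Finset.card_le_card fun y hy => mem_nbr.2 (hAU i (mem_nbr.1 hy))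
  have hNd : ∀ {i x}, i ∈ K x → (nbr (A i) x).card ≤ d := by
    intro i x h
    obtain ⟨a, rfl⟩ := hmemK.1 h
    rw [card_nbr_imageEdges]; exact hdeg i a
  have hN0 : ∀ {i x}, i ∉ K x → (nbr (A i) x).card = 0 := by
    intro i x h
    rw [Finset.card_eq_zero, Finset.eq_empty_iff_forall_notMem]
    intro y hy
    obtain ⟨a, b, h1, -, -⟩ := hend (mem_nbr.1 hy)
    exact h (hmemK.2 ⟨a, h1⟩)
  have hpair : ∀ {i x}, i ∈ K x → ∃ j ∈ K x, j ≠ i := by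
    intro i x h
    obtain ⟨a, rfl⟩ := hmemK.1 h
    obtain ⟨b, hab⟩ := hpos i a
    obtain ⟨j, hj, hj'⟩ := hcov i _ (mk_mem_imageEdges.2 hab)
    obtain ⟨a', b', h1, -, -⟩ := exists_of_mk_mem_imageEdges hj'
    exact ⟨j, hmemK.2 ⟨a', h1⟩, hj⟩
  have hK2 : ∀ x ∈ W, 2 ≤ (K x).card := fun x hx => by
    obtain ⟨i, hi⟩ := hmemW.1 hx
    obtain ⟨j, hj, hne⟩ := hpair hi
    exact Finset.one_lt_card.2 ⟨j, hj, i, hi, hne⟩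
  have hsumK : ∑ x ∈ W, (K x).card = 4 * Fintype.card V := by
    have h1 : ∑ x ∈ W, (K x).card = ∑ x, (K x).card :=
      Finset.sum_subset (Finset.subset_univ _) fun x _ hx => by
        rw [Finset.card_eq_zero]; by_contra hne
        exact hx (hmemW.2 (Finset.nonempty_iff_ne_empty.2 hne))
    have h2 : ∀ x, (K x).card = ∑ i, if ∃ a, F i a = x then 1 else 0 := fun x => by
      rw [hK, Finset.card_filter]
    have h3 : ∀ i, (∑ x, if ∃ a, F i a = x then 1 else 0) = Fintype.card V := fun i => by
      rw [← Finset.card_filter, ← Finset.card_univ, ← Finset.card_map (F i)]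
      congr 1; ext x; simp
    rw [h1, Finset.sum_congr rfl fun x _ => h2 x, Finset.sum_comm,
      Finset.sum_congr rfl fun i _ => h3 i]
    simp
  have hsumN : ∀ i, ∑ x, (nbr (A i) x).card = 2 * e := fun i => by
    rw [sum_card_nbr _ (hAdiag i), card_imageEdges', hcard]
  have hsumU : ∑ x ∈ W, (nbr U x).card = 2 * U.card := by
    rw [← sum_card_nbr _ hUdiag]
    refine Finset.sum_subset (Finset.subset_univ _) fun x _ hx => ?_
    rw [Finset.card_eq_zero, Finset.eq_empty_iff_forall_notMem]
    intro y hy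
    obtain ⟨i, -, hi⟩ := Finset.mem_biUnion.1 (mem_nbr.1 hy)
    obtain ⟨a, b, h1, -, -⟩ := hend hi
    exact hx (hmemW.2 ⟨i, hmemK.2 ⟨a, h1⟩⟩)
  -- The degree deficits d - deg of the copies through x, minus twice the deficit of their union.
  -- This is nonnegative at each vertex, because x lies in at least two copies and each has smaller
  -- degree than the union, while its sum over all vertices is linear in the numbers of vertices and
  -- edges of the union.
  set δ : Fin n → ℤ := fun x =>
    ∑ i ∈ K x, ((d : ℤ) - (nbr (A i) x).card) - 2 * ((d : ℤ) - (nbr U x).card) with hδ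
  have hsumδ : ∑ x ∈ W, δ x
      = 4 * Fintype.card V * d - 8 * e - 2 * (d * W.card) + 4 * U.card := by
    have h1 : ∀ x, ∑ i ∈ K x, ((d : ℤ) - (nbr (A i) x).card)
        = (K x).card * d - ∑ i, ((nbr (A i) x).card : ℤ) := fun x => by
      rw [Finset.sum_sub_distrib, Finset.sum_const, nsmul_eq_mul]
      congr 1
      exact Finset.sum_subset (Finset.subset_univ _) fun i _ hi => by rw [hN0 hi]; rfl
    have h2 : ∑ x ∈ W, ∑ i, ((nbr (A i) x).card : ℤ) = 8 * e := by
      have : ∑ x ∈ W, ∑ i, ((nbr (A i) x).card : ℤ) = ∑ x, ∑ i, ((nbr (A i) x).card : ℤ) :=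
        Finset.sum_subset (Finset.subset_univ _) fun x _ hx => by
          refine Finset.sum_eq_zero fun i _ => ?_
          rw [hN0 fun hi => hx (hmemW.2 ⟨i, hi⟩)]; rfl
      rw [this, Finset.sum_comm]
      have h3 : ∀ i, ∑ x, ((nbr (A i) x).card : ℤ) = 2 * e := fun i => by
        exact_mod_cast hsumN i
      simp only [h3, Finset.sum_const, Finset.card_univ, Fintype.card_fin]
      ring
    have h3 : ∑ x ∈ W, ((nbr U x).card : ℤ) = 2 * U.card := by exact_mod_cast hsumU
    have h4 : ∑ x ∈ W, ((K x).card : ℤ) = 4 * Fintype.card V := by exact_mod_cast hsumK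
    simp only [hδ, h1, Finset.sum_sub_distrib, ← Finset.mul_sum, ← Finset.sum_mul, h2, h3, h4,
      Finset.sum_const, nsmul_eq_mul]
    ring
  have hδ2 : ∀ {x i j}, i ∈ K x → j ∈ K x → i ≠ j →
      2 * ((nbr U x).card : ℤ) - (nbr (A i) x).card - (nbr (A j) x).card ≤ δ x := by
    intro x i j hi hj hij
    have h := Finset.sum_le_sum_of_subset_of_nonneg
      (f := fun l => ((d : ℤ) - (nbr (A l) x).card)) (s := {i, j}) (t := K x)
      (by intro l hl; simp at hl; rcases hl with rfl | rfl <;> assumption)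
      (fun l hl _ => by have := hNd hl; omega)
    rw [Finset.sum_pair hij] at h
    simp only [hδ]
    linarith
  have hδ3 : ∀ {x i j l}, i ∈ K x → j ∈ K x → l ∈ K x → i ≠ j → i ≠ l → j ≠ l →
      2 * ((nbr U x).card : ℤ) - (nbr (A i) x).card - (nbr (A j) x).card
        + (d - (nbr (A l) x).card) ≤ δ x := by
    intro x i j l hi hj hl hij hil hjl
    have h := Finset.sum_le_sum_of_subset_of_nonneg
      (f := fun l => ((d : ℤ) - (nbr (A l) x).card)) (s := {i, j, l}) (t := K x)
      (by intro l hl; simp at hl; rcases hl with rfl | rfl | rfl <;> assumption)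
      (fun l hl _ => by have := hNd hl; omega)
    rw [Finset.sum_insert (by simp [hij, hil]), Finset.sum_pair hjl] at h
    simp only [hδ]
    linarith
  have hδ0 : ∀ x ∈ W, 0 ≤ δ x := fun x hx => by
    obtain ⟨i, hi⟩ := hmemW.1 hx
    obtain ⟨j, hj, hne⟩ := hpair hi
    have := hδ2 hj hi hne
    have := hNle i x
    have := hNle j x
    omega
  by_contra hcon
  rw [not_or] at hcon
  obtain ⟨hcon1, hcon2⟩ := hcon
  apply hcon1
  -- local structure
  have hlocal : (∀ {x i j}, i ∈ K x → j ∈ K x → nbr (A i) x = nbr (A j) x) ∧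
      (∀ {x i j l}, i ∈ K x → j ∈ K x → l ∈ K x → i ≠ j → i ≠ l → j ≠ l →
        (nbr (A l) x).card = d) := by
    -- If the union has fewer than 2v vertices, failure of the edge bound makes the sum of δ at most
    -- 0, so δ vanishes everywhere and all copies through a vertex have there the same neighbors as
    -- the union. Otherwise every vertex lies in exactly two copies.
    by_cases hw : W.card + 1 ≤ 2 * Fintype.card V
    · have hD : ∑ x ∈ W, δ x ≤ 0 := by
        have hlt : ¬ _ := fun h => hcon2 ⟨hw, h⟩
        rw [not_le] at hlt
        rw [hsumδ]
        zify at hlt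
        linarith
      have hz : ∀ x ∈ W, δ x = 0 :=
        (Finset.sum_eq_zero_iff_of_nonneg hδ0).1 (le_antisymm hD (Finset.sum_nonneg hδ0))
      have hNU : ∀ {x i}, i ∈ K x → nbr (A i) x = nbr U x := by
        intro x i hi
        refine Finset.eq_of_subset_of_card_le (fun y hy => mem_nbr.2 (hAU i (mem_nbr.1 hy))) ?_
        obtain ⟨j, hj, hne⟩ := hpair hi
        have h1 := hδ2 hj hi hne
        rw [hz x (hmemW.2 ⟨i, hi⟩)] at h1
        have := hNle i x
        have := hNle j x
        omega
      refine ⟨fun hi hj => (hNU hi).trans (hNU hj).symm, fun {x i j l} hi hj hl hij hil hjl => ?_⟩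
      have h1 := hδ3 hi hj hl hij hil hjl
      rw [hz x (hmemW.2 ⟨i, hi⟩)] at h1
      have := hNd hl
      have := hNle i x
      have := hNle j x
      omega
    · have hKeq : ∀ x ∈ W, (K x).card = 2 := by
        have h1 : ∑ x ∈ W, 2 ≤ ∑ x ∈ W, (K x).card := Finset.sum_le_sum hK2
        have h2 : ∑ x ∈ W, (2 : ℕ) = ∑ x ∈ W, (K x).card := by
          refine le_antisymm h1 ?_
          rw [hsumK, Finset.sum_const, smul_eq_mul]; omega
        exact fun x hx => ((Finset.sum_eq_sum_iff_of_le hK2).1 h2 x hx).symm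
      have hno : ∀ {x i j l}, i ∈ K x → j ∈ K x → l ∈ K x → i ≠ j → i ≠ l → j ≠ l → False := by
        intro x i j l hi hj hl hij hil hjl
        have h1 := hKeq x (hmemW.2 ⟨i, hi⟩)
        have h2 : ({i, j, l} : Finset (Fin 4)).card ≤ (K x).card := Finset.card_le_card (by
          intro l hl; simp at hl; rcases hl with rfl | rfl | rfl <;> assumption)
        rw [Finset.card_eq_three.2 ⟨i, j, l, hij, hil, hjl, rfl⟩] at h2
        omega
      -- An edge of one copy at x is covered by a second copy, which passes through x; as no third
      -- copy does, it is the given one.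
      have hsub : ∀ {x i j}, i ∈ K x → j ∈ K x → nbr (A i) x ⊆ nbr (A j) x := by
        intro x i j hi hj y hy
        by_cases hij : i = j
        · rwa [← hij]
        obtain ⟨l, hl, hl'⟩ := hcov i _ (mem_nbr.1 hy)
        obtain ⟨a, b, h1, -, -⟩ := exists_of_mk_mem_imageEdges hl'
        have hlK : l ∈ K x := hmemK.2 ⟨a, h1⟩
        by_cases hlj : l = j
        · rw [← hlj]; exact mem_nbr.2 hl'
        · exact (hno hi hj hlK hij (Ne.symm hl) (Ne.symm hlj)).elim
      exact ⟨fun hi hj => (hsub hi hj).antisymm (hsub hj hi),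
        fun hi hj hl hij hil hjl => (hno hi hj hl hij hil hjl).elim⟩
  obtain ⟨hagree, htriple⟩ := hlocal
  -- propagation along walks
  have hprop : ∀ {i j x}, i ∈ K x → j ∈ K x → ∀ a, j ∈ K (F i a) := by
    intro i j x hi hj a
    obtain ⟨a₀, rfl⟩ := hmemK.1 hi
    obtain ⟨p⟩ := hconn i a₀ a
    induction p with
    | nil => exact hj
    | @cons u v' w hadj p ih =>
      refine ih (hKmem i _) ?_
      have h1 : F i v' ∈ nbr (A i) (F i u) := mem_nbr.2 (mk_mem_imageEdges.2 hadj)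
      rw [hagree (hKmem i u) hj] at h1
      obtain ⟨a, b, -, h2, -⟩ := exists_of_mk_mem_imageEdges (mem_nbr.1 h1)
      exact hmemK.2 ⟨b, h2⟩
  have hsub : ∀ {i j x}, i ∈ K x → j ∈ K x → A i ⊆ A j := by
    intro i j x hi hj y hy
    induction y with
    | h y z =>
      obtain ⟨a, b, rfl, rfl, hab⟩ := hend hy
      have := hagree (hKmem i a) (hprop hi hj a)
      rw [← mem_nbr, ← this]
      exact mem_nbr.2 hy
  have heq : ∀ {i j x}, i ∈ K x → j ∈ K x → A i = A j := fun hi hj =>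
    (hsub hi hj).antisymm (hsub hj hi)
  have hedge : ∀ {i j y}, y ∈ A i → y ∈ A j → ∃ x, i ∈ K x ∧ j ∈ K x := by
    intro i j y hi hj
    induction y with
    | h y z =>
      obtain ⟨a, -, h1, -, -⟩ := hend hi
      obtain ⟨b, -, h2, -, -⟩ := hend hj
      exact ⟨y, hmemK.2 ⟨a, h1⟩, hmemK.2 ⟨b, h2⟩⟩
  have hne : ∀ i, (A i).Nonempty := fun i => by
    obtain ⟨a, -⟩ := hlow i
    obtain ⟨b, hab⟩ := hpos i a
    exact ⟨_, mk_mem_imageEdges.2 hab⟩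
  have hdis : ∀ {i j}, A i ≠ A j → Disjoint (A i) (A j) := by
    intro i j hij
    rw [Finset.disjoint_left]
    intro y hi hj
    obtain ⟨x, h1, h2⟩ := hedge hi hj
    exact hij (heq h1 h2)
  have hex : ∀ i, ∃ j, j ≠ i ∧ A i = A j := fun i => by
    obtain ⟨y, hy⟩ := hne i
    obtain ⟨j, hj, hj'⟩ := hcov i y hy
    obtain ⟨x, h1, h2⟩ := hedge hy hj'
    exact ⟨j, hj, heq h1 h2⟩
  -- A vertex common to three copies has full degree d in each of them, which fails at a vertex of
  -- smaller degree. This is the role of the extremity vertices.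
  have hno3 : ∀ {i j l}, i ≠ j → i ≠ l → j ≠ l → A l = A i → A l = A j → False := by
    intro i j l hij hil hjl h1 h2
    obtain ⟨a, ha⟩ := hlow l
    obtain ⟨y, hy⟩ := hne l
    obtain ⟨x, hx1, hx2⟩ := hedge hy (h1 ▸ hy)
    obtain ⟨x', hx1', hx2'⟩ := hedge hy (h2 ▸ hy)
    have h := htriple (hprop hx1 hx2 a) (hprop hx1' hx2' a) (hKmem l a) hij hil hjl
    rw [card_nbr_imageEdges] at h
    omega
  obtain ⟨j, hj, h0⟩ := hex 0
  fin_cases j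
  · exact absurd rfl hj
  · left
    obtain ⟨k, hk, h2⟩ := hex 2
    have h02 : A 0 ≠ A 2 := fun h =>
      hno3 (l := 0) (i := 1) (j := 2) (by decide) (by decide) (by decide) h0 h
    fin_cases k
    · exact absurd h2.symm h02
    · exact absurd (h2.trans h0.symm).symm h02
    · exact absurd rfl hk
    · exact ⟨h0, h2, hdis h02⟩
  · right; left
    obtain ⟨k, hk, h2⟩ := hex 1
    have h02 : A 0 ≠ A 1 := fun h =>
      hno3 (l := 0) (i := 1) (j := 2) (by decide) (by decide) (by decide) h h0
    fin_cases k
    · exact absurd h2.symm h02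
    · exact absurd rfl hk
    · exact absurd (h2.trans h0.symm).symm h02
    · exact ⟨h0, h2, hdis h02⟩
  · right; right
    obtain ⟨k, hk, h2⟩ := hex 1
    have h02 : A 0 ≠ A 1 := fun h =>
      hno3 (l := 0) (i := 1) (j := 3) (by decide) (by decide) (by decide) h h0
    fin_cases k
    · exact absurd h2.symm h02
    · exact absurd rfl hk
    · exact ⟨h0, h2, hdis h02⟩
    · exact absurd (h2.trans h0.symm).symm h02

end Overlap

/-! ### Counting placements -/

section Counting

open Classical in
/-- Weighting each map by the inverse number of maps with the same kernel, the total is at most the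
number of self-maps of the domain. -/
theorem sum_inv_pow_card_image_le {A : Type} [Fintype A] {n : ℕ} :
    ∑ F : A → Fin n, ((n : ℝ) ^ (Finset.univ.image F).card)⁻¹
      ≤ (Fintype.card A : ℝ) ^ Fintype.card A := by
  rcases isEmpty_or_nonempty A with hA | hA
  · simp
  rcases Nat.eq_zero_or_pos n with rfl | hn
  · have : IsEmpty (A → Fin 0) := by
      rw [isEmpty_fun]; exact ⟨hA, inferInstance⟩
    simp
  -- Each point is sent to a chosen representative of its fiber. The resulting self-map records the
  -- kernel of F, and its image has as many points as that of F.
  set r : (A → Fin n) → (A → A) := fun F a => Function.invFun F (F a) with hr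
  have hFr : ∀ (F : A → Fin n) (a : A), F (r F a) = F a :=
    fun F a => Function.invFun_eq ⟨a, rfl⟩
  have hcard : ∀ F : A → Fin n,
      (Finset.univ.image F).card = (Finset.univ.image (r F)).card := fun F => by
    have : Finset.univ.image (r F) = (Finset.univ.image F).image (Function.invFun F) := by
      rw [Finset.image_image]; rfl
    rw [this]
    refine (Finset.card_image_of_injOn ?_).symm
    intro x hx y hy hxy
    simp only [Finset.coe_image, Finset.coe_univ, Set.image_univ, Set.mem_range] at hx hy
    rw [← Function.invFun_eq hx, hxy, Function.invFun_eq hy]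
  rw [← Finset.sum_fiberwise (s := Finset.univ) (g := r)]
  have hone : ∀ ψ : A → A, ∑ F ∈ Finset.univ.filter (fun F => r F = ψ),
      ((n : ℝ) ^ (Finset.univ.image F).card)⁻¹ ≤ 1 := fun ψ => by
    have h1 : ∀ F ∈ Finset.univ.filter (fun F => r F = ψ),
        ((n : ℝ) ^ (Finset.univ.image F).card)⁻¹
          = ((n : ℝ) ^ (Finset.univ.image ψ).card)⁻¹ := fun F hF => by
      rw [hcard, (Finset.mem_filter.1 hF).2]
    rw [Finset.sum_congr rfl h1, Finset.sum_const, nsmul_eq_mul]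
    -- A map with `r F = ψ` is determined by its values on the image of ψ, so there are at most n to
    -- the size of that image.
    have h2 : (Finset.univ.filter (fun F : A → Fin n => r F = ψ)).card
        ≤ Fintype.card ((Finset.univ.image ψ) → Fin n) := by
      rw [← Finset.card_univ]
      refine Finset.card_le_card_of_injOn (fun F a => F a) (fun _ _ => Finset.mem_univ _) ?_
      intro F hF G hG hFG
      simp only [Finset.coe_filter, Finset.mem_univ, true_and, Set.mem_ofPred_eq] at hF hG
      ext a
      rw [← hFr F a, ← hFr G a, hF, hG]
      have := congrFun hFG ⟨ψ a, Finset.mem_image_of_mem _ (Finset.mem_univ _)⟩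
      simp only at this
      rw [this]
    rw [Fintype.card_fun, Fintype.card_fin, Fintype.card_coe] at h2
    have h3 : (0 : ℝ) < (n : ℝ) ^ (Finset.univ.image ψ).card := by positivity
    rw [← div_eq_mul_inv, div_le_one h3]
    exact_mod_cast h2
  calc _ ≤ ∑ _ψ : A → A, (1 : ℝ) := Finset.sum_le_sum fun ψ _ => hone ψ
    _ = _ := by simp

theorem sum_fin_four {E : Type} [Fintype E] (h : (Fin 4 → E) → ℝ) :
    ∑ F, h F = ∑ a, ∑ b, ∑ c, ∑ d, h ![a, b, c, d] := by
  let eq : (Fin 4 → E) ≃ E × E × E × E :=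
    { toFun := fun F => (F 0, F 1, F 2, F 3)
      invFun := fun t => ![t.1, t.2.1, t.2.2.1, t.2.2.2]
      left_inv := fun F => by ext i; fin_cases i <;> rfl
      right_inv := fun t => rfl }
  rw [← Equiv.sum_comp eq.symm]
  simp only [Fintype.sum_prod_type]
  rfl

variable {V : Type} [Fintype V] {n : ℕ}

/-- Without isolated vertices, the edges of a copy determine its vertices; comparing the two
placements point by point yields the isomorphism. -/
theorem exists_iso_of_imageEdges_eq {M M' : SimpleGraph V} (hM : ∀ a, ∃ b, M.Adj a b)
    (hM' : ∀ a, ∃ b, M'.Adj a b) {f g : V ↪ Fin n} (h : imageEdges M f = imageEdges M' g) :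
    ∃ τ : M' ≃g M, ∀ a, f (τ a) = g a := by
  have h1 : ∀ a, ∃ b, f b = g a := fun a => by
    obtain ⟨b, hab⟩ := hM' a
    have := mk_mem_imageEdges (f := g).2 hab
    rw [← h] at this
    obtain ⟨c, -, hc, -, -⟩ := exists_of_mk_mem_imageEdges this
    exact ⟨c, hc⟩
  have h2 : ∀ a, ∃ b, g b = f a := fun a => by
    obtain ⟨b, hab⟩ := hM a
    have := mk_mem_imageEdges (f := f).2 hab
    rw [h] at this
    obtain ⟨c, -, hc, -, -⟩ := exists_of_mk_mem_imageEdges this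
    exact ⟨c, hc⟩
  choose s hs using h1
  choose t ht using h2
  refine ⟨⟨⟨s, t, fun a => ?_, fun a => ?_⟩, fun {a b} => ?_⟩, hs⟩
  · exact g.injective (by rw [ht, hs])
  · exact f.injective (by rw [hs, ht])
  · change M.Adj (s a) (s b) ↔ M'.Adj a b
    rw [← mk_mem_imageEdges (f := f), h, hs, hs, mk_mem_imageEdges]

theorem imageEdges_iso {M M' : SimpleGraph V} (τ : M' ≃g M) (f : V ↪ Fin n) :
    imageEdges M' (τ.toEquiv.toEmbedding.trans f) = imageEdges M f := by
  ext e
  induction e with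
  | h x y =>
    constructor
    · intro h
      obtain ⟨a, b, rfl, rfl, hab⟩ := exists_of_mk_mem_imageEdges h
      exact mk_mem_imageEdges.2 (τ.map_rel_iff.2 hab)
    · intro h
      obtain ⟨a, b, rfl, rfl, hab⟩ := exists_of_mk_mem_imageEdges h
      have h1 : M'.Adj (τ.symm a) (τ.symm b) := τ.symm.map_rel_iff.2 hab
      have := mk_mem_imageEdges (f := τ.toEquiv.toEmbedding.trans f).2 h1
      have e1 : τ.toEquiv (τ.symm a) = a := τ.apply_symm_apply a
      have e2 : τ.toEquiv (τ.symm b) = b := τ.apply_symm_apply b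
      simpa [e1, e2] using this

open Classical in
/-- The number of pairs of placements of `M` and `M'` with the same edges. -/
noncomputable def coincidences (n : ℕ) (M M' : SimpleGraph V) : ℝ :=
  ∑ f : V ↪ Fin n, ∑ g : V ↪ Fin n, if imageEdges M f = imageEdges M' g then 1 else 0

/-- For a fixed placement, the placements with the same edges are its compositions with the
automorphisms of the graph. -/
theorem coincidences_self (n : ℕ) {M : SimpleGraph V} (hM : ∀ a, ∃ b, M.Adj a b) :
    coincidences n M M = (n.descFactorial (Fintype.card V) : ℝ) * aut M := by
  classical
  have h1 : ∀ f : V ↪ Fin n,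
      (∑ g : V ↪ Fin n, if imageEdges M f = imageEdges M g then (1 : ℝ) else 0) = aut M := by
    intro f
    rw [Finset.sum_boole]
    congr 1
    rw [aut, ← Fintype.card_subtype, ← Nat.card_eq_fintype_card]
    refine (Nat.card_congr (Equiv.ofBijective
      (fun τ : M ≃g M => (⟨τ.toEquiv.toEmbedding.trans f, (imageEdges_iso τ f).symm⟩ :
        {g : V ↪ Fin n // imageEdges M f = imageEdges M g})) ⟨?_, ?_⟩)).symm
    · intro τ υ h
      ext a
      have h2 := DFunLike.congr_fun (Subtype.ext_iff.1 h) a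
      exact f.injective h2
    · rintro ⟨g, hg⟩
      obtain ⟨τ, hτ⟩ := exists_iso_of_imageEdges_eq hM hM hg
      exact ⟨τ, Subtype.ext (DFunLike.ext _ _ hτ)⟩
  rw [coincidences, Finset.sum_congr rfl fun f _ => h1 f]
  simp [Fintype.card_embedding_eq]

theorem coincidences_eq_zero (n : ℕ) {M M' : SimpleGraph V} (hM : ∀ a, ∃ b, M.Adj a b)
    (hM' : ∀ a, ∃ b, M'.Adj a b) (hne : IsEmpty (M ≃g M')) : coincidences n M M' = 0 := by
  refine Finset.sum_eq_zero fun f _ => Finset.sum_eq_zero fun g _ => if_neg fun h => ?_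
  obtain ⟨τ, -⟩ := exists_iso_of_imageEdges_eq hM hM' h
  exact hne.false τ.symm

theorem aut_pos (M : SimpleGraph V) : 0 < aut M := by
  have : Finite (M ≃g M) := Finite.of_injective (fun (τ : M ≃g M) (a : V) => τ a)
    fun τ υ h => DFunLike.ext _ _ (congrFun h)
  have : Nonempty (M ≃g M) := ⟨RelIso.refl _⟩
  exact Nat.card_pos

/-- The reason for the normalization of the weights: they cancel the variance of the edges and the
number of coincident pairs of placements, leaving only a power of ρ. -/
theorem weight_mul {p : ℝ} (hp : p * (1 - p) ≠ 0) (ρ : ℝ) (hn : Fintype.card V ≤ n)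
    (M : SimpleGraph V) :
    weight n p ρ M * (p * (1 - p)) ^ M.edgeSet.ncard
      * ((n.descFactorial (Fintype.card V) : ℝ) * aut M) = ρ ^ M.edgeSet.ncard := by
  have h1 : ((n - Fintype.card V)! : ℝ) * (n.descFactorial (Fintype.card V) : ℝ) = n ! := by
    exact_mod_cast Nat.factorial_mul_descFactorial hn
  have h2 : (aut M : ℝ) ≠ 0 := by exact_mod_cast (aut_pos M).ne'
  have h3 : ((n - Fintype.card V)! : ℝ) ≠ 0 := by exact_mod_cast (Nat.factorial_pos _).ne'
  have h4 : (n.descFactorial (Fintype.card V) : ℝ) ≠ 0 := by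
    exact_mod_cast (Nat.descFactorial_pos.2 hn).ne'
  unfold weight
  rw [← h1]
  field_simp

end Counting

/-! ### First and second moments -/

section Moments
variable {V : Type} [Fintype V] {n : ℕ}

open Classical in
/-- The properties of a motif that control overlaps of its copies. -/
structure IsBalanced (d e : ℕ) (M : SimpleGraph V) : Prop where
  preconnected : M.Preconnected
  degree_le : ∀ a, M.degree a ≤ d
  exists_degree_lt : ∃ a, M.degree a < d
  exists_adj : ∀ a, ∃ b, M.Adj a b
  ncard_edgeSet : M.edgeSet.ncard = e

variable {d e : ℕ} {𝓜 : Finset (Motif V)} {p ρ : ℝ}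

theorem coincidences_out (h𝓜 : ∀ M ∈ 𝓜, IsBalanced d e M.out) {M M' : Motif V} (hM : M ∈ 𝓜)
    (hM' : M' ∈ 𝓜) (hne : M ≠ M') : coincidences n M.out M'.out = 0 := by
  refine coincidences_eq_zero n (h𝓜 M hM).exists_adj (h𝓜 M' hM').exists_adj ⟨fun τ => hne ?_⟩
  rw [← Quotient.out_eq M, ← Quotient.out_eq M']
  exact Quotient.sound ⟨τ⟩

-- Only pairs of placements with equal edges contribute, each with (ρ p (1-p))^e. By
-- `coincidences_self` and `weight_mul` each motif therefore contributes ρ^e · ρ^e.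
open Classical in
theorem integral_bitStatistic (hp0 : 0 < p) (hp1 : p < 1) (hρ0 : 0 < ρ) (hρ1 : ρ ≤ 1)
    (hn : Fintype.card V ≤ n) (h𝓜 : ∀ M ∈ 𝓜, IsBalanced d e M.out) :
    ∫ ω, bitStatistic 𝓜 n p ρ ω ∂(Measure.pi fun _ : Sym2 (Fin n) => bivariateBernoulli p ρ)
      = 𝓜.card * ρ ^ (2 * e) := by
  have := isProbabilityMeasure_bivariateBernoulli hp0.le hp1.le hρ0.le hρ1
  have hpq : p * (1 - p) ≠ 0 := (mul_pos hp0 (by linarith)).ne'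
  unfold bitStatistic
  rw [integral_finsetSum _ fun _ _ => Integrable.of_finite, Finset.cast_card, Finset.sum_mul]
  refine Finset.sum_congr rfl fun M hM => ?_
  simp only [mul_assoc, Finset.sum_mul_sum]
  rw [integral_const_mul, integral_finsetSum _ fun _ _ => Integrable.of_finite]
  have h1 : ∀ f : V ↪ Fin n, ∫ ω, ∑ g : V ↪ Fin n,
      (∏ e ∈ imageEdges M.out f, centeredBit p (ω e).1)
        * (∏ e ∈ imageEdges M.out g, centeredBit p (ω e).2)
        ∂(Measure.pi fun _ : Sym2 (Fin n) => bivariateBernoulli p ρ)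
      = ∑ g : V ↪ Fin n, (if imageEdges M.out f = imageEdges M.out g then 1 else 0)
          * (ρ * (p * (1 - p))) ^ e := fun f => by
    rw [integral_finsetSum _ fun _ _ => Integrable.of_finite]
    refine Finset.sum_congr rfl fun g _ => ?_
    rw [integral_pair hp0.le hp1.le hρ0.le hρ1, card_imageEdges', (h𝓜 M hM).ncard_edgeSet]
    split_ifs <;> simp
  simp only [h1, ← Finset.sum_mul]
  have h2 := coincidences_self n (h𝓜 M hM).exists_adj
  have h3 := weight_mul hpq ρ hn M.out
  rw [(h𝓜 M hM).ncard_edgeSet] at h3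
  rw [coincidences] at h2
  rw [h2, mul_pow, two_mul, pow_add, one_mul]
  calc _ = ρ ^ e * (weight n p ρ M.out * (p * (1 - p)) ^ e
            * ((n.descFactorial (Fintype.card V) : ℝ) * aut M.out)) := by ring
    _ = _ := by rw [h3]

/-- Copies of different motifs never have the same edges, so only the diagonal remains. The sum
occurs both as the second moment under the null and as the contribution of the two crossed pairings
under the alternative. -/
theorem weight_mul_weight_sum (hp0 : 0 < p) (hp1 : p < 1)
    (hn : Fintype.card V ≤ n) (h𝓜 : ∀ M ∈ 𝓜, IsBalanced d e M.out) :
    ∑ M ∈ 𝓜, ∑ M' ∈ 𝓜, weight n p ρ M.out * weight n p ρ M'.out *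
        ((p * (1 - p)) ^ e * coincidences n M.out M'.out) ^ 2 = 𝓜.card * ρ ^ (2 * e) := by
  have hpq : p * (1 - p) ≠ 0 := (mul_pos hp0 (by linarith)).ne'
  rw [Finset.cast_card, Finset.sum_mul]
  refine Finset.sum_congr rfl fun M hM => ?_
  rw [Finset.sum_eq_single_of_mem M hM fun M' hM' hne => by
    rw [coincidences_out h𝓜 hM hM' hne.symm]; simp]
  have h3 := weight_mul hpq ρ hn M.out
  rw [(h𝓜 M hM).ncard_edgeSet] at h3
  rw [coincidences_self n (h𝓜 M hM).exists_adj, two_mul, pow_add, one_mul, ← h3]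
  ring

theorem integral_nullLaw_sq_eq {p : I} (hp0 : 0 < (p : ℝ)) (hp1 : (p : ℝ) < 1)
    (hn : Fintype.card V ≤ n) (h𝓜 : ∀ M ∈ 𝓜, IsBalanced d e M.out) :
    ∫ G, motifStatistic 𝓜 n p ρ G ^ 2 ∂(nullLaw n p) = 𝓜.card * ρ ^ (2 * e) := by
  classical
  rw [integral_nullLaw_sq, ← weight_mul_weight_sum (ρ := ρ) hp0 hp1 hn h𝓜]
  refine Finset.sum_congr rfl fun M hM => Finset.sum_congr rfl fun M' hM' => ?_
  congr 2
  rw [coincidences, Finset.mul_sum]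
  refine Finset.sum_congr rfl fun f _ => ?_
  rw [Finset.mul_sum]
  refine Finset.sum_congr rfl fun g _ => ?_
  rw [card_imageEdges', (h𝓜 M hM).ncard_edgeSet]
  split_ifs <;> simp

end Moments

/-! ### The second moment under the alternative. -/

section SecondMoment
variable {V : Type} [Fintype V] {n d e : ℕ} {𝓜 : Finset (Motif V)} {p ρ : ℝ}

/-- Two copies of `M` followed by two copies of `M'`. -/
noncomputable def quadGraphs (M M' : SimpleGraph V) : Fin 4 → SimpleGraph V := ![M, M, M', M']

theorem bitStatistic_sq (ω : Sym2 (Fin n) → Bool × Bool) :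
    bitStatistic 𝓜 n p ρ ω ^ 2 = ∑ M ∈ 𝓜, ∑ M' ∈ 𝓜, weight n p ρ M.out * weight n p ρ M'.out *
      ∑ F : Fin 4 → (V ↪ Fin n), ∏ i, ∏ x ∈ imageEdges (quadGraphs M.out M'.out i) (F i),
        centeredBit p (fourBits (ω x) i) := by
  rw [bitStatistic, sq, Finset.sum_mul_sum]
  refine Finset.sum_congr rfl fun M _ => Finset.sum_congr rfl fun M' _ => ?_
  have h := Finset.prod_univ_sum (fun _ : Fin 4 => (Finset.univ : Finset (V ↪ Fin n)))
    (fun i f => ∏ x ∈ imageEdges (quadGraphs M.out M'.out i) f,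
        centeredBit p (fourBits (ω x) i))
  rw [Fintype.piFinset_univ] at h
  rw [← h, Fin.prod_univ_four]
  simp only [quadGraphs, fourBits, Matrix.cons_val]
  ring

theorem integral_bitStatistic_sq (hp0 : 0 ≤ p) (hp1 : p ≤ 1) (hρ0 : 0 ≤ ρ) (hρ1 : ρ ≤ 1) :
    ∫ ω, bitStatistic 𝓜 n p ρ ω ^ 2 ∂(Measure.pi fun _ : Sym2 (Fin n) => bivariateBernoulli p ρ)
      = ∑ M ∈ 𝓜, ∑ M' ∈ 𝓜, weight n p ρ M.out * weight n p ρ M'.out *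
      ∑ F : Fin 4 → (V ↪ Fin n),
        quadMean p ρ fun i => imageEdges (quadGraphs M.out M'.out i) (F i) := by
  have := isProbabilityMeasure_bivariateBernoulli hp0 hp1 hρ0 hρ1
  simp only [bitStatistic_sq]
  rw [integral_finsetSum _ fun _ _ => Integrable.of_finite]
  refine Finset.sum_congr rfl fun M _ => ?_
  rw [integral_finsetSum _ fun _ _ => Integrable.of_finite]
  refine Finset.sum_congr rfl fun M' _ => ?_
  rw [integral_const_mul, integral_finsetSum _ fun _ _ => Integrable.of_finite]
  congr 1
  exact Finset.sum_congr rfl fun F _ => integral_quad hp0 hp1 hρ0 hρ1 _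

/-- Here w and m count the vertices and edges of the union, and k the vertices missing from 2v.
Losing k vertices costs N^(-k) and saves at most dk/2 - 1/2 edges, so the net loss is √q (N²
q^d)^(-k/2), which is at most θ by assumption. The inequality is squared to avoid half-integral
exponents. -/
theorem overlap_weight_le {v w m k : ℕ} {q θ N : ℝ} (hq0 : 0 < q) (hq1 : q ≤ 1) (hN : 0 < N)
    (hθ0 : 0 ≤ θ) (hk : w + k = 2 * v) (hm : d * w + 4 * e + 1 ≤ 2 * v * d + 2 * m)
    (hθ : q ≤ θ ^ 2 * (N ^ 2 * q ^ d) ^ k) :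
    q ^ m ≤ q ^ (2 * e) * N ^ (2 * v) * θ * (N ^ w)⁻¹ := by
  rw [← div_eq_mul_inv, le_div_iff₀ (by positivity)]
  refine le_of_sq_le_sq ?_ (by positivity)
  have h1 : 4 * e + 1 ≤ 2 * m + d * k := by
    have : d * w + d * k = 2 * v * d := by rw [← mul_add, hk]; ring
    omega
  have hpos : 0 < (N ^ 2 * q ^ d) ^ k := by positivity
  refine le_of_mul_le_mul_right ?_ hpos
  calc (q ^ m * N ^ w) ^ 2 * (N ^ 2 * q ^ d) ^ k
      = q ^ (2 * m + d * k) * N ^ (2 * (w + k)) := by ring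
    _ ≤ q ^ (4 * e + 1) * N ^ (2 * (w + k)) := by
        gcongr ?_ * _
        exact pow_le_pow_of_le_one hq0.le hq1 h1
    _ = (q ^ (2 * e) * N ^ (2 * v)) ^ 2 * q := by rw [hk]; ring
    _ ≤ (q ^ (2 * e) * N ^ (2 * v)) ^ 2 * (θ ^ 2 * (N ^ 2 * q ^ d) ^ k) := by gcongr
    _ = _ := by ring

open Classical in
/-- The indicator that two placements have the same edges. -/
noncomputable def sameEdges (M M' : SimpleGraph V) (f g : V ↪ Fin n) : ℝ :=
  if imageEdges M f = imageEdges M' g then 1 else 0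

theorem sameEdges_nonneg (M M' : SimpleGraph V) (f g : V ↪ Fin n) : 0 ≤ sameEdges M M' f g := by
  unfold sameEdges; split_ifs <;> norm_num

-- The four terms correspond to the three ways of pairing the copies and to the overlaps left by
-- `overlap_dichotomy`. Positions 0, 2 lie in the first graph and 1, 3 in the second. The factor ρ
-- is kept for the pairing 01|23, which must reproduce the square of the mean; for the other
-- pairings the cruder bound p(1-p) per edge suffices.
open Classical in
theorem quadMean_le {M M' : SimpleGraph V} (hM : IsBalanced d e M) (hM' : IsBalanced d e M')
    (hp0 : 0 < p) (hp1 : p < 1) (hρ0 : 0 ≤ ρ) (hρ1 : ρ ≤ 1) (hn : 0 < n) {θ : ℝ} (hθ0 : 0 ≤ θ)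
    (hθ : ∀ k, 1 ≤ k → k ≤ 2 * Fintype.card V →
      p * (1 - p) ≤ θ ^ 2 * ((n : ℝ) ^ 2 * (p * (1 - p)) ^ d) ^ k)
    (F : Fin 4 → (V ↪ Fin n)) :
    quadMean p ρ (fun i => imageEdges (quadGraphs M M' i) (F i)) ≤
      (ρ * (p * (1 - p))) ^ (2 * e) * (sameEdges M M (F 0) (F 1) * sameEdges M' M' (F 2) (F 3))
      + (p * (1 - p)) ^ (2 * e) * (sameEdges M M' (F 0) (F 2) * sameEdges M M' (F 1) (F 3))
      + (p * (1 - p)) ^ (2 * e) * (sameEdges M M' (F 0) (F 3) * sameEdges M M' (F 1) (F 2))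
      + (p * (1 - p)) ^ (2 * e) * (n : ℝ) ^ (2 * Fintype.card V) * θ *
        ((n : ℝ) ^ (Finset.univ.image fun x : Fin 4 × V => F x.1 x.2).card)⁻¹ := by
  set A := fun i => imageEdges (quadGraphs M M' i) (F i) with hA
  have hq : 0 < p * (1 - p) := mul_pos hp0 (by linarith)
  have hq1 : p * (1 - p) ≤ 1 := by nlinarith
  have hN : (0 : ℝ) < n := by exact_mod_cast hn
  have t1 : 0 ≤ (ρ * (p * (1 - p))) ^ (2 * e)
      * (sameEdges M M (F 0) (F 1) * sameEdges M' M' (F 2) (F 3)) :=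
    mul_nonneg (by positivity) (mul_nonneg (sameEdges_nonneg _ _ _ _) (sameEdges_nonneg _ _ _ _))
  have t2 : 0 ≤ (p * (1 - p)) ^ (2 * e)
      * (sameEdges M M' (F 0) (F 2) * sameEdges M M' (F 1) (F 3)) :=
    mul_nonneg (by positivity) (mul_nonneg (sameEdges_nonneg _ _ _ _) (sameEdges_nonneg _ _ _ _))
  have t3 : 0 ≤ (p * (1 - p)) ^ (2 * e)
      * (sameEdges M M' (F 0) (F 3) * sameEdges M M' (F 1) (F 2)) :=
    mul_nonneg (by positivity) (mul_nonneg (sameEdges_nonneg _ _ _ _) (sameEdges_nonneg _ _ _ _))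
  have t4 : 0 ≤ (p * (1 - p)) ^ (2 * e) * (n : ℝ) ^ (2 * Fintype.card V) * θ *
        ((n : ℝ) ^ (Finset.univ.image fun x : Fin 4 × V => F x.1 x.2).card)⁻¹ := by positivity
  by_cases hcov : ∀ i, ∀ x ∈ A i, ∃ j, j ≠ i ∧ x ∈ A j
  swap
  · push Not at hcov
    obtain ⟨i, x, hx, h⟩ := hcov
    rw [quadMean_eq_zero hp0.le hp1.le hρ0 hρ1 A hx h]
    positivity
  have hbal : ∀ i, IsBalanced d e (quadGraphs M M' i) := fun i => by
    fin_cases i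
    exacts [hM, hM, hM', hM']
  have hcA : ∀ i, (A i).card = e := fun i => by rw [hA, card_imageEdges', (hbal i).ncard_edgeSet]
  have habs := (le_abs_self _).trans (abs_quadMean_le hp0.le hp1.le hρ0 hρ1 A hcov)
  have hcU : ∀ B C : Finset (Sym2 (Fin n)), B.card = e → C.card = e → Disjoint B C →
      (∀ i, A i = B ∨ A i = C) → (∃ i, A i = B) → (∃ i, A i = C) →
      (Finset.univ.biUnion A).card = 2 * e := by
    rintro B C hB hC hBC hAi ⟨i, hi⟩ ⟨j, hj⟩
    have : Finset.univ.biUnion A = B ∪ C := by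
      ext x
      simp only [Finset.mem_biUnion, Finset.mem_univ, true_and, Finset.mem_union]
      constructor
      · rintro ⟨l, hl⟩
        rcases hAi l with h | h <;> rw [h] at hl <;> tauto
      · rintro (h | h)
        · exact ⟨i, hi ▸ h⟩
        · exact ⟨j, hj ▸ h⟩
    rw [this, Finset.card_union_of_disjoint hBC, hB, hC]; ring
  have hW : (Finset.univ.biUnion fun i => Finset.univ.map (F i))
      = Finset.univ.image fun x : Fin 4 × V => F x.1 x.2 := by
    ext y; simp
  rcases overlap_dichotomy (d := d) (e := e) (quadGraphs M M') F (fun i => (hbal i).preconnected)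
    (fun i => (hbal i).degree_le) (fun i => (hbal i).exists_degree_lt)
    (fun i => (hbal i).exists_adj) (fun i => (hbal i).ncard_edgeSet) hcov
    with (⟨h1, h2, h3⟩ | ⟨h1, h2, h3⟩ | ⟨h1, h2, h3⟩) | ⟨h1, h2⟩
  · have h := quadMean_pairs hp0.le hp1.le hρ0 hρ1 A h1 h2 h3
    rw [hcA, hcA, ← two_mul] at h
    have s1 : sameEdges M M (F 0) (F 1) = 1 := if_pos h1
    have s2 : sameEdges M' M' (F 2) (F 3) = 1 := if_pos h2
    have hle : quadMean p ρ A ≤ (ρ * (p * (1 - p))) ^ (2 * e)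

      * (sameEdges M M (F 0) (F 1) * sameEdges M' M' (F 2) (F 3)) := by
      rw [h, s1, s2, mul_one, mul_one]
    linarith
  · have s1 : sameEdges M M' (F 0) (F 2) = 1 := if_pos h1
    have s2 : sameEdges M M' (F 1) (F 3) = 1 := if_pos h2
    rw [hcU (A 0) (A 1) (hcA 0) (hcA 1) h3 (fun i => by
      fin_cases i <;> simp
      exacts [Or.inl h1.symm, Or.inr h2.symm]) ⟨0, rfl⟩ ⟨1, rfl⟩] at habs
    have hle : quadMean p ρ A ≤ (p * (1 - p)) ^ (2 * e)

      * (sameEdges M M' (F 0) (F 2) * sameEdges M M' (F 1) (F 3)) := by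
      rw [s1, s2, mul_one, mul_one]; exact habs
    linarith
  · have s1 : sameEdges M M' (F 0) (F 3) = 1 := if_pos h1
    have s2 : sameEdges M M' (F 1) (F 2) = 1 := if_pos h2
    rw [hcU (A 0) (A 1) (hcA 0) (hcA 1) h3 (fun i => by
      fin_cases i <;> simp
      exacts [Or.inr h2.symm, Or.inl h1.symm]) ⟨0, rfl⟩ ⟨1, rfl⟩] at habs
    have hle : quadMean p ρ A ≤ (p * (1 - p)) ^ (2 * e)

      * (sameEdges M M' (F 0) (F 3) * sameEdges M M' (F 1) (F 2)) := by
      rw [s1, s2, mul_one, mul_one]; exact habs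
    linarith
  · rw [hW] at h1 h2
    have h3 := overlap_weight_le (d := d) (e := e) (v := Fintype.card V) hq hq1 hN hθ0
      (k := 2 * Fintype.card V - (Finset.univ.image fun x : Fin 4 × V => F x.1 x.2).card)
      (by omega) h2 (hθ _ (by omega) (by omega))
    linarith

theorem sum_quad_le (hn : 0 < n) :
    ∑ F : Fin 4 → (V ↪ Fin n), ((n : ℝ) ^
      (Finset.univ.image fun x : Fin 4 × V => F x.1 x.2).card)⁻¹
      ≤ (4 * Fintype.card V : ℝ) ^ (4 * Fintype.card V) := by
  classical
  have h := sum_inv_pow_card_image_le (A := Fin 4 × V) (n := n)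
  rw [Fintype.card_prod, Fintype.card_fin] at h
  push_cast at h
  refine le_trans ?_ h
  let ι : (Fin 4 → (V ↪ Fin n)) ↪ (Fin 4 × V → Fin n) :=
    ⟨fun F x => F x.1 x.2, fun F G hFG => by
      ext i a
      have := congrFun hFG (i, a)
      exact congrArg _ this⟩
  calc _ = ∑ F ∈ Finset.univ.map ι, ((n : ℝ) ^ (Finset.univ.image F).card)⁻¹ := by
        rw [Finset.sum_map]
        refine Finset.sum_congr rfl fun F _ => ?_
        congr!
    _ ≤ ∑ F : Fin 4 × V → Fin n, ((n : ℝ) ^ (Finset.univ.image F).card)⁻¹ :=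
        Finset.sum_le_sum_of_subset_of_nonneg (Finset.subset_univ _)
          fun _ _ _ => by positivity
    _ = _ := by congr!

theorem coincidences_eq_sum (M M' : SimpleGraph V) :
    coincidences n M M' = ∑ f : V ↪ Fin n, ∑ g : V ↪ Fin n, sameEdges M M' f g := rfl

theorem weight_nonneg (hp0 : 0 ≤ p) (hp1 : p ≤ 1) (hρ0 : 0 ≤ ρ) (M : SimpleGraph V) :
    0 ≤ weight n p ρ M := by
  have : 0 ≤ 1 - p := by linarith
  unfold weight
  positivity

/-- The second moment of the statistic under the alternative. -/
theorem integral_bitStatistic_sq_le (h𝓜 : ∀ M ∈ 𝓜, IsBalanced d e M.out)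
    (hp0 : 0 < p) (hp1 : p < 1) (hρ0 : 0 < ρ) (hρ1 : ρ ≤ 1) (hn : 0 < n)
    (hVn : Fintype.card V ≤ n) {θ : ℝ} (hθ0 : 0 ≤ θ)
    (hθ : ∀ k, 1 ≤ k → k ≤ 2 * Fintype.card V →
      p * (1 - p) ≤ θ ^ 2 * ((n : ℝ) ^ 2 * (p * (1 - p)) ^ d) ^ k) :
    ∫ ω, bitStatistic 𝓜 n p ρ ω ^ 2 ∂(Measure.pi fun _ : Sym2 (Fin n) => bivariateBernoulli p ρ)
      ≤ (𝓜.card * ρ ^ (2 * e)) ^ 2 + 2 * (𝓜.card * ρ ^ (2 * e))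
        + 𝓜.card ^ 2 * ρ ^ (2 * e) * ((n : ℝ) ^ Fintype.card V
          / n.descFactorial (Fintype.card V)) ^ 2
          * (4 * Fintype.card V : ℝ) ^ (4 * Fintype.card V) * θ := by
  classical
  have hq : 0 < p * (1 - p) := mul_pos hp0 (by linarith)
  rw [integral_bitStatistic_sq hp0.le hp1.le hρ0.le hρ1]
  set v := Fintype.card V with hv
  set D : ℝ := ((n.descFactorial v : ℕ) : ℝ) with hD
  have hDpos : 0 < D := by rw [hD]; exact_mod_cast Nat.descFactorial_pos.2 hVn
  set B : ℝ := (4 * v : ℝ) ^ (4 * v) with hB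
  have hw : ∀ M ∈ 𝓜, weight n p ρ M.out * (p * (1 - p)) ^ e * (D * aut M.out) = ρ ^ e := by
    intro M hM
    have := weight_mul hq.ne' ρ hVn M.out
    rwa [(h𝓜 M hM).ncard_edgeSet] at this
  -- In the overlap term the automorphisms are simply discarded, using that there is at least one.
  have hw' : ∀ M ∈ 𝓜, weight n p ρ M.out * (p * (1 - p)) ^ e ≤ ρ ^ e / D := by
    intro M hM
    rw [le_div_iff₀ hDpos, ← hw M hM]
    have h1 : (1 : ℝ) ≤ aut M.out := by exact_mod_cast aut_pos M.out
    have h2 := weight_nonneg (n := n) hp0.le hp1.le hρ0.le M.out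
    refine mul_le_mul_of_nonneg_left ?_ (by positivity)
    nlinarith
  -- the three coincidence patterns and the overlap term
  have hterm : ∀ M ∈ 𝓜, ∀ M' ∈ 𝓜, weight n p ρ M.out * weight n p ρ M'.out *
      ∑ F : Fin 4 → (V ↪ Fin n),
        quadMean p ρ (fun i => imageEdges (quadGraphs M.out M'.out i) (F i)) ≤
      ρ ^ (2 * e) * ρ ^ (2 * e)
      + 2 * (weight n p ρ M.out * weight n p ρ M'.out *
          ((p * (1 - p)) ^ e * coincidences n M.out M'.out) ^ 2)
      + ρ ^ (2 * e) * ((n : ℝ) ^ v / D) ^ 2 * B * θ := by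
    intro M hM M' hM'
    have hwM := weight_nonneg (n := n) hp0.le hp1.le hρ0.le M.out
    have hwM' := weight_nonneg (n := n) hp0.le hp1.le hρ0.le M'.out
    have hsum := Finset.sum_le_sum fun F (_ : F ∈ Finset.univ) =>
      quadMean_le (h𝓜 M hM) (h𝓜 M' hM') hp0 hp1 hρ0.le hρ1 hn hθ0 hθ F
    rw [Finset.sum_add_distrib, Finset.sum_add_distrib, Finset.sum_add_distrib,
      ← Finset.mul_sum, ← Finset.mul_sum, ← Finset.mul_sum, ← Finset.mul_sum] at hsum
    have e1 : ∑ F : Fin 4 → (V ↪ Fin n), sameEdges M.out M.out (F 0) (F 1)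
        * sameEdges M'.out M'.out (F 2) (F 3)
        = coincidences n M.out M.out * coincidences n M'.out M'.out := by
      rw [sum_fin_four]
      simp only [Matrix.cons_val, ← Finset.mul_sum, ← Finset.sum_mul, coincidences_eq_sum]
    have e2 : ∑ F : Fin 4 → (V ↪ Fin n), sameEdges M.out M'.out (F 0) (F 2)
        * sameEdges M.out M'.out (F 1) (F 3) = coincidences n M.out M'.out ^ 2 := by
      rw [sum_fin_four]
      simp only [Matrix.cons_val, ← Finset.mul_sum, ← Finset.sum_mul, coincidences_eq_sum, sq]
    have e3 : ∑ F : Fin 4 → (V ↪ Fin n), sameEdges M.out M'.out (F 0) (F 3)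
        * sameEdges M.out M'.out (F 1) (F 2) = coincidences n M.out M'.out ^ 2 := by
      rw [sum_fin_four]
      simp only [Matrix.cons_val, ← Finset.mul_sum, ← Finset.sum_mul, coincidences_eq_sum, sq]
    have e4 := sum_quad_le (V := V) hn
    rw [e1, e2, e3] at hsum
    rw [coincidences_self n (h𝓜 M hM).exists_adj,
      coincidences_self n (h𝓜 M' hM').exists_adj] at hsum
    refine (mul_le_mul_of_nonneg_left hsum (mul_nonneg hwM hwM')).trans ?_
    rw [mul_add, mul_add, mul_add]
    have f1 : weight n p ρ M.out * weight n p ρ M'.out * ((ρ * (p * (1 - p))) ^ (2 * e)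
        * (D * aut M.out * (D * aut M'.out))) = ρ ^ (2 * e) * ρ ^ (2 * e) := by
      calc _ = ρ ^ (2 * e) * ((weight n p ρ M.out * (p * (1 - p)) ^ e * (D * aut M.out))
            * (weight n p ρ M'.out * (p * (1 - p)) ^ e * (D * aut M'.out))) := by
            rw [mul_pow]; ring
        _ = _ := by rw [hw M hM, hw M' hM']; ring
    have f4 : weight n p ρ M.out * weight n p ρ M'.out * ((p * (1 - p)) ^ (2 * e)
        * (n : ℝ) ^ (2 * v) * θ * ∑ F : Fin 4 → (V ↪ Fin n), ((n : ℝ) ^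
      (Finset.univ.image fun x : Fin 4 × V => F x.1 x.2).card)⁻¹)
        ≤ ρ ^ (2 * e) * ((n : ℝ) ^ v / D) ^ 2 * B * θ := by
      calc _ ≤ weight n p ρ M.out * weight n p ρ M'.out * ((p * (1 - p)) ^ (2 * e)
            * (n : ℝ) ^ (2 * v) * θ * B) := by gcongr
        _ = (weight n p ρ M.out * (p * (1 - p)) ^ e) * (weight n p ρ M'.out * (p * (1 - p)) ^ e)
            * ((n : ℝ) ^ (2 * v) * θ * B) := by ring
        _ ≤ (ρ ^ e / D) * (ρ ^ e / D) * ((n : ℝ) ^ (2 * v) * θ * B) := by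
            gcongr
            · exact hw' M hM
            · exact hw' M' hM'
        _ = _ := by field_simp; ring
    rw [f1]
    refine add_le_add (le_of_eq ?_) f4
    ring
  calc _ ≤ ∑ M ∈ 𝓜, ∑ M' ∈ 𝓜, (ρ ^ (2 * e) * ρ ^ (2 * e)
      + 2 * (weight n p ρ M.out * weight n p ρ M'.out *
          ((p * (1 - p)) ^ e * coincidences n M.out M'.out) ^ 2)
      + ρ ^ (2 * e) * ((n : ℝ) ^ v / D) ^ 2 * B * θ) :=
        Finset.sum_le_sum fun M hM => Finset.sum_le_sum fun M' hM' => hterm M hM M' hM'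
    _ = _ := by
      simp only [Finset.sum_add_distrib, ← Finset.mul_sum, Finset.sum_const, nsmul_eq_mul]
      rw [weight_mul_weight_sum hp0 hp1 hVn h𝓜]
      ring

end SecondMoment

/-! ### The special family -/

section Special
variable {d ℓ : ℕ} {z : Fin (d - 1) → Fin (d - 1) → Equiv.Perm (Fin ℓ)}

/-- Each edge is listed in one orientation only, so degrees are sums of out-degrees and in-degrees,
and products over the relation run once over each edge. -/
theorem specialRel_asymm {x y : MotifVertex d ℓ} (h : specialRel d ℓ z x y) :
    ¬ specialRel d ℓ z y x := by
  rcases x with u | ⟨i, s⟩ <;> rcases y with v | ⟨j, t⟩ <;> simp only [specialRel] at h ⊢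
  · rintro (⟨rfl, rfl⟩ | ⟨rfl, rfl⟩) <;> revert h <;> decide
  · exact not_false
  · rintro (⟨h1, h2⟩ | ⟨h1, h2⟩) <;> rcases h with ⟨h3, h4⟩ | ⟨h3, h4⟩
    · omega
    · exact h3.ne h1.symm
    · exact h1.ne h3.symm
    · exact h1.asymm h3

theorem specialGraph_adj {x y : MotifVertex d ℓ} :
    (specialGraph d ℓ z).Adj x y ↔ specialRel d ℓ z x y ∨ specialRel d ℓ z y x := by
  rw [specialGraph, SimpleGraph.fromRel_adj, and_iff_right_iff_imp]
  rintro h rfl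
  rcases h with h | h <;> exact specialRel_asymm h h

open Classical in
theorem specialGraph_degree_eq_sum (x : MotifVertex d ℓ) :
    (specialGraph d ℓ z).degree x
      = ∑ y, ((if specialRel d ℓ z x y then 1 else 0)
        + (if specialRel d ℓ z y x then 1 else 0)) := by
  rw [← SimpleGraph.card_neighborFinset_eq_degree, SimpleGraph.neighborFinset_eq_filter,
    Finset.card_filter]
  refine Finset.sum_congr rfl fun y _ => ?_
  rw [if_congr specialGraph_adj rfl rfl]
  by_cases h : specialRel d ℓ z x y
  · simp [h, specialRel_asymm h]
  · simp [h]

theorem sum_ite_val_eq {ℓ c : ℕ} (hc : c < ℓ) :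
    (∑ t : Fin ℓ, if (t : ℕ) = c then 1 else 0) = 1 := by
  rw [Finset.sum_eq_single_of_mem (⟨c, hc⟩ : Fin ℓ) (Finset.mem_univ _)
    fun t _ ht => if_neg fun h =>
    ht (Fin.ext h)]
  simp

open Classical in
theorem specialGraph_degree_inl (hd : 1 ≤ d) (hℓ : 1 ≤ ℓ) (u : Fin 4) :
    (specialGraph d ℓ z).degree (Sum.inl u) = if u = 0 ∨ u = 3 then 1 else d := by
  rw [specialGraph_degree_eq_sum, Fintype.sum_sum_type, Fintype.sum_prod_type]
  have h1 := sum_ite_val_eq (ℓ := ℓ) (c := 0) hℓ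
  have h2 := sum_ite_val_eq (ℓ := ℓ) (c := ℓ - 1) (by omega)
  have h3 : ∀ t : Fin ℓ, ((t : ℕ) + 1 = ℓ) ↔ (t : ℕ) = ℓ - 1 := fun t => by omega
  fin_cases u <;> simp [specialRel, h3, h1, h2] <;> omega

-- Two neighbors along the path, a central vertex standing in beyond either end, and one neighbor on
-- each of the d - 2 other paths.
open Classical in
theorem specialGraph_degree_inr (hd : 2 ≤ d) (i : Fin (d - 1)) (s : Fin ℓ) :
    (specialGraph d ℓ z).degree (Sum.inr (i, s)) = d := by
  rw [specialGraph_degree_eq_sum, Fintype.sum_sum_type, Fintype.sum_prod_type]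
  have h1 : (∑ u : Fin 4, ((if specialRel d ℓ z (Sum.inr (i, s)) (Sum.inl u) then 1 else 0)
      + (if specialRel d ℓ z (Sum.inl u) (Sum.inr (i, s)) then 1 else 0)))
      = (if (s : ℕ) = 0 then 1 else 0) + (if (s : ℕ) + 1 = ℓ then 1 else 0) := by
    simp [specialRel, Fin.sum_univ_four]
  have h2 : ∀ j, j ≠ i →
      (∑ t : Fin ℓ, ((if specialRel d ℓ z (Sum.inr (i, s)) (Sum.inr (j, t)) then 1 else 0)
      + (if specialRel d ℓ z (Sum.inr (j, t)) (Sum.inr (i, s)) then 1 else 0))) = 1 := by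
    intro j hj
    rcases lt_or_gt_of_ne hj with h | h
    · simp only [specialRel, hj, hj.symm, false_and, false_or, h.not_gt, h, true_and, if_false,
        zero_add]
      rw [Finset.sum_eq_single_of_mem ((z j i).symm s) (Finset.mem_univ _)]
      · simp
      · intro t _ ht
        exact if_neg fun h => ht (by rw [← h]; simp)
    · simp only [specialRel, hj, hj.symm, false_and, false_or, h.not_gt, h, true_and, if_false,
        add_zero]
      rw [Finset.sum_eq_single_of_mem (z i j s) (Finset.mem_univ _)]
      · simp
      · intro t _ ht
        exact if_neg fun h => ht h.symm
  have h3 : (∑ t : Fin ℓ, ((if specialRel d ℓ z (Sum.inr (i, s)) (Sum.inr (i, t)) then 1 else 0)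
      + (if specialRel d ℓ z (Sum.inr (i, t)) (Sum.inr (i, s)) then 1 else 0)))
      = (if (s : ℕ) + 1 = ℓ then 0 else 1) + (if (s : ℕ) = 0 then 0 else 1) := by
    simp only [specialRel, lt_irrefl, false_and, or_false, true_and]
    rw [Finset.sum_add_distrib]
    congr 1
    · split_ifs with h
      · exact Finset.sum_eq_zero fun t _ => if_neg (by omega)
      · exact (Finset.sum_congr rfl fun t _ => if_congr eq_comm rfl rfl).trans
          (sum_ite_val_eq (ℓ := ℓ) (c := (s : ℕ) + 1) (by omega))
    · split_ifs with h
      · exact Finset.sum_eq_zero fun t _ => if_neg (by omega)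
      · exact (Finset.sum_congr rfl fun t _ => if_congr (by omega) rfl rfl).trans
          (sum_ite_val_eq (ℓ := ℓ) (c := (s : ℕ) - 1) (by omega))
  rw [h1, ← Finset.add_sum_erase _ _ (Finset.mem_univ i), h3,
    Finset.sum_congr rfl fun j hj => h2 j (Finset.ne_of_mem_erase hj), Finset.sum_const,
    Finset.card_erase_of_mem (Finset.mem_univ i), Finset.card_univ, Fintype.card_fin]
  split_ifs <;> simp <;> omega

theorem card_motifVertex : Fintype.card (MotifVertex d ℓ) = (d - 1) * ℓ + 4 := by
  simp; ring

theorem specialGraph_ncard_edgeSet (hd : 2 ≤ d) (hℓ : 1 ≤ ℓ) :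
    (specialGraph d ℓ z).edgeSet.ncard = numEdges d ℓ := by
  classical
  have h := (specialGraph d ℓ z).sum_degrees_eq_twice_card_edges
  rw [Fintype.sum_sum_type, Fintype.sum_prod_type] at h
  simp only [specialGraph_degree_inl (by omega : 1 ≤ d) hℓ, specialGraph_degree_inr hd,
    Fin.sum_univ_four, Finset.sum_const, Finset.card_univ, Fintype.card_fin, smul_eq_mul] at h
  rw [← SimpleGraph.coe_edgeFinset, Set.ncard_coe_finset]
  have h2 : d.choose 2 * 2 = d * (d - 1) := by
    rw [Nat.choose_two_right]; exact Nat.div_mul_cancel (Nat.even_mul_pred_self d).two_dvd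
  have h3 : (d - 1) * (ℓ * d) = d.choose 2 * 2 * ℓ := by rw [h2]; ring
  rw [h3] at h
  simp at h
  unfold numEdges
  have : 2 * (d.choose 2 * ℓ) = d.choose 2 * 2 * ℓ := by ring
  omega

/-- The parent of a vertex in a spanning tree, rooted at the first central vertex, that is common to
all the special graphs. -/
def parent (d ℓ : ℕ) (hd : 0 < d - 1) (hℓ : 0 < ℓ) : MotifVertex d ℓ → MotifVertex d ℓ
  | Sum.inl u => if u = 2 then Sum.inr (⟨0, hd⟩, ⟨ℓ - 1, by omega⟩)
      else if u = 3 then Sum.inl 2 else Sum.inl 1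
  | Sum.inr (i, t) => if (t : ℕ) = 0 then Sum.inl 1 else Sum.inr (i, ⟨t - 1, by omega⟩)

theorem specialGraph_adj_parent (hd : 0 < d - 1) (hℓ : 0 < ℓ) (x : MotifVertex d ℓ)
    (hx : x ≠ Sum.inl 1) : (specialGraph d ℓ z).Adj (parent d ℓ hd hℓ x) x := by
  rw [specialGraph_adj]
  rcases x with u | ⟨i, t⟩
  · fin_cases u
    · right; simp [parent, specialRel]
    · exact absurd rfl hx
    · right; simp [parent, specialRel]; omega
    · left; simp [parent, specialRel]
  · left
    by_cases h : (t : ℕ) = 0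
    · simp [parent, specialRel, h]
    · simp [parent, specialRel, h]; omega

/-- Induction along the spanning tree. -/
theorem tree_induction (hd : 0 < d - 1) (hℓ : 0 < ℓ) {P : MotifVertex d ℓ → Prop}
    (h1 : P (Sum.inl 1)) (hstep : ∀ x, x ≠ Sum.inl 1 → P (parent d ℓ hd hℓ x) → P x) (x) : P x := by
  have hpath : ∀ i : Fin (d - 1), ∀ t : ℕ, ∀ ht : t < ℓ, P (Sum.inr (i, ⟨t, ht⟩)) := by
    intro i t
    induction t with
    | zero => exact fun ht => hstep _ (by simp) (by simpa [parent] using h1)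
    | succ t ih => exact fun ht => hstep _ (by simp) (by simpa [parent] using ih (by omega))
  have h2 : P (Sum.inl 2) := hstep _ (by simp) (by simpa [parent] using hpath _ _ _)
  rcases x with u | ⟨i, t⟩
  · fin_cases u
    · exact hstep _ (by simp) (by simpa [parent] using h1)
    · exact h1
    · exact h2
    · exact hstep _ (by simp) (by simpa [parent] using h2)
  · exact hpath i t t.2

theorem specialGraph_preconnected (hd : 0 < d - 1) (hℓ : 0 < ℓ) :
    (specialGraph d ℓ z).Preconnected := by
  have h : ∀ x, (specialGraph d ℓ z).Reachable (Sum.inl 1) x :=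
    tree_induction hd hℓ (SimpleGraph.Reachable.refl _) fun x hx hp =>
      hp.trans (specialGraph_adj_parent hd hℓ x hx).reachable
  exact fun x y => (h x).symm.trans (h y)

/-- Path vertices and central vertices have degree exactly d; the extremity vertices are the leaves
required by the overlap argument. -/
theorem isBalanced_specialGraph (hd : 3 ≤ d) (hℓ : 1 ≤ ℓ) :
    IsBalanced d (numEdges d ℓ) (specialGraph d ℓ z) where
  preconnected := specialGraph_preconnected (by omega) hℓ
  degree_le := by
    rintro (u | ⟨i, s⟩)
    · rw [specialGraph_degree_inl (by omega) hℓ]; split_ifs <;> omega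
    · rw [specialGraph_degree_inr (by omega)]
  exists_degree_lt := ⟨Sum.inl 0, by
    rw [specialGraph_degree_inl (by omega) hℓ]; simp; omega⟩
  exists_adj := by
    classical
    intro a
    by_cases ha : a = Sum.inl 1
    · exact ⟨Sum.inl 0, by rw [ha, specialGraph_adj]; right; simp [specialRel]⟩
    · exact ⟨_, (specialGraph_adj_parent (by omega) hℓ a ha).symm⟩
  ncard_edgeSet := specialGraph_ncard_edgeSet (by omega) hℓ

theorem IsBalanced.of_iso {V : Type} [Fintype V] {e : ℕ} {M M' : SimpleGraph V}
    (h : IsBalanced d e M) (τ : M ≃g M') : IsBalanced d e M' where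
  preconnected := τ.preconnected_iff.1 h.preconnected
  degree_le a := by
    classical
    have := h.degree_le (τ.symm a)
    rwa [← τ.degree_eq (τ.symm a), τ.apply_symm_apply] at this
  exists_degree_lt := by
    classical
    obtain ⟨a, ha⟩ := h.exists_degree_lt
    exact ⟨τ a, by rwa [τ.degree_eq]⟩
  exists_adj a := by
    obtain ⟨b, hb⟩ := h.exists_adj (τ.symm a)
    exact ⟨τ b, by simpa using τ.map_rel_iff.2 hb⟩
  ncard_edgeSet := by
    classical
    have h1 := h.ncard_edgeSet
    rw [← SimpleGraph.coe_edgeFinset, Set.ncard_coe_finset] at h1 ⊢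
    rw [← h1]
    exact τ.card_edgeFinset_eq.symm

theorem mem_specialFamily {M : Motif (MotifVertex d ℓ)} :
    M ∈ specialFamily d ℓ ↔ ∃ z, Quotient.mk (isoSetoid _) (specialGraph d ℓ z) = M := by
  classical
  simp [specialFamily]

theorem mk_eq_mk_iff {V : Type} {M M' : SimpleGraph V} :
    Quotient.mk (isoSetoid V) M = Quotient.mk (isoSetoid V) M' ↔ Nonempty (M ≃g M') :=
  ⟨fun h => Quotient.exact h, fun h => Quotient.sound h⟩

theorem isBalanced_out (hd : 3 ≤ d) (hℓ : 1 ≤ ℓ) {M : Motif (MotifVertex d ℓ)}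
    (hM : M ∈ specialFamily d ℓ) : IsBalanced d (numEdges d ℓ) M.out := by
  obtain ⟨z, hz⟩ := mem_specialFamily.1 hM
  rw [← Quotient.out_eq M, mk_eq_mk_iff] at hz
  exact (isBalanced_specialGraph hd hℓ).of_iso hz.some

/-- Labels from `Fin d` for the neighbors of a vertex; with them an isomorphism is encoded by one
label per tree edge. -/
theorem exists_neighbor_index {V : Type} [Fintype V] {e : ℕ} {M : SimpleGraph V}
    (h : IsBalanced d e M) (y : V) : ∃ g : V → Fin d, Set.InjOn g (M.neighborSet y) := by
  classical
  have hd : 0 < d := by obtain ⟨a, ha⟩ := h.exists_degree_lt; omega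
  have : Nonempty (M.neighborFinset y ↪ Fin d) := by
    apply Function.Embedding.nonempty_of_card_le
    rw [Fintype.card_coe, SimpleGraph.card_neighborFinset_eq_degree, Fintype.card_fin]
    exact h.degree_le y
  obtain ⟨f⟩ := this
  refine ⟨fun x => if hx : x ∈ M.neighborFinset y then f ⟨x, hx⟩ else ⟨0, hd⟩, ?_⟩
  intro a ha b hb hab
  have ha' : a ∈ M.neighborFinset y := by simpa using ha
  have hb' : b ∈ M.neighborFinset y := by simpa using hb
  simp only [ha', hb', dif_pos] at hab
  exact Subtype.ext_iff.1 (f.injective hab)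

/-- The pairs of distinct paths. -/
abbrev PathPair (d : ℕ) : Type := {q : Fin (d - 1) × Fin (d - 1) // q.1 < q.2}

/-- Cross matchings between pairs of paths, extended by the identity. -/
def extendMatching (w : PathPair d → Equiv.Perm (Fin ℓ)) (i j : Fin (d - 1)) :
    Equiv.Perm (Fin ℓ) :=
  if h : i < j then w ⟨(i, j), h⟩ else 1

theorem extendMatching_injective {w w' : PathPair d → Equiv.Perm (Fin ℓ)}
    (h : specialGraph d ℓ (extendMatching w) = specialGraph d ℓ (extendMatching w')) : w = w' := by
  ext ⟨⟨i, j⟩, hij⟩ s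
  have h1 : (specialGraph d ℓ (extendMatching w)).Adj (Sum.inr (i, s))
      (Sum.inr (j, w ⟨(i, j), hij⟩ s)) := by
    rw [specialGraph_adj]; left; right
    exact ⟨hij, by simp only [extendMatching, dif_pos hij]⟩
  rw [h, specialGraph_adj] at h1
  simp only [specialRel, hij.ne, hij.ne', false_and, false_or, hij, true_and, hij.not_gt, or_false,
    extendMatching, dif_pos] at h1
  rw [h1]

theorem card_pathPair (d : ℕ) : Fintype.card (PathPair d) = (d - 1).choose 2 := by
  classical
  have h := Sym2.card_subtype_not_diag (α := Fin (d - 1))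
  rw [Fintype.card_fin] at h
  rw [← h]
  refine Fintype.card_congr (Equiv.ofBijective (fun q => ⟨s(q.1.1, q.1.2), ?_⟩) ⟨?_, ?_⟩)
  · simpa using q.2.ne
  · rintro ⟨⟨a, b⟩, h1⟩ ⟨⟨a', b'⟩, h2⟩ h
    simp only [Subtype.mk.injEq, Sym2.eq_iff] at h
    rcases h with ⟨rfl, rfl⟩ | ⟨rfl, rfl⟩
    · rfl
    · exact (h1.asymm h2).elim
  · rintro ⟨e, he⟩
    induction e with
    | h a b =>
      have hab : a ≠ b := by simpa using he
      rcases lt_or_gt_of_ne hab with h | h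
      · exact ⟨⟨(a, b), h⟩, rfl⟩
      · exact ⟨⟨(b, a), h⟩, Subtype.ext Sym2.eq_swap⟩

/-- The number of special motifs. -/
theorem factorial_pow_le (hd : 3 ≤ d) (hℓ : 1 ≤ ℓ) :
    (ℓ !) ^ (d - 1).choose 2 ≤ (specialFamily d ℓ).card *
      (Fintype.card (MotifVertex d ℓ) * d ^ Fintype.card (MotifVertex d ℓ)) := by
  classical
  have hd' : 0 < d - 1 := by omega
  let Φ : (PathPair d → Equiv.Perm (Fin ℓ)) → Motif (MotifVertex d ℓ) :=
    fun w => Quotient.mk (isoSetoid _) (specialGraph d ℓ (extendMatching w))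
  have h1 : (Finset.univ : Finset (PathPair d → Equiv.Perm (Fin ℓ))).card
      = (ℓ !) ^ (d - 1).choose 2 := by
    rw [Finset.card_univ, Fintype.card_fun, card_pathPair, Fintype.card_perm, Fintype.card_fin]
  rw [← h1, mul_comm]
  refine Finset.card_le_mul_card_image_of_maps_to (f := Φ)
    (fun w _ => mem_specialFamily.2 ⟨_, rfl⟩) _ fun M hM => ?_
  have hbal := isBalanced_out hd hℓ hM
  choose g hg using exists_neighbor_index hbal
  have hiso : ∀ w ∈ Finset.univ.filter (fun w => Φ w = M),
      Nonempty (specialGraph d ℓ (extendMatching w) ≃g M.out) := fun w hw => by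
    have := (Finset.mem_filter.1 hw).2
    rwa [← Quotient.out_eq M, mk_eq_mk_iff] at this
  choose! τ hτ using fun (w : PathPair d → Equiv.Perm (Fin ℓ))
      (hw : w ∈ Finset.univ.filter (fun w => Φ w = M)) =>
    (⟨(hiso w hw).some, (hiso w hw).some.map_rel_iff⟩ :
      ∃ τ : Equiv.Perm (MotifVertex d ℓ), ∀ {x y}, M.out.Adj (τ x) (τ y) ↔
        (specialGraph d ℓ (extendMatching w)).Adj x y)
  have hcard : Fintype.card (MotifVertex d ℓ × (MotifVertex d ℓ → Fin d))
      = Fintype.card (MotifVertex d ℓ) * d ^ Fintype.card (MotifVertex d ℓ) := by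
    rw [Fintype.card_prod, Fintype.card_fun, Fintype.card_fin]
  rw [← hcard, ← Finset.card_univ]
  -- An isomorphism onto the representative is recovered from the image of the root and, for each
  -- vertex, the label of its image among the neighbors of the image of its parent. The spanning
  -- tree is common to all special graphs, so the isomorphism in turn determines the labeled graph
  -- and hence the matchings.
  refine Finset.card_le_card_of_injOn (fun w => (τ w (Sum.inl 1),
    fun x => g (τ w (parent d ℓ hd' hℓ x)) (τ w x))) (fun _ _ => Finset.mem_univ _) ?_
  intro w hw w' hw' h
  rw [Finset.mem_coe] at hw hw'
  simp only [Prod.mk.injEq] at h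
  obtain ⟨h0, h2⟩ := h
  have hadj : ∀ w ∈ Finset.univ.filter (fun w => Φ w = M), ∀ x, x ≠ Sum.inl 1 →
      τ w x ∈ M.out.neighborSet (τ w (parent d ℓ hd' hℓ x)) := fun w hw x hx =>
    (hτ w hw).2 (specialGraph_adj_parent hd' hℓ x hx)
  have hall : ∀ x, τ w x = τ w' x := by
    refine tree_induction hd' hℓ h0 fun x hx hp => ?_
    have h3 := congrFun h2 x
    have h4 := hadj w hw x hx
    have h5 := hadj w' hw' x hx
    rw [hp] at h3 h4
    exact hg _ h4 h5 h3
  refine extendMatching_injective ?_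
  ext x y
  rw [← hτ w hw, ← hτ w' hw', hall, hall]

end Special

/-! ### The error of the test -/

section Test
variable {d ℓ n : ℕ} {ρ : ℝ}

/-- Chebyshev's inequality at distance S/2 from the mean. Under the null the second moment is S,
giving 4/S; under the alternative the variance is at most 2S + 0.001 S², giving 8/S + 0.004. With S
≥ 1000 the sum is at most 0.016. -/
theorem totalError_le {p : I} (hp0 : 0 < (p : ℝ)) (hp1 : (p : ℝ) < 1) (hρ0 : 0 < ρ) (hρ1 : ρ ≤ 1)
    (hd : 3 ≤ d) (hℓ : 1 ≤ ℓ) (hVn : Fintype.card (MotifVertex d ℓ) ≤ n)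
    (hS : 1000 ≤ (specialFamily d ℓ).card * ρ ^ (2 * numEdges d ℓ)) {θ : ℝ} (hθ0 : 0 ≤ θ)
    (hθ : ∀ k, 1 ≤ k → k ≤ 2 * Fintype.card (MotifVertex d ℓ) →
      (p : ℝ) * (1 - p) ≤ θ ^ 2 * ((n : ℝ) ^ 2 * ((p : ℝ) * (1 - p)) ^ d) ^ k)
    (hsmall : ((n : ℝ) ^ Fintype.card (MotifVertex d ℓ)
          / n.descFactorial (Fintype.card (MotifVertex d ℓ))) ^ 2
          * (4 * Fintype.card (MotifVertex d ℓ) : ℝ) ^ (4 * Fintype.card (MotifVertex d ℓ)) * θ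
          ≤ 0.001 * ρ ^ (2 * numEdges d ℓ)) :
    totalError d ℓ n p ρ ≤ 0.05 := by
  set e := numEdges d ℓ with he
  set 𝓜 := specialFamily d ℓ with h𝓜
  have hbal : ∀ M ∈ 𝓜, IsBalanced d e M.out := fun M hM => isBalanced_out hd hℓ hM
  set S : ℝ := 𝓜.card * ρ ^ (2 * e) with hSdef
  have hn : 0 < n := lt_of_lt_of_le (by rw [card_motifVertex]; omega) hVn
  have hprob := isProbabilityMeasure_correlatedLaw (n := n) hp0.le hp1.le hρ0.le hρ1
  have hprob0 : IsProbabilityMeasure (nullLaw n p) := by unfold nullLaw; infer_instance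
  have hbiv := isProbabilityMeasure_bivariateBernoulli hp0.le hp1.le hρ0.le hρ1
  have hmean : ∫ G, specialStatistic d ℓ n p ρ G ∂(correlatedLaw n p ρ) = S := by
    rw [hSdef, ← integral_bitStatistic hp0 hp1 hρ0 hρ1 hVn hbal]
    exact integral_correlatedLaw hp0.le hp1.le hρ0.le hρ1 𝓜 id
  have hτ : threshold d ℓ n p ρ = S / 2 := by rw [threshold, hmean]
  have hnull : ∫ G, specialStatistic d ℓ n p ρ G ^ 2 ∂(nullLaw n p) = S :=
    integral_nullLaw_sq_eq hp0 hp1 hVn hbal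
  have hsq : ∫ G, specialStatistic d ℓ n p ρ G ^ 2 ∂(correlatedLaw n p ρ)
      ≤ S ^ 2 + 2 * S + 0.001 * S ^ 2 := by
    rw [show ∫ G, specialStatistic d ℓ n p ρ G ^ 2 ∂(correlatedLaw n p ρ) = _ from
      integral_correlatedLaw hp0.le hp1.le hρ0.le hρ1 𝓜 (fun x => x ^ 2)]
    refine (integral_bitStatistic_sq_le hbal hp0 hp1 hρ0 hρ1 hn hVn hθ0 hθ).trans ?_
    have h1 := mul_le_mul_of_nonneg_left hsmall
      (by positivity : 0 ≤ (𝓜.card : ℝ) ^ 2 * ρ ^ (2 * e))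
    have h2 : S ^ 2 = (𝓜.card : ℝ) ^ 2 * ρ ^ (2 * e) * ρ ^ (2 * e) := by rw [hSdef]; ring
    nlinarith
  have hvar : ∫ G, (specialStatistic d ℓ n p ρ G - S) ^ 2 ∂(correlatedLaw n p ρ)
      ≤ 2 * S + 0.001 * S ^ 2 := by
    have h1 : ∀ G : SimpleGraph (Fin n) × SimpleGraph (Fin n),
        (specialStatistic d ℓ n p ρ G - S) ^ 2
        = specialStatistic d ℓ n p ρ G ^ 2 - 2 * S * specialStatistic d ℓ n p ρ G + S ^ 2 :=
      fun G => by ring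
    simp only [h1]
    rw [integral_add Integrable.of_finite Integrable.of_finite,
      integral_sub Integrable.of_finite Integrable.of_finite, integral_const_mul, hmean]
    simp
    linarith
  have hSpos : 0 < S := by linarith
  have hE0 : (nullLaw n p).real {G | threshold d ℓ n p ρ ≤ specialStatistic d ℓ n p ρ G}
      ≤ 4 / S := by
    have h1 := mul_meas_ge_le_integral_of_nonneg (μ := nullLaw n p)
      (f := fun G => specialStatistic d ℓ n p ρ G ^ 2)
      (ae_of_all _ fun G => sq_nonneg _) Integrable.of_finite ((S / 2) ^ 2)
    rw [hnull] at h1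
    have h2 : (nullLaw n p).real {G | threshold d ℓ n p ρ ≤ specialStatistic d ℓ n p ρ G}
        ≤ (nullLaw n p).real {G | (S / 2) ^ 2 ≤ specialStatistic d ℓ n p ρ G ^ 2} := by
      refine measureReal_mono ?_
      intro G hG
      simp only [Set.mem_ofPred_eq, hτ] at hG ⊢
      gcongr
    rw [le_div_iff₀ hSpos]
    nlinarith
  have hE1 : (correlatedLaw n p ρ).real {G | specialStatistic d ℓ n p ρ G < threshold d ℓ n p ρ}
      ≤ 8 / S + 0.004 := by
    have h1 := mul_meas_ge_le_integral_of_nonneg (μ := correlatedLaw n p ρ)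
      (f := fun G => (specialStatistic d ℓ n p ρ G - S) ^ 2)
      (ae_of_all _ fun G => sq_nonneg _) Integrable.of_finite ((S / 2) ^ 2)
    have h2 : (correlatedLaw n p ρ).real {G | specialStatistic d ℓ n p ρ G < threshold d ℓ n p ρ}
        ≤ (correlatedLaw n p ρ).real
          {G | (S / 2) ^ 2 ≤ (specialStatistic d ℓ n p ρ G - S) ^ 2} := by
      refine measureReal_mono ?_
      intro G hG
      simp only [Set.mem_ofPred_eq, hτ] at hG ⊢
      nlinarith
    have h3 := h1.trans hvar
    rw [← sub_le_iff_le_add, le_div_iff₀ hSpos]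
    nlinarith
  have h4 : 4 / S ≤ 0.004 := by rw [div_le_iff₀ hSpos]; linarith
  have h8 : 8 / S ≤ 0.008 := by rw [div_le_iff₀ hSpos]; linarith
  unfold totalError
  linarith

theorem mul_log_sub_le_log_factorial (hℓ : 1 ≤ ℓ) :
    (ℓ : ℝ) * (Real.log ℓ - 1) ≤ Real.log (ℓ ! : ℝ) := by
  have h1 : (ℓ : ℝ) ^ ℓ / (ℓ ! : ℝ) ≤ Real.exp ℓ :=
    Real.pow_div_factorial_le_exp _ (by positivity) ℓ
  have hf : (0 : ℝ) < (ℓ ! : ℝ) := by exact_mod_cast Nat.factorial_pos ℓ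
  have hl : (0 : ℝ) < ℓ := by exact_mod_cast hℓ
  rw [div_le_iff₀ hf] at h1
  have h2 := Real.log_le_log (by positivity) h1
  rw [Real.log_pow, Real.log_mul (Real.exp_pos _).ne' hf.ne', Real.log_exp] at h2
  linarith

/-- The constant in the lower bound on the number of edges. -/
noncomputable def edgeConstant (d : ℕ) : ℝ := 2 * (d : ℝ) ^ 2 * Real.exp (8 + 4 * d + 3 * d ^ 2)

-- In logarithms the family gains C(d-1,2) ℓ log ℓ and the power of ρ costs d(d-1) ℓ |log ρ|, up to
-- terms linear in ℓ. As 2 C(d-1,2) = (d-1)(d-2), the gain wins once log ℓ exceeds 2d/(d-2) |log ρ|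
-- by a constant, which is what the lower bound on the number of edges provides.
set_option maxHeartbeats 800000 in
theorem family_large (hd : 3 ≤ d) (hℓ : 1 ≤ ℓ) (hρ0 : 0 < ρ) (hρ1 : ρ ≤ 1)
    (hN : edgeConstant d / ρ ^ (2 * (d : ℝ) / ((d : ℝ) - 2)) ≤ (numEdges d ℓ : ℝ)) :
    1000 ≤ (specialFamily d ℓ).card * ρ ^ (2 * numEdges d ℓ) := by
  have hD : (3 : ℝ) ≤ d := by exact_mod_cast hd
  have hl : (1 : ℝ) ≤ ℓ := by exact_mod_cast hℓ
  set D : ℝ := ((d : ℕ) : ℝ) with hDdef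
  set l : ℝ := ((ℓ : ℕ) : ℝ) with hldef
  set r : ℝ := - Real.log ρ with hr
  have hr0 : 0 ≤ r := by rw [hr, neg_nonneg]; exact Real.log_nonpos hρ0.le hρ1
  set lam : ℝ := Real.log l with hlam
  have hlaml : lam ≤ l := (Real.log_le_sub_one_of_pos (by linarith)).trans (by linarith)
  set K : ℝ := (((d - 1).choose 2 : ℕ) : ℝ) with hK
  have hK2 : 2 * K = (D - 1) * (D - 2) := by
    have : ((d - 1).choose 2) * 2 = (d - 1) * (d - 2) := by
      rw [Nat.choose_two_right, show d - 2 = d - 1 - 1 by omega]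
      exact Nat.div_mul_cancel (Nat.even_mul_pred_self (d - 1)).two_dvd
    have h : (((d - 1).choose 2 : ℕ) : ℝ) * 2 = ((d - 1 : ℕ) : ℝ) * ((d - 2 : ℕ) : ℝ) := by
      exact_mod_cast this
    rw [Nat.cast_sub (by omega), Nat.cast_sub (by omega)] at h
    push_cast at h
    rw [hK, hDdef]; linarith
  have hN2 : 2 * (numEdges d ℓ : ℝ) = D * (D - 1) * l + 2 * D + 2 := by
    have : (d.choose 2) * 2 = d * (d - 1) := by
      rw [Nat.choose_two_right]
      exact Nat.div_mul_cancel (Nat.even_mul_pred_self d).two_dvd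
    have h : ((d.choose 2 : ℕ) : ℝ) * 2 = (d : ℝ) * ((d - 1 : ℕ) : ℝ) := by exact_mod_cast this
    rw [Nat.cast_sub (by omega)] at h
    push_cast at h
    rw [numEdges]; push_cast
    rw [hDdef, hldef]; linear_combination (ℓ : ℝ) * h
  have hv : (Fintype.card (MotifVertex d ℓ) : ℝ) = (D - 1) * l + 4 := by
    rw [card_motifVertex]; push_cast [Nat.cast_sub (by omega : 1 ≤ d)]; rfl
  set v : ℝ := (Fintype.card (MotifVertex d ℓ) : ℝ) with hvdef
  -- The constant collects the error terms per unit of ℓ: 1 from Stirling's bound, 7 from log 1000,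
  -- 3D from log v, 3D² from v log d, and D from the d + 1 edges whose number does not grow with ℓ.
  set L : ℝ := 8 + 4 * D + 3 * D ^ 2 with hL
  -- the lower bound on `ℓ`
  have hlog : L * (D - 2) + 2 * D * r ≤ (D - 2) * lam := by
    have h1 : (numEdges d ℓ : ℝ) ≤ 2 * D ^ 2 * l := by nlinarith
    have h2 := hN.trans h1
    rw [edgeConstant, mul_div_assoc] at h2
    have h3 := le_of_mul_le_mul_left h2 (by positivity)
    have h4 := Real.log_le_log (by positivity) h3
    rw [Real.log_div (Real.exp_pos _).ne' (Real.rpow_pos_of_pos hρ0 _).ne', Real.log_exp,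
      Real.log_rpow hρ0] at h4
    have h5 : (D - 2) * (L - 2 * D / (D - 2) * Real.log ρ) ≤ (D - 2) * lam :=
      mul_le_mul_of_nonneg_left h4 (by linarith)
    have h6 : (D - 2) * (2 * D / (D - 2) * Real.log ρ) = 2 * D * Real.log ρ := by
      field_simp [(by linarith : D - 2 ≠ 0)]
    rw [hr]
    linarith
  -- the size of the family
  have hfac := factorial_pow_le hd hℓ
  have hfac' : ((ℓ ! : ℕ) : ℝ) ^ (d - 1).choose 2 ≤ ((specialFamily d ℓ).card : ℝ) *
      (v * D ^ Fintype.card (MotifVertex d ℓ)) := by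
    rw [hvdef, hDdef]; exact_mod_cast hfac
  have hf : (0 : ℝ) < ((ℓ ! : ℕ) : ℝ) := by exact_mod_cast Nat.factorial_pos ℓ
  have hcardpos : 0 < ((specialFamily d ℓ).card : ℝ) := by
    by_contra hneg
    have h0 : ((specialFamily d ℓ).card : ℝ) = 0 := le_antisymm (not_lt.1 hneg) (by positivity)
    rw [h0, zero_mul] at hfac'
    exact absurd hfac' (not_le.2 (by positivity))
  have hvpos : 0 < v := by rw [hv]; nlinarith
  have hlogM := Real.log_le_log (by positivity) hfac'
  rw [Real.log_pow, Real.log_mul hcardpos.ne' (by positivity),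
    Real.log_mul hvpos.ne' (by positivity),
    Real.log_pow] at hlogM
  have hfl := mul_log_sub_le_log_factorial hℓ
  have hv3 : v ≤ 3 * D * l := by rw [hv]; nlinarith
  have hlogv : Real.log v ≤ v := (Real.log_le_sub_one_of_pos hvpos).trans (by linarith)
  have hlogd : Real.log D ≤ D := (Real.log_le_sub_one_of_pos (by linarith)).trans (by linarith)
  have hK1 : 1 ≤ K := by nlinarith
  have hlog1000 : Real.log 1000 ≤ 7 := by
    rw [Real.log_le_iff_le_exp (by norm_num)]
    have h1 : (2.7182818283 : ℝ) < Real.exp 1 := Real.exp_one_gt_d9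
    have h2 : Real.exp 7 = Real.exp 1 ^ 7 := by rw [← Real.exp_nat_mul]; norm_num
    rw [h2]
    calc (1000 : ℝ) ≤ 2.7182818283 ^ 7 := by norm_num
      _ ≤ _ := by gcongr
  have hpos : 0 < ((specialFamily d ℓ).card : ℝ) * ρ ^ (2 * numEdges d ℓ) := by positivity
  rw [← Real.log_le_log_iff (by norm_num) hpos, Real.log_mul hcardpos.ne' (by positivity),
    Real.log_pow]
  push_cast
  rw [hN2]
  have hr' : Real.log ρ = -r := by rw [hr]; ring
  rw [hr']
  have h1 : K * (l * (lam - 1)) ≤ K * Real.log ((ℓ ! : ℕ) : ℝ) :=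
    mul_le_mul_of_nonneg_left hfl (by linarith)
  have h2 : v * Real.log D ≤ (3 * D * l) * D := by
    refine mul_le_mul hv3 hlogd (Real.log_nonneg (by linarith)) (by positivity)
  have hL0 : 0 ≤ L := by positivity
  -- `2 D r ≤ (D - 2) (lam - L)`
  have h3 : D * (D - 1) * l * r ≤ K * l * (lam - L) := by
    have h := mul_le_mul_of_nonneg_left hlog
      (div_nonneg (mul_nonneg (by linarith) (by linarith)) zero_le_two :
      0 ≤ (D - 1) * l / 2)
    have e1 : (D - 1) * l / 2 * ((D - 2) * lam) = K * l * lam := by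
      linear_combination (-(l * lam) / 2) * hK2
    have e2 : (D - 1) * l / 2 * (L * (D - 2) + 2 * D * r) = K * l * L + D * (D - 1) * l * r := by
      linear_combination (-(l * L) / 2) * hK2
    rw [e1, e2] at h
    linarith
  -- The lower bound on log ℓ, combined with log ℓ ≤ ℓ, makes |log ρ| itself at most linear in ℓ.
  have h4 : (2 * D + 2) * r ≤ D * l := by
    have h5 : (D - 2) * lam ≤ (D - 2) * l := mul_le_mul_of_nonneg_left hlaml (by linarith)
    have h7 : 0 ≤ L * (D - 2) := mul_nonneg hL0 (by linarith)
    have h8 : 2 * D * r ≤ (D - 2) * l := by linarith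
    have h9 : (D + 1) * (2 * D * r) ≤ (D + 1) * ((D - 2) * l) :=
      mul_le_mul_of_nonneg_left h8 (by linarith)
    have h10 : D * ((2 * D + 2) * r) ≤ D * (D * l) := by nlinarith
    exact le_of_mul_le_mul_left h10 (by linarith)
  have h6 : l * (7 + 3 * D + 3 * D ^ 2 + D) ≤ K * l * (L - 1) := by
    have : l * (L - 1) ≤ K * (l * (L - 1)) :=
      le_mul_of_one_le_left (mul_nonneg (by linarith) (by rw [hL]; nlinarith)) hK1
    have h7 : l * (7 + 3 * D + 3 * D ^ 2 + D) = l * (L - 1) := by rw [hL]; ring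
    rw [h7]
    linarith
  have h7 : (D * (D - 1) * l + 2 * D + 2) * (-r) = -(D * (D - 1) * l * r) - (2 * D + 2) * r := by
    ring
  rw [h7]
  have h8 : l * (7 + 3 * D + 3 * D ^ 2 + D) = 7 * l + 3 * D * l + 3 * D * l * D + D * l := by ring
  linarith

end Test

/-! ### Consequences of slow growth -/

section Asymptotic

/-- Eventually log log n ≥ 1, so the maximum may be replaced by 1 or by either of its terms. In
particular N ≤ log n, hence log N ≤ log log n and N^N = n^(o(1)). -/
theorem SlowlyGrowing.eventually_le {N : ℕ → ℕ} {ρ : ℕ → ℝ} (h : SlowlyGrowing N ρ) {c : ℝ}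
    (hc : 0 < c) :
    ∀ᶠ n : ℕ in atTop, (N n : ℝ) ≤ c * Real.log n ∧
      (N n : ℝ) * Real.log (Real.log n) ≤ c * Real.log n ∧
      (N n : ℝ) * (-Real.log (ρ n)) ≤ c * Real.log n ∧
      (N n : ℝ) * Real.log (N n) ≤ c * Real.log n := by
  have hlog : Tendsto (fun n : ℕ => Real.log n) atTop atTop :=
    Real.tendsto_log_atTop.comp tendsto_natCast_atTop_atTop
  have hloglog : Tendsto (fun n : ℕ => Real.log (Real.log n)) atTop atTop :=
    Real.tendsto_log_atTop.comp hlog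
  have hmain : ∀ c : ℝ, 0 < c → ∀ᶠ n : ℕ in atTop,
      (N n : ℝ) * max (Real.log (Real.log n)) (-Real.log (ρ n)) ≤ c * Real.log n := by
    intro c hc
    filter_upwards [h.def hc, hlog.eventually_ge_atTop 1, hloglog.eventually_ge_atTop 1]
      with n h1 h2 h3
    have hmax : 1 ≤ max (Real.log (Real.log n)) (-Real.log (ρ n)) := h3.trans (le_max_left _ _)
    rw [Real.norm_of_nonneg (by positivity), Real.norm_of_nonneg (by positivity), ← mul_div_assoc,
      le_div_iff₀ (by positivity)] at h1
    exact h1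
  filter_upwards [hmain c hc, hmain 1 one_pos, hlog.eventually_ge_atTop 1,
    hloglog.eventually_ge_atTop 1] with n h1 h2 h3 h4
  have hmax1 := le_max_left (Real.log (Real.log n)) (-Real.log (ρ n))
  have hmax2 := le_max_right (Real.log (Real.log n)) (-Real.log (ρ n))
  have hN0 : (0 : ℝ) ≤ N n := by positivity
  have hA : (N n : ℝ) * Real.log (Real.log n) ≤ c * Real.log n :=
    (mul_le_mul_of_nonneg_left hmax1 hN0).trans h1
  have hB : (N n : ℝ) * Real.log (Real.log n) ≤ 1 * Real.log n :=
    (mul_le_mul_of_nonneg_left hmax1 hN0).trans h2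
  refine ⟨?_, hA, (mul_le_mul_of_nonneg_left hmax2 hN0).trans h1, ?_⟩
  · exact (le_mul_of_one_le_right hN0 h4).trans hA
  · have hNlog : (N n : ℝ) ≤ Real.log n := by
      have := le_mul_of_one_le_right hN0 h4
      linarith
    rcases Nat.eq_zero_or_pos (N n) with h0 | h0
    · rw [h0]; simp; positivity
    · have : Real.log (N n) ≤ Real.log (Real.log n) :=
        Real.log_le_log (by exact_mod_cast h0) hNlog
      exact (mul_le_mul_of_nonneg_left this hN0).trans hA

/-- As C(d,2) ≥ d for d ≥ 3, there are at least ℓ more edges than vertices. Besides bounding v by e,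
this yields the spare factor n in the running time. -/
theorem card_motifVertex_add_le_numEdges {d ℓ : ℕ} (hd : 3 ≤ d) :
    Fintype.card (MotifVertex d ℓ) + ℓ ≤ numEdges d ℓ := by
  rw [card_motifVertex, numEdges]
  have h : d ≤ d.choose 2 := by
    rw [Nat.choose_two_right, Nat.le_div_iff_mul_le two_pos]
    exact Nat.mul_le_mul_left d (by omega)
  have h1 : (d - 1) * ℓ + ℓ ≤ d.choose 2 * ℓ := by
    calc (d - 1) * ℓ + ℓ = (d - 1 + 1) * ℓ := by ring
      _ = d * ℓ := by rw [Nat.sub_add_cancel (by omega)]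
      _ ≤ _ := Nat.mul_le_mul_right ℓ h
  omega

theorem pow_div_descFactorial_le {n v : ℕ} (h : 2 * v ≤ n) (hv : 0 < v) :
    (n : ℝ) ^ v / n.descFactorial v ≤ 2 ^ v := by
  have h1 : (0 : ℝ) < n.descFactorial v := by
    exact_mod_cast Nat.descFactorial_pos.2 (by omega)
  rw [div_le_iff₀ h1]
  have h2 : n ^ v ≤ 2 ^ v * n.descFactorial v := by
    calc n ^ v ≤ (2 * (n + 1 - v)) ^ v := Nat.pow_le_pow_left (by omega) v
      _ = 2 ^ v * (n + 1 - v) ^ v := mul_pow _ _ _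
      _ ≤ _ := Nat.mul_le_mul_left _ (Nat.pow_sub_le_descFactorial n v)
  exact_mod_cast h2

set_option maxHeartbeats 400000 in
/-- The two regimes share the following conclusion: the test succeeds as soon as the overlaps of
copies lose a power of `n`. -/
theorem eventually_totalError_le {d : ℕ} (hd : 3 ≤ d) {b : ℝ} (hb : 0 < b) {p : ℕ → I} {ρ : ℕ → ℝ}
    {ℓ : ℕ → ℕ} (hp : ∀ᶠ n in atTop, 0 < (p n : ℝ) ∧ (p n : ℝ) < 1)
    (hρ : ∀ᶠ n in atTop, 0 < ρ n ∧ ρ n ≤ 1) (hℓ : ∀ᶠ n in atTop, 1 ≤ ℓ n)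
    (hslow : SlowlyGrowing (fun n => numEdges d (ℓ n)) ρ)
    (hN : ∀ᶠ n in atTop,
      edgeConstant d / ρ n ^ (2 * (d : ℝ) / ((d : ℝ) - 2)) ≤ (numEdges d (ℓ n) : ℝ))
    (hθ : ∀ᶠ n : ℕ in atTop, ∀ v : ℕ, 1 ≤ v → ∀ k, 1 ≤ k → k ≤ 2 * v →
      (p n : ℝ) * (1 - p n) ≤ (2 ^ (d * v) * (n : ℝ) ^ (-(b / 2))) ^ 2
        * ((n : ℝ) ^ 2 * ((p n : ℝ) * (1 - p n)) ^ d) ^ k) :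
    ∀ᶠ n in atTop, totalError d (ℓ n) n (p n) (ρ n) ≤ 0.05 := by
  have hlog : Tendsto (fun n : ℕ => Real.log n) atTop atTop :=
    Real.tendsto_log_atTop.comp tendsto_natCast_atTop_atTop
  -- The errors 2N, 8N + 4N log N, dN and 2N |log ρ| add up to at most (d + 16) c log n, hence to at
  -- most half of the available (b/2) log n. The other half absorbs the constant 0.001.
  set c : ℝ := b / (4 * (d + 22)) with hc
  have hc0 : 0 < c := by positivity
  filter_upwards [hp, hρ, hℓ, hN, hθ, hslow.eventually_le hc0, hslow.eventually_le one_half_pos,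
    hlog.eventually_ge_atTop (4 / b * 7), eventually_ge_atTop 1]
    with n hp hρ hℓ hN hθ hslow hhalf hlogn hn1
  obtain ⟨hs1, -, hs3, hs4⟩ := hslow
  set N : ℝ := (numEdges d (ℓ n) : ℝ) with hNdef
  set v := Fintype.card (MotifVertex d (ℓ n)) with hv
  have hvN : (v : ℝ) ≤ N := by
    have := card_motifVertex_add_le_numEdges (ℓ := ℓ n) hd
    rw [hNdef]; exact_mod_cast (by omega : v ≤ numEdges d (ℓ n))
  have hv4 : 4 ≤ v := by rw [hv, card_motifVertex]; omega
  have hvr : (4 : ℝ) ≤ v := by exact_mod_cast hv4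
  have hnr : (1 : ℝ) ≤ n := by exact_mod_cast hn1
  have hlogn' : Real.log n ≤ n := (Real.log_le_sub_one_of_pos (by linarith)).trans (by linarith)
  have h2v : 2 * v ≤ n := by
    have : (2 : ℝ) * v ≤ n := by linarith [hhalf.1]
    exact_mod_cast this
  have hdr : (3 : ℝ) ≤ d := by exact_mod_cast hd
  set θ : ℝ := 2 ^ (d * v) * (n : ℝ) ^ (-(b / 2)) with hθdef
  have hθ0 : 0 < θ := by positivity
  refine totalError_le hp.1 hp.2 hρ.1 hρ.2 hd hℓ (by omega) (family_large hd hℓ hρ.1 hρ.2 hN)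
    hθ0.le (hθ v (by omega)) ?_
  have hbase : ((2 : ℝ) ^ v) ^ 2 * (4 * v) ^ (4 * v) * θ
      ≤ 0.001 * ρ n ^ (2 * numEdges d (ℓ n)) := by
    have hρpos := hρ.1
    have l1 : Real.log (((2 : ℝ) ^ v) ^ 2 * (4 * v) ^ (4 * v) * θ)
        = 2 * (v * Real.log 2) + 4 * v * (Real.log 4 + Real.log v)
          + (d * v * Real.log 2 + -(b / 2) * Real.log n) := by
      rw [Real.log_mul (by positivity) hθ0.ne', Real.log_mul (by positivity) (by positivity),
        Real.log_pow, Real.log_pow, Real.log_pow, Real.log_mul (by norm_num) (by positivity),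
        hθdef, Real.log_mul (by positivity) (by positivity), Real.log_pow,
        Real.log_rpow (by linarith)]
      push_cast
      ring
    have l2 : Real.log (0.001 * ρ n ^ (2 * numEdges d (ℓ n)))
        = Real.log 0.001 + 2 * N * Real.log (ρ n) := by
      rw [Real.log_mul (by norm_num) (by positivity), Real.log_pow]
      push_cast
      rfl
    rw [← Real.log_le_log_iff (by positivity) (by positivity), l1, l2]
    have hl2 : Real.log 2 ≤ 1 := by
      have := Real.log_two_lt_d9; linarith
    have hl20 : 0 ≤ Real.log 2 := Real.log_nonneg (by norm_num)
    have hl4 : Real.log 4 ≤ 2 := by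
      rw [show (4 : ℝ) = 2 ^ 2 by norm_num, Real.log_pow]; push_cast; linarith
    have hl001 : -7 ≤ Real.log 0.001 := by
      rw [show (0.001 : ℝ) = 1000⁻¹ by norm_num, Real.log_inv, neg_le_neg_iff,
        Real.log_le_iff_le_exp (by norm_num), show (7 : ℝ) = ((7 : ℕ) : ℝ) * 1 by norm_num,
        Real.exp_nat_mul]
      calc (1000 : ℝ) ≤ 2.7182818283 ^ 7 := by norm_num
        _ ≤ _ := by gcongr; exact Real.exp_one_gt_d9.le
    have hlv0 : 0 ≤ Real.log v := Real.log_nonneg (by linarith)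
    have hlv : (v : ℝ) * Real.log v ≤ N * Real.log N :=
      mul_le_mul hvN (Real.log_le_log (by linarith) hvN) hlv0 (by linarith)
    have hN0 : 0 ≤ N := by linarith
    have e0 : v * Real.log 2 ≤ N * 1 := mul_le_mul hvN hl2 hl20 hN0
    have e1 : 2 * (v * Real.log 2) ≤ 2 * N := by linarith
    have e2 : 4 * v * (Real.log 4 + Real.log v) ≤ 8 * N + 4 * (N * Real.log N) := by
      have : v * Real.log 4 ≤ N * 2 :=
        mul_le_mul hvN hl4 (Real.log_nonneg (by norm_num)) hN0
      rw [show 4 * v * (Real.log 4 + Real.log v) = 4 * (v * Real.log 4) + 4 * (v * Real.log v) by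
        ring]
      linarith
    have e3 : d * v * Real.log 2 ≤ d * N := by
      rw [mul_assoc]
      exact mul_le_mul_of_nonneg_left (by linarith) (by linarith)
    have e4 : (16 + d) * (c * Real.log n) ≤ b / 4 * Real.log n := by
      rw [← mul_assoc]
      have h0 : 0 ≤ Real.log n := Real.log_nonneg hnr
      refine mul_le_mul_of_nonneg_right ?_ h0
      rw [hc, ← mul_div_assoc, div_le_div_iff₀ (by positivity) (by norm_num)]
      linarith
    have e5 : 7 ≤ b / 4 * Real.log n := by
      have := mul_le_mul_of_nonneg_left hlogn (by positivity : 0 ≤ b / 4)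
      have h7 : b / 4 * (4 / b * 7) = 7 := by field_simp
      linarith
    have e6 : (d : ℝ) * N ≤ d * (c * Real.log n) := mul_le_mul_of_nonneg_left hs1 (by linarith)
    linarith
  refine le_trans ?_ hbase
  gcongr
  exact pow_div_descFactorial_le h2v (by omega)

/-- Since d = ⌊2/a⌋, one has da ≤ 2 and n² p^d ≥ 1. The gain is then √p = n^(-a/2), that is b = a;
the factors 1 - p ≥ 1/2 cost a power of 2 absorbed into θ. -/
theorem sparse_regime (d : ℕ) {a : ℝ} (ha : 0 < a) (ha' : a ≤ 2 / 3) (hda : d = ⌊2 / a⌋₊)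
    {p : ℕ → I} {ρ : ℕ → ℝ} {ℓ : ℕ → ℕ} (hp : ∀ᶠ n : ℕ in atTop, (p n : ℝ) = (n : ℝ) ^ (-a))
    (hρ : ∀ᶠ n in atTop, 0 < ρ n ∧ ρ n ≤ 1) (hℓ : ∀ᶠ n in atTop, 1 ≤ ℓ n)
    (hslow : SlowlyGrowing (fun n => numEdges d (ℓ n)) ρ)
    (hN : ∀ᶠ n in atTop,
      edgeConstant d / ρ n ^ (2 * (d : ℝ) / ((d : ℝ) - 2)) ≤ (numEdges d (ℓ n) : ℝ)) :
    ∀ᶠ n in atTop, totalError d (ℓ n) n (p n) (ρ n) ≤ 0.05 := by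
  have hd : 3 ≤ d := by
    rw [hda, Nat.le_floor_iff (by positivity), le_div_iff₀ ha]
    push_cast; linarith
  have hda' : (d : ℝ) * a ≤ 2 := by
    rw [← le_div_iff₀ ha, hda]
    exact Nat.floor_le (by positivity)
  have hhalf : ∀ᶠ n : ℕ in atTop, (n : ℝ) ^ (-a) ≤ 1 / 2 :=
    ((tendsto_rpow_neg_atTop ha).comp tendsto_natCast_atTop_atTop).eventually
      (ge_mem_nhds (by norm_num))
  refine eventually_totalError_le hd ha ?_ hρ hℓ hslow hN ?_
  · filter_upwards [hp, hhalf, eventually_gt_atTop 0] with n hp hhalf hn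
    rw [hp]
    exact ⟨by positivity, by linarith⟩
  · filter_upwards [hp, hhalf, eventually_gt_atTop 0] with n hp hhalf hn v hv k hk1 hk2
    have hn0 : (0 : ℝ) < n := by exact_mod_cast hn
    have hn1 : (1 : ℝ) ≤ n := by exact_mod_cast hn
    set q : ℝ := (p n : ℝ) with hq
    have hq0 : 0 < q := by rw [hp]; positivity
    have h1 : 1 ≤ (n : ℝ) ^ 2 * q ^ d := by
      rw [hp, ← Real.rpow_natCast ((n : ℝ) ^ (-a)) d, ← Real.rpow_mul hn0.le,
        ← Real.rpow_natCast (n : ℝ) 2, ← Real.rpow_add hn0]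
      refine Real.one_le_rpow hn1 ?_
      push_cast; linarith
    have h2 : ((1 : ℝ) / 2) ^ (2 * (d * v)) ≤ ((n : ℝ) ^ 2 * (q * (1 - q)) ^ d) ^ k := by
      calc ((1 : ℝ) / 2) ^ (2 * (d * v)) ≤ (1 / 2) ^ (d * k) := by
            refine pow_le_pow_of_le_one (by norm_num) (by norm_num) ?_
            calc d * k ≤ d * (2 * v) := Nat.mul_le_mul_left d hk2
              _ = _ := by ring
        _ = ((1 / 2 : ℝ) ^ d) ^ k := pow_mul _ _ _
        _ ≤ ((n : ℝ) ^ 2 * (q * (1 - q)) ^ d) ^ k := by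
            refine pow_le_pow_left₀ (by positivity) ?_ k
            rw [mul_pow, ← mul_assoc]
            have : ((1 : ℝ) / 2) ^ d ≤ (1 - q) ^ d :=
              pow_le_pow_left₀ (by norm_num) (by rw [hp]; linarith) d
            exact this.trans (le_mul_of_one_le_left (pow_nonneg (by rw [hp]; linarith) d) h1)
    have h3 : (2 ^ (d * v) * (n : ℝ) ^ (-(a / 2))) ^ 2 = 2 ^ (2 * (d * v)) * q := by
      rw [mul_pow, ← pow_mul, mul_comm (d * v) 2, hp, ← Real.rpow_natCast _ 2,
        ← Real.rpow_mul hn0.le]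
      congr 2
      push_cast; ring
    calc q * (1 - q) ≤ q := by nlinarith
      _ = 2 ^ (2 * (d * v)) * q * (1 / 2) ^ (2 * (d * v)) := by
          rw [mul_right_comm, ← mul_pow]; norm_num
      _ ≤ _ := by rw [h3]; gcongr

/-- The choice of d gives d - 2 > 4/ε, that is 2d/(d-2) = 2 + 4/(d-2) ≤ 2 + ε. As (p(1-p))^d ≥ 1/n
eventually, each missing vertex already loses √n, so b = 1 works. -/
theorem dense_regime {ε : ℝ} (hε : 0 < ε) {d : ℕ} (hdε : d = ⌊4 / ε⌋₊ + 3)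
    {p : ℕ → I} {ρ : ℕ → ℝ} {ℓ : ℕ → ℕ} (hp : ∀ᶠ n in atTop, 0 < (p n : ℝ) ∧ (p n : ℝ) < 1)
    (hp1 : (fun n => Real.log (p n)) =o[atTop] fun n : ℕ => Real.log n)
    (hp2 : (fun n => Real.log (1 - p n)) =o[atTop] fun n : ℕ => Real.log n)
    (hρ : ∀ᶠ n in atTop, 0 < ρ n ∧ ρ n ≤ 1) (hℓ : ∀ᶠ n in atTop, 1 ≤ ℓ n)
    (hslow : SlowlyGrowing (fun n => numEdges d (ℓ n)) ρ)
    (hN : ∀ᶠ n in atTop, edgeConstant d / ρ n ^ (2 + ε) ≤ (numEdges d (ℓ n) : ℝ)) :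
    ∀ᶠ n in atTop, totalError d (ℓ n) n (p n) (ρ n) ≤ 0.05 := by
  have hd : 3 ≤ d := by omega
  have hd2 : 2 * (d : ℝ) / ((d : ℝ) - 2) ≤ 2 + ε := by
    have h1 : 4 / ε < (d : ℝ) - 2 := by
      have := Nat.lt_floor_add_one (4 / ε)
      rw [hdε]; push_cast; linarith
    have h0 : 0 < 4 / ε := by positivity
    have h2 : 0 < (d : ℝ) - 2 := h0.trans h1
    rw [div_lt_iff₀ hε] at h1
    rw [div_le_iff₀ h2]
    nlinarith
  refine eventually_totalError_le hd one_pos hp hρ hℓ hslow ?_ ?_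
  · filter_upwards [hN, hρ] with n hN hρ
    refine le_trans ?_ hN
    have hρ0 := hρ.1
    have : ρ n ^ (2 + ε) ≤ ρ n ^ (2 * (d : ℝ) / ((d : ℝ) - 2)) :=
      Real.rpow_le_rpow_of_exponent_ge hρ.1 hρ.2 hd2
    unfold edgeConstant
    gcongr
  · have hc : (0 : ℝ) < 1 / (2 * d) := by positivity
    filter_upwards [hp, hp1.def hc, hp2.def hc, eventually_gt_atTop 0]
      with n hp h1 h2 hn v hv k hk1 hk2
    have hn0 : (0 : ℝ) < n := by exact_mod_cast hn
    have hn1 : (1 : ℝ) ≤ n := by exact_mod_cast hn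
    set q : ℝ := (p n : ℝ) with hq
    have hlog : 0 ≤ Real.log n := Real.log_nonneg hn1
    rw [Real.norm_eq_abs, Real.norm_of_nonneg hlog] at h1 h2
    have hq1 : 0 < 1 - q := by linarith
    have hqq : 0 < q * (1 - q) := mul_pos hp.1 hq1
    have hdpos : (0 : ℝ) < d := by positivity
    have h3 : (n : ℝ) ≤ (n : ℝ) ^ 2 * (q * (1 - q)) ^ d := by
      rw [← Real.log_le_log_iff hn0 (by positivity), Real.log_mul (by positivity) (by positivity),
        Real.log_pow, Real.log_pow, Real.log_mul hp.1.ne' hq1.ne']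
      have h4 := (abs_le.1 h1).1
      have h5 := (abs_le.1 h2).1
      have h6 : -(1 / (d : ℝ) * Real.log n) ≤ Real.log q + Real.log (1 - q) := by
        have : 1 / (d : ℝ) * Real.log n = 2 * (1 / (2 * d) * Real.log n) := by field_simp
        linarith
      have h7 := mul_le_mul_of_nonneg_left h6 hdpos.le
      have h8 : (d : ℝ) * -(1 / (d : ℝ) * Real.log n) = - Real.log n := by field_simp
      push_cast
      linarith
    have h4 : (n : ℝ) ≤ ((n : ℝ) ^ 2 * (q * (1 - q)) ^ d) ^ k :=
      h3.trans (le_self_pow₀ (hn1.trans h3) (by omega))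
    have h5 : (2 ^ (d * v) * (n : ℝ) ^ (-(1 / 2) : ℝ)) ^ 2 = 2 ^ (2 * (d * v)) * (n : ℝ)⁻¹ := by
      rw [mul_pow, ← pow_mul, mul_comm (d * v) 2, ← Real.rpow_natCast _ 2, ← Real.rpow_mul hn0.le,
        ← Real.rpow_neg_one]
      congr 2
      push_cast; norm_num
    rw [h5]
    have h6 : (1 : ℝ) ≤ 2 ^ (2 * (d * v)) := one_le_pow₀ (by norm_num)
    calc q * (1 - q) ≤ 1 := by nlinarith [hp.1, hp.2]
      _ = 1 * (n : ℝ)⁻¹ * n := by field_simp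
      _ ≤ _ := by gcongr

end Asymptotic

/-! ### Reasoning about programs -/

section Programs
variable {n : ℕ} {G : SimpleGraph (Fin n) × SimpleGraph (Fin n)}

/-- `P` started in `s` halts within `B` steps in a state satisfying `Q`. -/
def Runs (G : SimpleGraph (Fin n) × SimpleGraph (Fin n)) (P : RAMProgram) (s : RAMState) (B : ℕ)
    (Q : RAMState → Prop) : Prop :=
  ∃ t s', Exec G P s t s' ∧ t ≤ B ∧ Q s'

theorem Runs.mono {P : RAMProgram} {s : RAMState} {B B' : ℕ} {Q Q' : RAMState → Prop}
    (h : Runs G P s B Q) (hB : B ≤ B') (hQ : ∀ s', Q s' → Q' s') : Runs G P s B' Q' := by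
  obtain ⟨t, s', h1, h2, h3⟩ := h
  exact ⟨t, s', h1, h2.trans hB, hQ _ h3⟩

theorem Runs.seq {P R : RAMProgram} {s : RAMState} {B B' : ℕ} {Q Q' : RAMState → Prop}
    (h : Runs G P s B Q) (h' : ∀ s', Q s' → Runs G R s' B' Q') : Runs G (.seq P R) s (B + B') Q' := by
  obtain ⟨t, s', h1, h2, h3⟩ := h
  obtain ⟨t', s'', h1', h2', h3'⟩ := h' s' h3
  exact ⟨_, s'', .seq h1 h1', add_le_add h2 h2', h3'⟩

theorem Runs.ite_true {b : RAMTest} {P R : RAMProgram} {s : RAMState} {B : ℕ} {Q : RAMState → Prop}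
    (hb : b.holds s) (h : Runs G P s B Q) : Runs G (.ite b P R) s (B + 1) Q := by
  obtain ⟨t, s', h1, h2, h3⟩ := h
  exact ⟨_, s', .ite_true hb h1, Nat.succ_le_succ h2, h3⟩

theorem Runs.ite_false {b : RAMTest} {P R : RAMProgram} {s : RAMState} {B : ℕ}
    {Q : RAMState → Prop} (hb : ¬ b.holds s) (h : Runs G R s B Q) :
    Runs G (.ite b P R) s (B + 1) Q := by
  obtain ⟨t, s', h1, h2, h3⟩ := h
  exact ⟨_, s', .ite_false hb h1, Nat.succ_le_succ h2, h3⟩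

theorem Runs.loop_false {b : RAMTest} {P : RAMProgram} {s : RAMState} {Q : RAMState → Prop}
    (hb : ¬ b.holds s) (h : Q s) : Runs G (.loop b P) s 1 Q :=
  ⟨1, s, .loop_false hb, le_rfl, h⟩

theorem Runs.loop_true {b : RAMTest} {P : RAMProgram} {s : RAMState} {B B' : ℕ}
    {Q Q' : RAMState → Prop} (hb : b.holds s) (h : Runs G P s B Q)
    (h' : ∀ s', Q s' → Runs G (.loop b P) s' B' Q') : Runs G (.loop b P) s (B + B' + 1) Q' := by
  obtain ⟨t, s', h1, h2, h3⟩ := h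
  obtain ⟨t', s'', h1', h2', h3'⟩ := h' s' h3
  exact ⟨_, s'', .loop_true hb h1 h1', by omega, h3'⟩

/-- A straight-line program. -/
def block (c : RAMInstr) : List RAMInstr → RAMProgram
  | [] => .instr c
  | c' :: l => .seq (.instr c) (block c' l)

theorem Runs.block {Q : RAMState → Prop} : ∀ {c : RAMInstr} {l : List RAMInstr} {s : RAMState},
    Q ((c :: l).foldl (fun s c => c.run G s) s) → Runs G (block c l) s (l.length + 1) Q
  | c, [], s, h => ⟨1, _, .instr c s, le_rfl, h⟩
  | c, c' :: l, s, h => by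
    have h1 : Runs G (.instr c) s 1 (fun s' => s' = c.run G s) := ⟨1, _, .instr c s, le_rfl, rfl⟩
    refine (h1.seq (R := MotifCounting.block c' l) (B' := l.length + 1) ?_).mono
      (by simp only [List.length_cons]; omega) (fun _ h => h)
    rintro _ rfl
    exact Runs.block h

/-! ### Products and quotients in logarithmic time -/

/-- Doubling loop: cells `k + 5` and `k + 6` are doubled as long as the former stays below
cell `k + 4`. -/
def doublingLoop (k : ℕ) : RAMProgram :=
  .loop (.natLt (k + 7) (k + 4))
    (block (.natCopy (k + 5) (k + 7)) [.natAdd (k + 6) (k + 6) (k + 6),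
      .natAdd (k + 7) (k + 5) (k + 5)])

/-- One round: subtract from cell `k + 1` the largest `2 ^ j` multiple of cell `k + 2` that fits,
and add the same multiple of cell `k` to cell `k + 3`. -/
def quotRound (k : ℕ) : RAMProgram :=
  .seq (block (.natCopy (k + 5) (k + 2)) [.natCopy (k + 6) k, .natAdd (k + 7) (k + 5) (k + 5)])
    (.seq (doublingLoop k) (block (.natSub (k + 1) (k + 1) (k + 5))
      [.natAdd (k + 3) (k + 3) (k + 6), .natAdd (k + 4) (k + 1) (k + 8)]))

/-- With `T, X, S` in the cells `k, k + 1, k + 2`, computes `T * (X / S)` in cell `k`. -/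
def quotProg (k : ℕ) : RAMProgram :=
  .seq (block (.natConst (k + 3) 0) [.natConst (k + 8) 1, .natAdd (k + 4) (k + 1) (k + 8)])
    (.seq (.ite (.natLt (k + 3) (k + 2)) (.loop (.natLt (k + 2) (k + 4)) (quotRound k))
      (.instr (.natConst (k + 3) 0))) (.instr (.natCopy k (k + 3))))

/-- Only natural cells from `k` on have changed. -/
def KeepsBelow (k : ℕ) (s s' : RAMState) : Prop :=
  s'.real = s.real ∧ ∀ y < k, s'.nat y = s.nat y

theorem KeepsBelow.trans {k : ℕ} {s s' s'' : RAMState} (h : KeepsBelow k s s')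
    (h' : KeepsBelow k s' s'') : KeepsBelow k s s'' :=
  ⟨h'.1.trans h.1, fun y hy => (h'.2 y hy).trans (h.2 y hy)⟩

theorem KeepsBelow.mono {k k' : ℕ} {s s' : RAMState} (h : KeepsBelow k' s s') (hk : k ≤ k') :
    KeepsBelow k s s' := ⟨h.1, fun y hy => h.2 y (hy.trans_le hk)⟩

/-- The number m bounds the doublings still possible. Cell k + 7 holds the next candidate, so the
test prevents overshooting. -/
theorem runs_doublingLoop (k : ℕ) : ∀ (m : ℕ) (s : RAMState), 0 < s.nat (k + 5) →
    s.nat (k + 7) = s.nat (k + 5) + s.nat (k + 5) → s.nat (k + 4) ≤ s.nat (k + 5) * 2 ^ (m + 1) →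
    s.nat (k + 5) < s.nat (k + 4) →
    Runs G (doublingLoop k) s (4 * m + 1) fun s' => KeepsBelow (k + 5) s s' ∧
      s'.nat (k + 8) = s.nat (k + 8) ∧
      s'.nat (k + 5) < s.nat (k + 4) ∧ s.nat (k + 4) ≤ 2 * s'.nat (k + 5) ∧
      ∃ j, s'.nat (k + 5) = s.nat (k + 5) * 2 ^ j ∧ s'.nat (k + 6) = s.nat (k + 6) * 2 ^ j := by
  intro m
  induction m with
  | zero =>
    intro s h0 h1 h2 h3
    refine Runs.loop_false ?_ ⟨⟨rfl, fun _ _ => rfl⟩, rfl, h3, by omega, 0, by simp, by simp⟩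
    simp only [RAMTest.holds]; omega
  | succ m ih =>
    intro s h0 h1 h2 h3
    have hiff : (RAMTest.natLt (k + 7) (k + 4)).holds s ↔ s.nat (k + 7) < s.nat (k + 4) := Iff.rfl
    by_cases hlt : (RAMTest.natLt (k + 7) (k + 4)).holds s <;> have hlt' := hlt <;>
      rw [hiff] at hlt'
    · refine (Runs.loop_true (Q := fun s' => KeepsBelow (k + 5) s s' ∧
          s'.nat (k + 8) = s.nat (k + 8) ∧ s'.nat (k + 5) = 2 * s.nat (k + 5)
          ∧ s'.nat (k + 6) = 2 * s.nat (k + 6) ∧ s'.nat (k + 7) = s'.nat (k + 5) + s'.nat (k + 5))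
          (B := 3) hlt ?_ (B' := 4 * m + 1) ?_).mono (by omega) (fun _ h => h)
      · refine Runs.block ?_
        refine ⟨⟨rfl, fun y hy => ?_⟩, ?_⟩
        · simp [RAMInstr.run, show y ≠ k + 5 by omega,
            show y ≠ k + 6 by omega, show y ≠ k + 7 by omega]
        · simp [RAMInstr.run]
          omega
      · rintro s' ⟨hk, hk8, e5, e6, e7⟩
        have e4 : s'.nat (k + 4) = s.nat (k + 4) := hk.2 _ (by omega)
        refine (ih s' (by omega) e7 ?_ (by omega)).mono le_rfl ?_
        · rw [e4, e5]
          calc _ ≤ _ := h2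
            _ = _ := by ring
        · rintro s'' ⟨hk', hk8', h5, h6, j, h7, h8⟩
          refine ⟨hk.trans hk', hk8'.trans hk8, by omega, by omega, j + 1, ?_, ?_⟩
          · rw [h7, e5]; ring
          · rw [h8, e6]; ring
    · refine (Runs.loop_false hlt
        ⟨⟨rfl, fun _ _ => rfl⟩, rfl, h3, by omega, 0, by simp, by simp⟩).mono
        (by omega) (fun _ h => h)

/-- Removing from X the largest fitting S · 2^j leaves less than X/2, so one binary digit disappears
per round and the whole computation is quadratic in the number of digits. Cell k + 4 holds X + 1, so
that a strict comparison tests ≤. -/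
theorem runs_quotRound (k : ℕ) (s : RAMState) (hS : 0 < s.nat (k + 2))
    (hle : s.nat (k + 2) ≤ s.nat (k + 1)) (h4 : s.nat (k + 4) = s.nat (k + 1) + 1)
    (h8 : s.nat (k + 8) = 1) :
    Runs G (quotRound k) s (4 * (s.nat (k + 1)).size + 7) fun s' =>
      s'.real = s.real ∧ (∀ y < k + 1, s'.nat y = s.nat y) ∧ s'.nat (k + 2) = s.nat (k + 2) ∧
      s'.nat (k + 4) = s'.nat (k + 1) + 1 ∧ s'.nat (k + 8) = 1 ∧
      2 * s'.nat (k + 1) < s.nat (k + 1) ∧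
      s'.nat (k + 3) + s.nat k * (s'.nat (k + 1) / s.nat (k + 2))
        = s.nat (k + 3) + s.nat k * (s.nat (k + 1) / s.nat (k + 2)) := by
  refine (Runs.seq (Q := fun s' => KeepsBelow (k + 5) s s' ∧ s'.nat (k + 8) = s.nat (k + 8) ∧
    s'.nat (k + 5) = s.nat (k + 2) ∧ s'.nat (k + 6) = s.nat k ∧
    s'.nat (k + 7) = s'.nat (k + 5) + s'.nat (k + 5)) (B := 3)
    (B' := (4 * (s.nat (k + 1)).size + 1) + 3) ?_ ?_).mono (by omega) (fun _ h => h)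
  · refine Runs.block ⟨⟨rfl, fun y hy => ?_⟩, ?_⟩
    · simp [RAMInstr.run, show y ≠ k + 5 by omega,
            show y ≠ k + 6 by omega, show y ≠ k + 7 by omega]
    · simp [RAMInstr.run]
  · rintro s₁ ⟨hk, hk8, e5, e6, e7⟩
    have e1 : s₁.nat (k + 1) = s.nat (k + 1) := hk.2 _ (by omega)
    have e4 : s₁.nat (k + 4) = s.nat (k + 4) := hk.2 _ (by omega)
    refine Runs.seq (runs_doublingLoop k (s.nat (k + 1)).size s₁ (by omega) e7 ?_ (by omega)) ?_
    · rw [e4, h4, e5]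
      have h1 : s.nat (k + 1) < 2 ^ (s.nat (k + 1)).size := Nat.lt_size_self _
      calc s.nat (k + 1) + 1 ≤ 1 * 2 ^ (s.nat (k + 1)).size := by omega
        _ ≤ _ := Nat.mul_le_mul hS (Nat.pow_le_pow_right two_pos (by omega))
    · rintro s₂ ⟨hk', hk8', h5, h6, j, h7, h8'⟩
      have f : ∀ y < k + 5, s₂.nat y = s.nat y := fun y hy => (hk'.2 y hy).trans (hk.2 y hy)
      refine Runs.block ?_
      have g1 := f (k + 1) (by omega)
      have g3 := f (k + 3) (by omega)
      have g2 := f (k + 2) (by omega)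
      have g8 : s₂.nat (k + 8) = 1 := by omega
      refine ⟨?_, fun y hy => ?_, ?_, ?_, ?_, ?_, ?_⟩
      · exact hk'.1.trans hk.1
      · simp [RAMInstr.run, show y ≠ k + 1 by omega,
            show y ≠ k + 3 by omega, show y ≠ k + 4 by omega, f y (by omega)]
      · simp [RAMInstr.run, g2]
      · simp [RAMInstr.run, g8]
      · simp [RAMInstr.run, g8]
      · simp [RAMInstr.run, g1]; omega
      · simp [RAMInstr.run, g1, g3]
        rw [h7, h8', e5, e6]
        rw [h7, e5, e4, h4] at h5
        have h9 : s.nat (k + 1) / s.nat (k + 2)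
            = (s.nat (k + 1) - s.nat (k + 2) * 2 ^ j) / s.nat (k + 2) + 2 ^ j := by
          rw [Nat.sub_mul_div, Nat.sub_add_cancel]
          rw [Nat.le_div_iff_mul_le hS, mul_comm]; omega
        rw [h9]; ring

theorem runs_quotLoop (k : ℕ) : ∀ (m : ℕ) (s : RAMState), (s.nat (k + 1)).size ≤ m →
    0 < s.nat (k + 2) → s.nat (k + 4) = s.nat (k + 1) + 1 → s.nat (k + 8) = 1 →
    Runs G (.loop (.natLt (k + 2) (k + 4)) (quotRound k)) s (m * (4 * m + 8) + 1) fun s' =>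
      s'.real = s.real ∧ (∀ y < k + 1, s'.nat y = s.nat y) ∧
      s'.nat (k + 3) = s.nat (k + 3) + s.nat k * (s.nat (k + 1) / s.nat (k + 2)) := by
  intro m
  induction m with
  | zero =>
    intro s hm hS h4 h8
    have h0 : s.nat (k + 1) = 0 := Nat.size_eq_zero.1 (Nat.le_zero.1 hm)
    refine (Runs.loop_false ?_ ⟨rfl, fun _ _ => rfl, by simp [h0]⟩).mono (by omega) (fun _ h => h)
    simp only [RAMTest.holds]; omega
  | succ m ih =>
    intro s hm hS h4 h8
    have hiff : (RAMTest.natLt (k + 2) (k + 4)).holds s ↔ s.nat (k + 2) < s.nat (k + 4) := Iff.rfl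
    by_cases hlt : (RAMTest.natLt (k + 2) (k + 4)).holds s <;> have hlt' := hlt <;>
      rw [hiff] at hlt'
    · refine (Runs.loop_true hlt (runs_quotRound k s hS (by omega) h4 h8)
        (B' := m * (4 * m + 8) + 1)
        ?_).mono ?_ (fun _ h => h)
      · rintro s' ⟨hr, hk, h2, h4', h8', hlt'', hval⟩
        refine (ih s' ?_ (by omega) h4' h8').mono le_rfl ?_
        · rw [Nat.size_le] at hm ⊢
          rw [pow_succ] at hm
          omega
        · rintro s'' ⟨hr', hk', hval'⟩
          refine ⟨hr'.trans hr, fun y hy => (hk' y hy).trans (hk y hy), ?_⟩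
          rw [hval', hk k (by omega), h2, hval]
      · nlinarith
    · refine (Runs.loop_false hlt ⟨rfl, fun _ _ => rfl, ?_⟩).mono (by omega) (fun _ h => h)
      rw [Nat.div_eq_of_lt (by omega)]; simp

/-- The cost of a product or quotient. -/
def quotCost (X : ℕ) : ℕ := X.size * (4 * X.size + 8) + 6

/-- The machine only adds and subtracts naturals. This program supplies both products, with S = 1,
and quotients, with T = 1. -/
theorem runs_quotProg (k : ℕ) (s : RAMState) :
    Runs G (quotProg k) s (quotCost (s.nat (k + 1))) fun s' => KeepsBelow k s s' ∧
      s'.nat k = s.nat k * (s.nat (k + 1) / s.nat (k + 2)) := by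
  refine (Runs.seq (Q := fun s' => s'.real = s.real ∧ (∀ y < k + 3, s'.nat y = s.nat y) ∧
    s'.nat (k + 3) = 0 ∧ s'.nat (k + 4) = s.nat (k + 1) + 1 ∧ s'.nat (k + 8) = 1) (B := 3)
    (B' := (s.nat (k + 1)).size * (4 * (s.nat (k + 1)).size + 8) + 1 + 1 + 1) ?_ ?_).mono
    (by unfold quotCost; omega) (fun _ h => h)
  · refine Runs.block ⟨rfl, fun y hy => ?_, ?_⟩
    · simp [RAMInstr.run, show y ≠ k + 3 by omega,
            show y ≠ k + 8 by omega, show y ≠ k + 4 by omega]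
    · simp [RAMInstr.run]
  · rintro s₁ ⟨hr, hk, h3, h4, h8⟩
    have g0 := hk k (by omega)
    have g1 := hk (k + 1) (by omega)
    have g2 := hk (k + 2) (by omega)
    refine Runs.seq (Q := fun s' => s'.real = s.real ∧ (∀ y < k, s'.nat y = s.nat y) ∧
      s'.nat (k + 3) = s.nat k * (s.nat (k + 1) / s.nat (k + 2))) ?_ ?_
    -- For S = 0 the loop would not terminate; the result is then 0, in accordance with X / 0 = 0.
    · by_cases h0 : 0 < s.nat (k + 2)
      · refine Runs.ite_true (by simp only [RAMTest.holds]; omega) ?_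
        refine (runs_quotLoop k (s.nat (k + 1)).size s₁ (by rw [g1]) (by omega) (by omega) h8).mono
          le_rfl ?_
        rintro s₂ ⟨hr', hk', hv⟩
        refine ⟨hr'.trans hr, fun y hy => (hk' y (by omega)).trans (hk y (by omega)), ?_⟩
        rw [hv, h3, g0, g1, g2, zero_add]
      · refine Runs.ite_false (by simp only [RAMTest.holds]; omega) ?_
        refine ⟨1, _, .instr _ _, by omega, hr, fun y hy => ?_, ?_⟩
        · simp [RAMInstr.run, show y ≠ k + 3 by omega, hk y (by omega)]
        · have : s.nat (k + 2) = 0 := by omega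
          simp [RAMInstr.run, this]
    · rintro s₂ ⟨hr', hk', hv⟩
      refine ⟨1, _, .instr _ _, le_rfl, ⟨hr', fun y hy => ?_⟩, ?_⟩
      · simp [RAMInstr.run, hy.ne, hk' y hy]
      · simp [RAMInstr.run, hv]

end Programs

/-! ### A small expression language and its compilation -/

/-- Natural number expressions in ten variables. -/
inductive NatExpr : Type
  | var (x : Fin 10)
  | const (c : ℕ)
  | add (a b : NatExpr)
  | sub (a b : NatExpr)
  | mul (a b : NatExpr)
  | div (a b : NatExpr)
  | pow (a b : NatExpr)

/-- Real expressions, with bounded sums and products, conditionals and adjacency queries. -/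
inductive RealExpr : Type
  | ofNat (a : NatExpr)
  | prob
  | corr
  | sub (e f : RealExpr)
  | mul (e f : RealExpr)
  | div (e f : RealExpr)
  | iteLt (a b : NatExpr) (e f : RealExpr)
  | iteEq (a b : NatExpr) (e f : RealExpr)
  | sum (x : Fin 10) (N : NatExpr) (e : RealExpr)
  | prod (x : Fin 10) (N : NatExpr) (e : RealExpr)
  | adjFst (a b : NatExpr)
  | adjSnd (a b : NatExpr)

namespace NatExpr

/-- The value of an expression. -/
def eval (η : Fin 10 → ℕ) : NatExpr → ℕ
  | var x => η x
  | const c => c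
  | add a b => a.eval η + b.eval η
  | sub a b => a.eval η - b.eval η
  | mul a b => a.eval η * b.eval η
  | div a b => a.eval η / b.eval η
  | pow a b => a.eval η ^ b.eval η

/-- The cost of evaluating an expression. -/
def cost (η : Fin 10 → ℕ) : NatExpr → ℕ
  | var _ => 1
  | const _ => 1
  | add a b => a.cost η + b.cost η + 1
  | sub a b => a.cost η + b.cost η + 1
  | mul a b => a.cost η + b.cost η + quotCost (b.eval η) + 1
  | div a b => a.cost η + b.cost η + quotCost (a.eval η) + 2
  | pow a b => a.cost η + b.cost η + b.eval η * (quotCost (a.eval η) + 7) + 4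

/-- The program that evaluates an expression into cell `k`, using the cells from `k` on. -/
def compile : NatExpr → ℕ → RAMProgram
  | var x, k => .instr (.natCopy k x)
  | const c, k => .instr (.natConst k c)
  | add a b, k => .seq (a.compile k) (.seq (b.compile (k + 1)) (.instr (.natAdd k k (k + 1))))
  | sub a b, k => .seq (a.compile k) (.seq (b.compile (k + 1)) (.instr (.natSub k k (k + 1))))
  | mul a b, k => .seq (a.compile k) (.seq (b.compile (k + 1))
      (.seq (.instr (.natConst (k + 2) 1)) (quotProg k)))
  | div a b, k => .seq (a.compile (k + 1)) (.seq (b.compile (k + 2))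
      (.seq (.instr (.natConst k 1)) (quotProg k)))
  | pow a b, k => .seq (a.compile k) (.seq (b.compile (k + 1))
      (.seq (block (.natConst (k + 2) 1) [.natConst (k + 3) 0])
        (.seq (.loop (.natLt (k + 3) (k + 1))
            (.seq (block (.natCopy (k + 4) (k + 2)) [.natCopy (k + 5) k, .natConst (k + 6) 1])
              (.seq (quotProg (k + 4))
                (block (.natCopy (k + 2) (k + 4)) [.natConst (k + 6) 1,
                  .natSub (k + 1) (k + 1) (k + 6)]))))
          (.instr (.natCopy k (k + 2))))))

end NatExpr

/-- The values of the ten variables in a state. -/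
def RAMState.vars (s : RAMState) (x : Fin 10) : ℕ := s.nat x

theorem KeepsBelow.vars_eq {k : ℕ} {s s' : RAMState} (h : KeepsBelow k s s') (hk : 10 ≤ k) :
    s'.vars = s.vars := funext fun x => h.2 x (by omega)

section
variable {n : ℕ} {G : SimpleGraph (Fin n) × SimpleGraph (Fin n)}

theorem Runs.instr {Q : RAMState → Prop} {c : RAMInstr} {s : RAMState} (h : Q (c.run G s)) :
    Runs G (.instr c) s 1 Q := ⟨1, _, .instr c s, le_rfl, h⟩

theorem runs_powLoop (k : ℕ) : ∀ (m : ℕ) (s : RAMState), s.nat (k + 1) = m → s.nat (k + 3) = 0 →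
    Runs G (.loop (.natLt (k + 3) (k + 1))
            (.seq (block (.natCopy (k + 4) (k + 2)) [.natCopy (k + 5) k, .natConst (k + 6) 1])
              (.seq (quotProg (k + 4))
                (block (.natCopy (k + 2) (k + 4)) [.natConst (k + 6) 1,
                  .natSub (k + 1) (k + 1) (k + 6)])))) s (m * (quotCost (s.nat k) + 7) + 1)
      fun s' => KeepsBelow k s s' ∧ s'.nat (k + 2) = s.nat (k + 2) * s.nat k ^ m := by
  intro m
  induction m with
  | zero =>
    intro s h1 h3
    refine (Runs.loop_false ?_ ⟨⟨rfl, fun _ _ => rfl⟩, by simp⟩).mono (by omega) (fun _ h => h)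
    simp only [RAMTest.holds]; omega
  | succ m ih =>
    intro s h1 h3
    refine (Runs.loop_true (by simp only [RAMTest.holds]; omega)
      (Q := fun s' => s'.real = s.real ∧ (∀ y < k + 1, s'.nat y = s.nat y) ∧ s'.nat (k + 1) = m ∧
        s'.nat (k + 2) = s.nat (k + 2) * s.nat k ∧ s'.nat (k + 3) = 0)
      (B := 3 + (quotCost (s.nat k) + 3)) (Runs.seq (Q := fun s' =>
        KeepsBelow (k + 4) s s' ∧ s'.nat (k + 4) = s.nat (k + 2) ∧ s'.nat (k + 5) = s.nat k ∧
        s'.nat (k + 6) = 1) ?_ ?_)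
      (B' := m * (quotCost (s.nat k) + 7) + 1) ?_).mono (by ring_nf; omega) (fun _ h => h)
    · refine Runs.block ⟨⟨rfl, fun y hy => ?_⟩, ?_⟩
      · simp [RAMInstr.run, show y ≠ k + 4 by omega, show y ≠ k + 5 by omega,
          show y ≠ k + 6 by omega]
      · simp [RAMInstr.run]
    · rintro s₁ ⟨hk, e4, e5, e6⟩
      refine Runs.seq ((runs_quotProg (k + 4) s₁).mono (by rw [e5]) (fun _ h => h)) ?_
      rintro s₂ ⟨hk', hv⟩
      rw [e4, e5, e6, Nat.div_one] at hv
      have f : ∀ y < k + 4, s₂.nat y = s.nat y := fun y hy => (hk'.2 y hy).trans (hk.2 y hy)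
      refine Runs.block ⟨hk'.1.trans hk.1, fun y hy => ?_, ?_, ?_, ?_⟩
      · simp [RAMInstr.run, show y ≠ k + 2 by omega, show y ≠ k + 6 by omega,
          show y ≠ k + 1 by omega, f y (by omega)]
      · simp [RAMInstr.run, f (k + 1) (by omega), h1]
      · simp [RAMInstr.run, hv]
      · simp [RAMInstr.run, f (k + 3) (by omega), h3]
    · rintro s' ⟨hr, hk, e1, e2, e3⟩
      have e0 := hk k (by omega)
      refine (ih s' e1 e3).mono (by rw [e0]) ?_
      rintro s'' ⟨hk', hv⟩
      refine ⟨⟨hk'.1.trans hr, fun y hy => (hk'.2 y hy).trans (hk y (by omega))⟩, ?_⟩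
      rw [hv, e2, e0]; ring

/-- Cells 0 to 9 hold the variables and the cells from k ≥ 10 on serve as a stack: a subexpression
never disturbs the values stored below it. -/
theorem NatExpr.runs_compile (a : NatExpr) : ∀ (k : ℕ) (s : RAMState), 10 ≤ k →
    Runs G (a.compile k) s (a.cost s.vars) fun s' => KeepsBelow k s s' ∧
      s'.nat k = a.eval s.vars := by
  have binary : ∀ (a b : NatExpr) (j j' k : ℕ) (s : RAMState) (P : RAMProgram) (B : ℕ)
      (Q : RAMState → Prop), 10 ≤ k → k ≤ j → j < j' →
      (∀ (k : ℕ) (s : RAMState), 10 ≤ k → Runs G (a.compile k) s (a.cost s.vars) fun s' =>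
        KeepsBelow k s s' ∧ s'.nat k = a.eval s.vars) →
      (∀ (k : ℕ) (s : RAMState), 10 ≤ k → Runs G (b.compile k) s (b.cost s.vars) fun s' =>
        KeepsBelow k s s' ∧ s'.nat k = b.eval s.vars) →
      (∀ s', KeepsBelow k s s' → s'.nat j = a.eval s.vars → s'.nat j' = b.eval s.vars →
        Runs G P s' B Q) →
      Runs G (.seq (a.compile j) (.seq (b.compile j') P)) s
        (a.cost s.vars + b.cost s.vars + B) Q := by
    intro a b j j' k s P B Q hk hkj hj iha ihb hP
    rw [add_assoc]
    refine (iha j s (by omega)).seq ?_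
    rintro s₁ ⟨h1, h2⟩
    have hv := h1.vars_eq (by omega)
    refine ((ihb j' s₁ (by omega)).mono (by rw [hv]) (fun _ h => h)).seq ?_
    rintro s₂ ⟨h3, h4⟩
    exact hP s₂ ((h1.mono hkj).trans (h3.mono (by omega))) (by rw [h3.2 j hj, h2])
      (by rw [h4, hv])
  induction a with
  | var x =>
    intro k s hk
    refine Runs.instr ⟨⟨rfl, fun y hy => ?_⟩, ?_⟩
    · simp [RAMInstr.run, hy.ne]
    · simp [RAMInstr.run, NatExpr.eval, RAMState.vars]
  | const c =>
    intro k s hk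
    refine Runs.instr ⟨⟨rfl, fun y hy => ?_⟩, ?_⟩
    · simp [RAMInstr.run, hy.ne]
    · simp [RAMInstr.run, NatExpr.eval]
  | add a b iha ihb =>
    intro k s hk
    refine binary a b k (k + 1) k s _ 1 _ hk le_rfl (by omega) iha ihb fun s' h1 h2 h3 => ?_
    refine Runs.instr ⟨⟨h1.1, fun y hy => ?_⟩, ?_⟩
    · simp [RAMInstr.run, hy.ne, h1.2 y hy]
    · simp [RAMInstr.run, NatExpr.eval, h2, h3]
  | sub a b iha ihb =>
    intro k s hk
    refine binary a b k (k + 1) k s _ 1 _ hk le_rfl (by omega) iha ihb fun s' h1 h2 h3 => ?_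
    refine Runs.instr ⟨⟨h1.1, fun y hy => ?_⟩, ?_⟩
    · simp [RAMInstr.run, hy.ne, h1.2 y hy]
    · simp [RAMInstr.run, NatExpr.eval, h2, h3]
  | mul a b iha ihb =>
    intro k s hk
    refine (binary a b k (k + 1) k s _ (1 + quotCost (b.eval s.vars)) _ hk le_rfl (by omega) iha ihb
      fun s' h1 h2 h3 => ?_).mono (by simp only [NatExpr.cost]; omega) (fun _ h => h)
    refine Runs.seq (Q := fun s'' => s'' = (RAMInstr.natConst (k + 2) 1).run G s')
      (Runs.instr rfl) ?_
    rintro _ rfl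
    refine (runs_quotProg k _).mono (by simp [RAMInstr.run, h3]) ?_
    rintro s'' ⟨h4, h5⟩
    refine ⟨⟨h4.1.trans h1.1, fun y hy => ?_⟩, ?_⟩
    · rw [h4.2 y hy]
      simp [RAMInstr.run, show y ≠ k + 2 by omega, h1.2 y hy]
    · rw [h5]
      simp [RAMInstr.run, NatExpr.eval, h2, h3]
  | div a b iha ihb =>
    intro k s hk
    refine (binary a b (k + 1) (k + 2) k s _ (1 + quotCost (a.eval s.vars)) _ hk (by omega)
      (by omega) iha ihb fun s' h1 h2 h3 => ?_).mono
      (by simp only [NatExpr.cost]; omega) (fun _ h => h)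
    refine Runs.seq (Q := fun s'' => s'' = (RAMInstr.natConst k 1).run G s')
      (Runs.instr rfl) ?_
    rintro _ rfl
    refine (runs_quotProg k _).mono (by simp [RAMInstr.run, h2]) ?_
    rintro s'' ⟨h4, h5⟩
    refine ⟨⟨h4.1.trans h1.1, fun y hy => ?_⟩, ?_⟩
    · rw [h4.2 y hy]
      simp [RAMInstr.run, hy.ne, h1.2 y hy]
    · rw [h5]
      simp [RAMInstr.run, NatExpr.eval, h2, h3]
  | pow a b iha ihb =>
    intro k s hk
    refine (binary a b k (k + 1) k s _
      (2 + (b.eval s.vars * (quotCost (a.eval s.vars) + 7) + 1 + 1)) _ hk le_rfl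
      (by omega) iha ihb fun s' h1 h2 h3 => ?_).mono
      ?_ (fun _ h => h)
    · refine Runs.seq (Q := fun s'' => KeepsBelow k s s'' ∧ s''.nat k = a.eval s.vars ∧
        s''.nat (k + 1) = b.eval s.vars ∧ s''.nat (k + 2) = 1 ∧ s''.nat (k + 3) = 0)
        (Runs.block ⟨⟨h1.1, fun y hy => ?_⟩, ?_⟩) ?_
      · simp [RAMInstr.run, show y ≠ k + 2 by omega, show y ≠ k + 3 by omega, h1.2 y hy]
      · simp [RAMInstr.run, h2, h3]
      rintro s₁ ⟨h4, h5, h6, h7, h8⟩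
      refine Runs.seq ((runs_powLoop k (b.eval s.vars) s₁ h6 h8).mono (by rw [h5])
        (fun _ h => h)) ?_
      rintro s₂ ⟨h9, h10⟩
      refine Runs.instr ⟨⟨h9.1.trans h4.1, fun y hy => ?_⟩, ?_⟩
      · simp [RAMInstr.run, hy.ne, h9.2 y hy, h4.2 y hy]
      · simp [RAMInstr.run, h10, h7, h5, NatExpr.eval]
    · simp only [NatExpr.cost]; omega

end

namespace RealExpr
variable {n : ℕ}

/-- The value of an expression. -/
noncomputable def eval (G : SimpleGraph (Fin n) × SimpleGraph (Fin n)) (p ρ : ℝ) :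
    RealExpr → (Fin 10 → ℕ) → ℝ
  | ofNat a, η => (a.eval η : ℕ)
  | prob, _ => p
  | corr, _ => ρ
  | sub e f, η => e.eval G p ρ η - f.eval G p ρ η
  | mul e f, η => e.eval G p ρ η * f.eval G p ρ η
  | div e f, η => e.eval G p ρ η / f.eval G p ρ η
  | iteLt a b e f, η => if a.eval η < b.eval η then e.eval G p ρ η else f.eval G p ρ η
  | iteEq a b e f, η => if a.eval η = b.eval η then e.eval G p ρ η else f.eval G p ρ η
  | sum x N e, η => ∑ i ∈ Finset.range (N.eval η), e.eval G p ρ (Function.update η x i)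
  | prod x N e, η => ∏ i ∈ Finset.range (N.eval η), e.eval G p ρ (Function.update η x i)
  | adjFst a b, η => (adjQuery G.1 (a.eval η) (b.eval η) : ℕ)
  | adjSnd a b, η => (adjQuery G.2 (a.eval η) (b.eval η) : ℕ)

/-- The cost of evaluating an expression. -/
def cost : RealExpr → (Fin 10 → ℕ) → ℕ
  | ofNat a, η => a.cost η + 1
  | prob, _ => 1
  | corr, _ => 1
  | sub e f, η => e.cost η + f.cost η + 1
  | mul e f, η => e.cost η + f.cost η + 1
  | div e f, η => e.cost η + f.cost η + 1
  | iteLt a b e f, η => a.cost η + b.cost η + (e.cost η + f.cost η + 1)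
  | iteEq a b e f, η => a.cost η + b.cost η + (e.cost η + f.cost η + 1)
  | sum x N e, η =>
      N.cost η + ∑ i ∈ Finset.range (N.eval η), (e.cost (Function.update η x i) + 4) + 6
  | prod x N e, η =>
      N.cost η + ∑ i ∈ Finset.range (N.eval η), (e.cost (Function.update η x i) + 4) + 6
  | adjFst a b, η => a.cost η + b.cost η + 2
  | adjSnd a b, η => a.cost η + b.cost η + 2

/-- The program for a bounded sum or product. -/
def accumulate (x k r init : ℕ) (body : RAMProgram) (op : RAMInstr) : RAMProgram :=
  .seq (block (.natCopy (k + 1) x) [.natConst x 0, .natConst (k + 2) init, .realOfNat r (k + 2)])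
    (.seq (.loop (.natLt x k) (.seq body (block op [.natConst (k + 2) 1, .natAdd x x (k + 2)])))
      (.instr (.natCopy x (k + 1))))

/-- The program that evaluates an expression into the real cell `r`, using the cells from `k`
and from `r` on. -/
def compile : RealExpr → ℕ → ℕ → RAMProgram
  | ofNat a, k, r => .seq (a.compile k) (.instr (.realOfNat r k))
  | prob, _, r => .instr (.realCopy r 0)
  | corr, _, r => .instr (.realCopy r 1)
  | sub e f, k, r => .seq (e.compile k r)
      (.seq (f.compile k (r + 1)) (.instr (.realSub r r (r + 1))))
  | mul e f, k, r => .seq (e.compile k r)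
      (.seq (f.compile k (r + 1)) (.instr (.realMul r r (r + 1))))
  | div e f, k, r => .seq (e.compile k r)
      (.seq (f.compile k (r + 1)) (.instr (.realDiv r r (r + 1))))
  | iteLt a b e f, k, r => .seq (a.compile k) (.seq (b.compile (k + 1))
      (.ite (.natLt k (k + 1)) (e.compile k r) (f.compile k r)))
  | iteEq a b e f, k, r => .seq (a.compile k) (.seq (b.compile (k + 1))
      (.ite (.natEq k (k + 1)) (e.compile k r) (f.compile k r)))
  | sum x N e, k, r => .seq (N.compile k)
      (accumulate x k r 0 (e.compile (k + 2) (r + 1)) (.realAdd r r (r + 1)))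
  | prod x N e, k, r => .seq (N.compile k)
      (accumulate x k r 1 (e.compile (k + 2) (r + 1)) (.realMul r r (r + 1)))
  | adjFst a b, k, r => .seq (a.compile k) (.seq (b.compile (k + 1))
      (block (.queryFst k k (k + 1)) [.realOfNat r k]))
  | adjSnd a b, k, r => .seq (a.compile k) (.seq (b.compile (k + 1))
      (block (.querySnd k k (k + 1)) [.realOfNat r k]))

end RealExpr

/-- Only natural cells from `k` on and real cells from `r` on have changed. -/
def KeepsBelow₂ (k r : ℕ) (s s' : RAMState) : Prop :=
  (∀ y < k, s'.nat y = s.nat y) ∧ ∀ y < r, s'.real y = s.real y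

section
variable {n : ℕ} {G : SimpleGraph (Fin n) × SimpleGraph (Fin n)}

theorem KeepsBelow.to₂ {k : ℕ} {s s' : RAMState} (h : KeepsBelow k s s') (r : ℕ) :
    KeepsBelow₂ k r s s' := ⟨h.2, fun y _ => congrFun h.1 y⟩

theorem KeepsBelow₂.trans {k r : ℕ} {s s' s'' : RAMState} (h : KeepsBelow₂ k r s s')
    (h' : KeepsBelow₂ k r s' s'') : KeepsBelow₂ k r s s'' :=
  ⟨fun y hy => (h'.1 y hy).trans (h.1 y hy), fun y hy => (h'.2 y hy).trans (h.2 y hy)⟩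

theorem KeepsBelow₂.vars_eq {k r : ℕ} {s s' : RAMState} (h : KeepsBelow₂ k r s s') (hk : 10 ≤ k) :
    s'.vars = s.vars := funext fun x => h.1 x (by omega)

/-- What a compiled real expression does. -/
def RealExpr.Correct (G : SimpleGraph (Fin n) × SimpleGraph (Fin n)) (e : RealExpr) : Prop :=
  ∀ (k r : ℕ) (s : RAMState), 10 ≤ k → 2 ≤ r →
    Runs G (e.compile k r) s (e.cost s.vars) fun s' => KeepsBelow₂ k r s s' ∧
      s'.real r = e.eval G (s.real 0) (s.real 1) s.vars

/-- The loop counter is the cell of the bound variable itself, so the body sees the updated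
environment. The function F lists the partial results, which treats sums and products alike. -/
theorem runs_accumulateLoop {e : RealExpr} (he : e.Correct G) (x : Fin 10) (k r : ℕ) (op : RAMInstr)
    (g : ℝ → ℝ → ℝ)
    (hop : ∀ s : RAMState, op.run G s = { s with
      real := Function.update s.real r (g (s.real r) (s.real (r + 1))) })
    (hk : 10 ≤ k) (hr : 2 ≤ r) (η : Fin 10 → ℕ) (p ρ : ℝ) (N : ℕ) (F : ℕ → ℝ)
    (hF : ∀ i < N, F (i + 1) = g (F i) (e.eval G p ρ (Function.update η x i))) :
    ∀ (m i : ℕ) (s : RAMState), i + m = N → s.nat k = N → s.vars = Function.update η x i →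
    s.real 0 = p → s.real 1 = ρ → s.real r = F i →
    Runs G (.loop (.natLt x k) (.seq (e.compile (k + 2) (r + 1))
        (block op [.natConst (k + 2) 1, .natAdd x x (k + 2)]))) s
      (∑ j ∈ Finset.range m, (e.cost (Function.update η x (i + j)) + 4) + 1)
      fun s' => (∀ y < k + 2, y ≠ x → s'.nat y = s.nat y) ∧ (∀ y < r, s'.real y = s.real y) ∧
        s'.real r = F N := by
  intro m
  induction m with
  | zero =>
    intro i s hi hN hv h0 h1 hrF
    have hx : s.nat x = i := by
      have := congrFun hv x
      simpa [RAMState.vars] using this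
    refine Runs.loop_false ?_ ⟨fun _ _ _ => rfl, fun _ _ => rfl, ?_⟩
    · simp only [RAMTest.holds]; omega
    · rw [hrF, ← hi, add_zero]
  | succ m ih =>
    intro i s hi hN hv h0 h1 hrF
    have hx : s.nat x = i := by
      have := congrFun hv x
      simpa [RAMState.vars] using this
    have hxk : (x : ℕ) < 10 := x.2
    refine (Runs.loop_true (by simp only [RAMTest.holds]; omega)
      (Q := fun s' => (∀ y < k + 2, y ≠ x → s'.nat y = s.nat y) ∧
        (∀ y < r, s'.real y = s.real y) ∧ s'.nat x = i + 1 ∧ s'.real r = F (i + 1))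
      (B := e.cost s.vars + 3) (Runs.seq (he (k + 2) (r + 1) s (by omega) (by omega)) ?_)
      (B' := ∑ j ∈ Finset.range m, (e.cost (Function.update η x (i + 1 + j)) + 4) + 1) ?_).mono
      ?_ (fun _ h => h)
    · rintro s₁ ⟨hk1, hv1⟩
      refine Runs.block ?_
      rw [List.foldl_cons, hop]
      refine ⟨fun y hy hyx => ?_, fun y hy => ?_, ?_, ?_⟩
      · simp [RAMInstr.run, hyx, hy.ne, hk1.1 y hy]
      · simp [RAMInstr.run, hy.ne, hk1.2 y (by omega)]
      · simp [RAMInstr.run, show (x : ℕ) ≠ k + 2 by omega, hk1.1 x (by omega), hx]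
      · simp only [RAMInstr.run, List.foldl_cons, List.foldl_nil, Function.update_self]
        rw [hv1, hk1.2 r (by omega), hrF, h0, h1, hv, hF i (by omega)]
    · rintro s' ⟨g1, g2, g3, g4⟩
      refine (ih (i + 1) s' (by omega) ?_ ?_ ?_ ?_ g4).mono le_rfl ?_
      · rw [g1 k (by omega) (by omega), hN]
      · funext y
        by_cases hy : y = x
        · subst hy; simp [RAMState.vars, g3]
        · have := congrFun hv y
          rw [Function.update_of_ne hy] at this ⊢
          rw [← this]
          exact g1 y (by omega) (fun h => hy (Fin.ext h))
      · rw [g2 0 (by omega), h0]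
      · rw [g2 1 (by omega), h1]
      · rintro s'' ⟨f1, f2, f3⟩
        exact ⟨fun y hy hyx => (f1 y hy hyx).trans (g1 y hy hyx),
          fun y hy => (f2 y hy).trans (g2 y hy), f3⟩
    · have h : ∀ j, i + 1 + j = i + (j + 1) := fun j => by omega
      rw [Finset.sum_range_succ', hv, add_zero]
      simp_rw [h]
      omega

theorem runs_accumulate {e : RealExpr} (he : e.Correct G) (x : Fin 10) (k r init : ℕ)
    (op : RAMInstr) (g : ℝ → ℝ → ℝ)
    (hop : ∀ s : RAMState, op.run G s = { s with
      real := Function.update s.real r (g (s.real r) (s.real (r + 1))) })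
    (hk : 10 ≤ k) (hr : 2 ≤ r) (s : RAMState) (F : ℕ → ℝ) (hF0 : F 0 = init)
    (hF : ∀ i, F (i + 1)
      = g (F i) (e.eval G (s.real 0) (s.real 1) (Function.update s.vars x i))) :
    Runs G (RealExpr.accumulate x k r init (e.compile (k + 2) (r + 1)) op) s
      (∑ j ∈ Finset.range (s.nat k), (e.cost (Function.update s.vars x j) + 4) + 6)
      fun s' => KeepsBelow₂ k r s s' ∧ s'.real r = F (s.nat k) := by
  have hxk : (x : ℕ) < 10 := x.2
  refine (Runs.seq (Q := fun s' => (∀ y < k + 1, y ≠ x → s'.nat y = s.nat y) ∧ s'.nat x = 0 ∧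
    s'.nat (k + 1) = s.nat x ∧ (∀ y < r, s'.real y = s.real y) ∧ s'.real r = init) (B := 4)
    (B' := (∑ j ∈ Finset.range (s.nat k), (e.cost (Function.update s.vars x (0 + j)) + 4) + 1) + 1)
    ?_ ?_).mono ?_ (fun _ h => h)
  · refine Runs.block ⟨fun y hy hyx => ?_, ?_, ?_, fun y hy => ?_, ?_⟩
    · simp [RAMInstr.run, hyx, hy.ne, show y ≠ k + 2 by omega]
    · simp [RAMInstr.run, show (x : ℕ) ≠ k + 2 by omega]
    · simp [RAMInstr.run, show k + 1 ≠ x by omega]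
    · simp [RAMInstr.run, hy.ne]
    · simp [RAMInstr.run]
  · rintro s₁ ⟨h1, h2, h3, h4, h5⟩
    refine Runs.seq (runs_accumulateLoop he x k r op g hop hk hr s.vars (s.real 0) (s.real 1)
      (s.nat k) F (fun i _ => hF i) (s.nat k) 0 s₁ (by omega) (h1 k (by omega) (by omega)) ?_
      (h4 0 (by omega)) (h4 1 (by omega)) (by rw [h5, hF0])) ?_
    · funext y
      by_cases hy : y = x
      · subst hy; simp [RAMState.vars, h2]
      · rw [Function.update_of_ne hy]
        exact h1 y (by omega) (fun h => hy (Fin.ext h))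
    · rintro s₂ ⟨g1, g2, g3⟩
      refine Runs.instr ⟨⟨fun y hy => ?_, fun y hy => ?_⟩, ?_⟩
      · by_cases hyx : y = x
        · subst hyx
          simp [RAMInstr.run, g1 (k + 1) (by omega) (by omega), h3]
        · simp [RAMInstr.run, hyx, g1 y (by omega) hyx, h1 y (by omega) hyx]
      · exact (g2 y hy).trans (h4 y hy)
      · exact g3
  · simp only [zero_add]; omega

/-- Structural induction with the same stack discipline; results are placed from real cell 2 on,
since cells 0 and 1 hold p and ρ. -/
theorem RealExpr.correct (e : RealExpr) : e.Correct G := by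
  have nat2 : ∀ (a b : NatExpr) (k r : ℕ) (s : RAMState) (P : RAMProgram) (B : ℕ)
      (Q : RAMState → Prop), 10 ≤ k →
      (∀ s', KeepsBelow k s s' → s'.nat k = a.eval s.vars → s'.nat (k + 1) = b.eval s.vars →
        Runs G P s' B Q) →
      Runs G (.seq (a.compile k) (.seq (b.compile (k + 1)) P)) s
        (a.cost s.vars + b.cost s.vars + B) Q := by
    intro a b k r s P B Q hk hP
    rw [add_assoc]
    refine (a.runs_compile k s hk).seq ?_
    rintro s₁ ⟨h1, h2⟩
    have hv := h1.vars_eq hk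
    refine ((b.runs_compile (k + 1) s₁ (by omega)).mono (by rw [hv]) (fun _ h => h)).seq ?_
    rintro s₂ ⟨h3, h4⟩
    exact hP s₂ (h1.trans (h3.mono (by omega))) (by rw [h3.2 k (by omega), h2]) (by rw [h4, hv])
  have real2 : ∀ (e f : RealExpr) (k r : ℕ) (s : RAMState) (op : RAMInstr) (g : ℝ → ℝ → ℝ),
      e.Correct G → f.Correct G → 10 ≤ k → 2 ≤ r →
      (∀ s : RAMState, op.run G s = { s with
        real := Function.update s.real r (g (s.real r) (s.real (r + 1))) }) →
      Runs G (.seq (e.compile k r) (.seq (f.compile k (r + 1)) (.instr op))) s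
        (e.cost s.vars + f.cost s.vars + 1) fun s' => KeepsBelow₂ k r s s' ∧
        s'.real r = g (e.eval G (s.real 0) (s.real 1) s.vars)
          (f.eval G (s.real 0) (s.real 1) s.vars) := by
    intro e f k r s op g he hf hk hr hop
    rw [add_assoc]
    refine (he k r s hk hr).seq ?_
    rintro s₁ ⟨h1, h2⟩
    have hv := h1.vars_eq hk
    refine ((hf k (r + 1) s₁ hk (by omega)).mono (by rw [hv]) (fun _ h => h)).seq ?_
    rintro s₂ ⟨h3, h4⟩
    refine Runs.instr ?_
    rw [hop]
    refine ⟨⟨fun y hy => (h3.1 y hy).trans (h1.1 y hy), fun y hy => ?_⟩, ?_⟩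
    · simp [hy.ne, h3.2 y (by omega), h1.2 y hy]
    · simp only [Function.update_self]
      rw [h4, h3.2 r (by omega), h2, hv, h1.2 0 (by omega), h1.2 1 (by omega)]
  induction e with
  | ofNat a =>
    intro k r s hk hr
    refine (a.runs_compile k s hk).seq (B' := 1) ?_
    rintro s₁ ⟨h1, h2⟩
    refine Runs.instr ⟨⟨h1.2, fun y hy => ?_⟩, ?_⟩
    · simp [RAMInstr.run, hy.ne, h1.1]
    · simp [RAMInstr.run, h2, RealExpr.eval]
  | prob =>
    intro k r s hk hr
    refine Runs.instr ⟨⟨fun _ _ => rfl, fun y hy => ?_⟩, ?_⟩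
    · simp [RAMInstr.run, hy.ne]
    · simp [RAMInstr.run, RealExpr.eval]
  | corr =>
    intro k r s hk hr
    refine Runs.instr ⟨⟨fun _ _ => rfl, fun y hy => ?_⟩, ?_⟩
    · simp [RAMInstr.run, hy.ne]
    · simp [RAMInstr.run, RealExpr.eval]
  | sub e f he hf =>
    exact fun k r s hk hr => real2 e f k r s _ (fun u v => u - v) he hf hk hr fun s => rfl
  | mul e f he hf =>
    exact fun k r s hk hr => real2 e f k r s _ (fun u v => u * v) he hf hk hr fun s => rfl
  | div e f he hf =>
    exact fun k r s hk hr => real2 e f k r s _ (fun u v => u / v) he hf hk hr fun s => rfl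
  | iteLt a b e f he hf =>
    intro k r s hk hr
    refine nat2 a b k r s _ (e.cost s.vars + f.cost s.vars + 1) _ hk fun s₁ h1 h2 h3 => ?_
    have hv := h1.vars_eq hk
    by_cases hlt : a.eval s.vars < b.eval s.vars
    · refine (Runs.ite_true (by simpa only [RAMTest.holds, h2, h3] using hlt)
        (he k r s₁ hk hr)).mono (by rw [hv]; omega) ?_
      rintro s₂ ⟨h4, h5⟩
      refine ⟨(h1.to₂ r).trans h4, ?_⟩
      rw [h5, hv, h1.1]; simp only [RealExpr.eval, if_pos hlt]
    · refine (Runs.ite_false (by simpa only [RAMTest.holds, h2, h3] using hlt)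
        (hf k r s₁ hk hr)).mono (by rw [hv]; omega) ?_
      rintro s₂ ⟨h4, h5⟩
      refine ⟨(h1.to₂ r).trans h4, ?_⟩
      rw [h5, hv, h1.1]; simp only [RealExpr.eval, if_neg hlt]
  | iteEq a b e f he hf =>
    intro k r s hk hr
    refine nat2 a b k r s _ (e.cost s.vars + f.cost s.vars + 1) _ hk fun s₁ h1 h2 h3 => ?_
    have hv := h1.vars_eq hk
    by_cases hlt : a.eval s.vars = b.eval s.vars
    · refine (Runs.ite_true (by simpa only [RAMTest.holds, h2, h3] using hlt)
        (he k r s₁ hk hr)).mono (by rw [hv]; omega) ?_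
      rintro s₂ ⟨h4, h5⟩
      refine ⟨(h1.to₂ r).trans h4, ?_⟩
      rw [h5, hv, h1.1]; simp only [RealExpr.eval, if_pos hlt]
    · refine (Runs.ite_false (by simpa only [RAMTest.holds, h2, h3] using hlt)
        (hf k r s₁ hk hr)).mono (by rw [hv]; omega) ?_
      rintro s₂ ⟨h4, h5⟩
      refine ⟨(h1.to₂ r).trans h4, ?_⟩
      rw [h5, hv, h1.1]; simp only [RealExpr.eval, if_neg hlt]
  | sum x N e he =>
    intro k r s hk hr
    refine ((N.runs_compile k s hk).seq (B' := ∑ i ∈ Finset.range (N.eval s.vars),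
      (e.cost (Function.update s.vars x i) + 4) + 6) ?_).mono
      (by simp only [RealExpr.cost]; omega) (fun _ h => h)
    rintro s₁ ⟨h1, h2⟩
    have hv := h1.vars_eq hk
    refine (runs_accumulate he x k r 0 (.realAdd r r (r + 1)) (fun u v => u + v) (fun s => rfl)
      hk hr s₁ (fun m => ∑ i ∈ Finset.range m, e.eval G (s₁.real 0) (s₁.real 1)
        (Function.update s₁.vars x i)) (by simp) (fun i => Finset.sum_range_succ _ _)).mono
      (by rw [hv, h2]) ?_
    rintro s₂ ⟨h3, h4⟩
    refine ⟨(h1.to₂ r).trans h3, ?_⟩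
    rw [h4, hv, h2, h1.1]; rfl
  | prod x N e he =>
    intro k r s hk hr
    refine ((N.runs_compile k s hk).seq (B' := ∑ i ∈ Finset.range (N.eval s.vars),
      (e.cost (Function.update s.vars x i) + 4) + 6) ?_).mono
      (by simp only [RealExpr.cost]; omega) (fun _ h => h)
    rintro s₁ ⟨h1, h2⟩
    have hv := h1.vars_eq hk
    refine (runs_accumulate he x k r 1 (.realMul r r (r + 1)) (fun u v => u * v) (fun s => rfl)
      hk hr s₁ (fun m => ∏ i ∈ Finset.range m, e.eval G (s₁.real 0) (s₁.real 1)
        (Function.update s₁.vars x i)) (by simp) (fun i => Finset.prod_range_succ _ _)).mono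
      (by rw [hv, h2]) ?_
    rintro s₂ ⟨h3, h4⟩
    refine ⟨(h1.to₂ r).trans h3, ?_⟩
    rw [h4, hv, h2, h1.1]; rfl
  | adjFst a b =>
    intro k r s hk hr
    refine nat2 a b k r s _ 2 _ hk fun s₁ h1 h2 h3 => ?_
    refine Runs.block ⟨⟨fun y hy => ?_, fun y hy => ?_⟩, ?_⟩
    · simp [RAMInstr.run, hy.ne, h1.2 y hy]
    · simp [RAMInstr.run, hy.ne, h1.1]
    · simp [RAMInstr.run, h2, h3, RealExpr.eval]
  | adjSnd a b =>
    intro k r s hk hr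
    refine nat2 a b k r s _ 2 _ hk fun s₁ h1 h2 h3 => ?_
    refine Runs.block ⟨⟨fun y hy => ?_, fun y hy => ?_⟩, ?_⟩
    · simp [RAMInstr.run, hy.ne, h1.2 y hy]
    · simp [RAMInstr.run, hy.ne, h1.1]
    · simp [RAMInstr.run, h2, h3, RealExpr.eval]

end

/-! ### The statistic as a sum over codes -/

theorem prod_range_equiv {α : Type} [Fintype α] {m : ℕ} (e : α ≃ Fin m) {F : ℕ → ℝ} {F' : α → ℝ}
    (h : ∀ a, F (e a) = F' a) : ∏ i ∈ Finset.range m, F i = ∏ a, F' a := by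
  rw [Finset.prod_range, ← Equiv.prod_comp e]
  exact Finset.prod_congr rfl fun a _ => h a

/-- A sum over the codes of the functions from `α` to `β` written in base `k`. -/
theorem sum_range_pow {α β : Type} [Fintype α] [DecidableEq α] [Fintype β] {m k : ℕ} (e : α ≃ Fin m)
    (e' : β ≃ Fin k) {H : ℕ → ℝ} {H' : (α → β) → ℝ}
    (h : ∀ c g, (∀ a, c / k ^ (e a : ℕ) % k = e' (g a)) → H c = H' g) :
    ∑ c ∈ Finset.range (k ^ m), H c = ∑ g, H' g := by
  rw [Finset.sum_range, ← Equiv.sum_comp ((Equiv.arrowCongr e e').trans finFunctionFinEquiv)]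
  refine Finset.sum_congr rfl fun g _ => h _ _ fun a => ?_
  have h1 := congrFun (finFunctionFinEquiv.symm_apply_apply (Equiv.arrowCongr e e' g)) (e a)
  have h2 : _ / k ^ (e a : ℕ) % k = _ := congrArg Fin.val h1
  refine h2.trans ?_
  simp

/-- The expression language can only sum over all maps, coded as digits; injectivity enters as a
factor 0 or 1. -/
theorem sum_embedding {α β : Type} [Fintype α] [DecidableEq α] [Fintype β] [DecidableEq β]
    [∀ g : α → β, Decidable (Function.Injective g)] (F : (α → β) → ℝ) :
    ∑ g : α → β, (if Function.Injective g then 1 else 0) * F g = ∑ f : α ↪ β, F f := by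
  symm
  refine Fintype.sum_of_injective (fun f : α ↪ β => (f : α → β)) DFunLike.coe_injective _ _ ?_ ?_
  · intro g hg
    rw [if_neg, zero_mul]
    exact fun h => hg ⟨⟨g, h⟩, rfl⟩
  · intro f
    rw [if_pos f.injective, one_mul]

theorem prod_injective {α β : Type} [Fintype α] [DecidableEq α] [DecidableEq β] (g : α → β)
    [Decidable (Function.Injective g)] :
    ∏ x, ∏ y, (if x = y then (1 : ℝ) else if g x = g y then 0 else 1)
      = if Function.Injective g then 1 else 0 := by
  split_ifs with h
  · refine Finset.prod_eq_one fun x _ => Finset.prod_eq_one fun y _ => ?_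
    split_ifs with h1 h2
    · rfl
    · exact absurd (h h2) h1
    · rfl
  · unfold Function.Injective at h
    push Not at h
    obtain ⟨x, y, h1, h2⟩ := h
    refine Finset.prod_eq_zero (Finset.mem_univ x) (Finset.prod_eq_zero (Finset.mem_univ y) ?_)
    rw [if_neg h2, if_pos h1]

/-! ### Summing over families of matchings instead of isomorphism classes. -/

section Codes
variable {d ℓ n : ℕ}

/-- A family of matchings between the paths. -/
abbrev Matchings (d ℓ : ℕ) : Type := Fin (d - 1) → Fin (d - 1) → Equiv.Perm (Fin ℓ)

open Classical in
theorem sum_matchings (F : (Fin (d - 1) × Fin (d - 1) → Fin ℓ → Fin ℓ) → ℝ) :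
    ∑ g : Fin (d - 1) × Fin (d - 1) → Fin ℓ → Fin ℓ,
        (∏ q, if Function.Injective (g q) then 1 else 0) * F g
      = ∑ z : Matchings d ℓ, F fun q => z q.1 q.2 := by
  symm
  refine Fintype.sum_of_injective (fun (z : Matchings d ℓ) (q : Fin (d - 1) × Fin (d - 1)) =>
    (z q.1 q.2 : Fin ℓ → Fin ℓ)) ?_ _ _ ?_ ?_
  · intro z z' h
    funext i j
    exact DFunLike.coe_injective (congrFun h (i, j))
  · intro g hg
    rw [Finset.prod_ite_zero, if_neg, zero_mul]
    intro h
    refine hg ⟨fun i j => Equiv.ofBijective (g (i, j))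
      (Finite.injective_iff_bijective.1 (h (i, j) (Finset.mem_univ _))), ?_⟩
    funext q s
    rfl
  · intro z
    rw [Finset.prod_ite_zero, if_pos, Finset.prod_const_one, one_mul]
    exact fun q _ => (z q.1 q.2).injective

open Classical in
theorem prod_edgeFinset_specialGraph (z : Matchings d ℓ) (h : Sym2 (MotifVertex d ℓ) → ℝ) :
    ∏ x, ∏ y, (if specialRel d ℓ z x y then h s(x, y) else 1)
      = ∏ e ∈ (specialGraph d ℓ z).edgeFinset, h e := by
  rw [← Fintype.prod_prod_type' fun x y => if specialRel d ℓ z x y then h s(x, y) else 1,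
    ← Finset.prod_filter]
  refine Finset.prod_bij (fun q _ => s(q.1, q.2)) ?_ ?_ ?_ fun _ _ => rfl
  · intro q hq
    rw [Finset.mem_filter] at hq
    rw [SimpleGraph.mem_edgeFinset, SimpleGraph.mem_edgeSet, specialGraph_adj]
    exact Or.inl hq.2
  · rintro ⟨x, y⟩ hq ⟨x', y'⟩ hq' he
    rw [Finset.mem_filter] at hq hq'
    rcases Sym2.eq_iff.1 he with ⟨rfl, rfl⟩ | ⟨rfl, rfl⟩
    · rfl
    · exact absurd hq'.2 (specialRel_asymm hq.2)
  · intro e he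
    induction e with
    | h x y =>
      rw [SimpleGraph.mem_edgeFinset, SimpleGraph.mem_edgeSet, specialGraph_adj] at he
      rcases he with he | he
      · exact ⟨(x, y), Finset.mem_filter.2 ⟨Finset.mem_univ _, he⟩, rfl⟩
      · exact ⟨(y, x), Finset.mem_filter.2 ⟨Finset.mem_univ _, he⟩, Sym2.eq_swap⟩

/-- Whether `τ` maps edges of the first motif to edges of the second one. -/
def PreservesEdges (z' z : Matchings d ℓ) (τ : MotifVertex d ℓ → MotifVertex d ℓ) : Prop :=
  ∀ x y, specialRel d ℓ z' x y → (specialGraph d ℓ z).Adj (τ x) (τ y)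

open Classical in
/-- The number of pairs of a family of matchings and an isomorphism from its motif to the motif
of `z`. -/
noncomputable def isoCount (z : Matchings d ℓ) : ℝ :=
  ∑ z' : Matchings d ℓ, ∑ τ : MotifVertex d ℓ ↪ MotifVertex d ℓ,
    if PreservesEdges z' z τ then 1 else 0

/-- An edge-preserving injection between two motifs is an isomorphism. -/
theorem PreservesEdges.adj_iff (hd : 2 ≤ d) (hℓ : 1 ≤ ℓ) {z z' : Matchings d ℓ}
    {τ : MotifVertex d ℓ ↪ MotifVertex d ℓ} (h : PreservesEdges z' z τ) {x y : MotifVertex d ℓ} :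
    (specialGraph d ℓ z).Adj (τ x) (τ y) ↔ (specialGraph d ℓ z').Adj x y := by
  classical
  have hsub : (specialGraph d ℓ z').edgeFinset.map τ.sym2Map ⊆ (specialGraph d ℓ z).edgeFinset := by
    intro e he
    obtain ⟨e', he', rfl⟩ := Finset.mem_map.1 he
    induction e' with
    | h a b =>
      rw [SimpleGraph.mem_edgeFinset, SimpleGraph.mem_edgeSet, specialGraph_adj] at he'
      simp only [Function.Embedding.sym2Map_apply, Sym2.map_mk, SimpleGraph.mem_edgeFinset,
        SimpleGraph.mem_edgeSet]
      exact he'.elim (h a b) fun h' => (h b a h').symm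
  have hcard : ∀ z'' : Matchings d ℓ, (specialGraph d ℓ z'').edgeFinset.card = numEdges d ℓ := by
    intro z''
    rw [← specialGraph_ncard_edgeSet (z := z'') hd hℓ, ← SimpleGraph.coe_edgeFinset,
      Set.ncard_coe_finset]
  -- All special graphs with the same d and ℓ have equally many edges, so an injective image of the
  -- edges fills the whole target.
  have heq := Finset.eq_of_subset_of_card_le hsub (by rw [Finset.card_map, hcard, hcard])
  rw [← SimpleGraph.mem_edgeSet, ← SimpleGraph.mem_edgeFinset, ← heq, Finset.mem_map,
    ← SimpleGraph.mem_edgeSet]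
  constructor
  · rintro ⟨e', he', h'⟩
    have : e' = s(x, y) := τ.sym2Map.injective (by simpa using h')
    rw [← this]
    exact SimpleGraph.mem_edgeFinset.1 he'
  · intro h'
    exact ⟨s(x, y), SimpleGraph.mem_edgeFinset.2 h', by simp⟩

-- Composition with one fixed isomorphism is a bijection between the isomorphisms onto a graph and
-- its automorphisms.
open Classical in
theorem sum_preservesEdges (hd : 2 ≤ d) (hℓ : 1 ≤ ℓ) (z' z : Matchings d ℓ) :
    (∑ τ : MotifVertex d ℓ ↪ MotifVertex d ℓ, if PreservesEdges z' z τ then (1 : ℝ) else 0)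
      = if Nonempty (specialGraph d ℓ z' ≃g specialGraph d ℓ z)
        then (aut (specialGraph d ℓ z) : ℝ) else 0 := by
  have h1 : (∑ τ : MotifVertex d ℓ ↪ MotifVertex d ℓ, if PreservesEdges z' z τ then (1 : ℝ) else 0)
      = Nat.card (specialGraph d ℓ z' ≃g specialGraph d ℓ z) := by
    rw [Finset.sum_boole, ← Fintype.card_subtype, ← Nat.card_eq_fintype_card]
    congr 1
    refine Nat.card_congr ⟨fun τ => ⟨Equiv.ofBijective τ.1
      (Finite.injective_iff_bijective.1 τ.1.injective), τ.2.adj_iff hd hℓ⟩,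
      fun τ => ⟨τ.toEquiv.toEmbedding, fun x y h =>
        τ.map_rel_iff.2 (specialGraph_adj.2 (Or.inl h))⟩,
      ?_, ?_⟩
    · intro τ; rfl
    · intro τ; ext; rfl
  rw [h1]
  split_ifs with h
  · obtain ⟨υ⟩ := h
    rw [aut]
    congr 1
    exact Nat.card_congr ⟨fun τ => υ.symm.trans τ, fun τ => υ.trans τ,
      fun τ => by ext; simp, fun τ => by ext; simp⟩
  · have : IsEmpty (specialGraph d ℓ z' ≃g specialGraph d ℓ z) := not_nonempty_iff.1 h
    simp

-- The count is class size times automorphisms: dividing by it corrects at once for the repetitions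
-- within a class and supplies the automorphism factor of the weight.
open Classical in
theorem isoCount_eq (hd : 2 ≤ d) (hℓ : 1 ≤ ℓ) (z : Matchings d ℓ) :
    isoCount z = (Finset.univ.filter fun z' : Matchings d ℓ =>
      Quotient.mk (isoSetoid _) (specialGraph d ℓ z')
        = Quotient.mk (isoSetoid _) (specialGraph d ℓ z)).card * aut (specialGraph d ℓ z) := by
  unfold isoCount
  rw [Finset.sum_congr rfl fun z' _ => sum_preservesEdges hd hℓ z' z, Finset.sum_ite,
    Finset.sum_const_zero, add_zero, Finset.sum_const, nsmul_eq_mul]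
  simp only [mk_eq_mk_iff]

theorem inj_iso {V : Type} [Fintype V] (p : ℝ) {M M' : SimpleGraph V} (υ : M' ≃g M)
    (G : SimpleGraph (Fin n)) : inj p M' G = inj p M G := by
  rw [inj_eq_sum_imageEdges, inj_eq_sum_imageEdges]
  symm
  refine Fintype.sum_equiv (Equiv.embeddingCongr υ.symm.toEquiv (Equiv.refl _)) _ _ fun f => ?_
  have : imageEdges M' (Equiv.embeddingCongr υ.symm.toEquiv (Equiv.refl _) f) = imageEdges M f := by
    rw [← imageEdges_iso υ f]
    congr 1
  rw [this]

theorem aut_iso {V : Type} {M M' : SimpleGraph V} (υ : M' ≃g M) : aut M' = aut M :=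
  Nat.card_congr ⟨fun τ => υ.symm.trans (τ.trans υ), fun τ => υ.trans (τ.trans υ.symm),
    fun τ => by ext; simp, fun τ => by ext; simp⟩

/-- The statistic as a sum over all families of matchings. -/
theorem specialStatistic_eq_sum (hd : 3 ≤ d) (hℓ : 1 ≤ ℓ) (hn : (d - 1) * ℓ + 4 ≤ n) {p : ℝ}
    (hp : p * (1 - p) ≠ 0) (ρ : ℝ) (G : SimpleGraph (Fin n) × SimpleGraph (Fin n)) :
    specialStatistic d ℓ n p ρ G = ∑ z : Matchings d ℓ,
      (ρ / (p * (1 - p))) ^ numEdges d ℓ / (n.descFactorial ((d - 1) * ℓ + 4) : ℝ) / isoCount z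
        * (inj p (specialGraph d ℓ z) G.1 * inj p (specialGraph d ℓ z) G.2) := by
  classical
  unfold specialStatistic motifStatistic specialFamily
  -- It suffices to treat one class: all its terms agree, and their number cancels against the class
  -- size contained in `isoCount`.
  refine Finset.sum_image' _ fun z _ => ?_
  obtain ⟨υ⟩ : Nonempty ((Quotient.mk (isoSetoid _) (specialGraph d ℓ z)).out
      ≃g specialGraph d ℓ z) := mk_eq_mk_iff.1 (Quotient.out_eq _)
  have hterm : ∀ z' ∈ Finset.univ.filter fun z' : Matchings d ℓ =>
      Quotient.mk (isoSetoid _) (specialGraph d ℓ z')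
        = Quotient.mk (isoSetoid _) (specialGraph d ℓ z),
      (ρ / (p * (1 - p))) ^ numEdges d ℓ / (n.descFactorial ((d - 1) * ℓ + 4) : ℝ) / isoCount z'
        * (inj p (specialGraph d ℓ z') G.1 * inj p (specialGraph d ℓ z') G.2)
      = (ρ / (p * (1 - p))) ^ numEdges d ℓ / (n.descFactorial ((d - 1) * ℓ + 4) : ℝ) / isoCount z
        * (inj p (specialGraph d ℓ z) G.1 * inj p (specialGraph d ℓ z) G.2) := by
    intro z' hz'
    rw [Finset.mem_filter] at hz'
    obtain ⟨υ'⟩ := mk_eq_mk_iff.1 hz'.2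
    rw [inj_iso p υ', inj_iso p υ', isoCount_eq (by omega) hℓ, isoCount_eq (by omega) hℓ, hz'.2,
      aut_iso υ']
  rw [Finset.sum_congr rfl hterm, Finset.sum_const, nsmul_eq_mul, inj_iso p υ, inj_iso p υ,
    isoCount_eq (by omega) hℓ]
  have hw := weight_mul (n := n) hp ρ (card_motifVertex.trans_le hn)
    (Quotient.mk (isoSetoid _) (specialGraph d ℓ z)).out
  have he : ((Quotient.mk (isoSetoid _) (specialGraph d ℓ z)).out).edgeSet.ncard = numEdges d ℓ :=
    (isBalanced_out hd hℓ (mem_specialFamily.2 ⟨z, rfl⟩)).ncard_edgeSet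
  rw [he, aut_iso υ, card_motifVertex] at hw
  have h2 : (aut (specialGraph d ℓ z) : ℝ) ≠ 0 := by exact_mod_cast (aut_pos _).ne'
  have h4 : (n.descFactorial ((d - 1) * ℓ + 4) : ℝ) ≠ 0 := by
    exact_mod_cast (Nat.descFactorial_pos.2 hn).ne'
  have h5 : ((Finset.univ.filter fun z' : Matchings d ℓ =>
      Quotient.mk (isoSetoid _) (specialGraph d ℓ z')
        = Quotient.mk (isoSetoid _) (specialGraph d ℓ z)).card : ℝ) ≠ 0 := by
    rw [Nat.cast_ne_zero]
    exact (Finset.card_pos.2 ⟨z, by simp⟩).ne'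
  have h6 : (p * (1 - p)) ^ numEdges d ℓ ≠ 0 := pow_ne_zero _ hp
  rw [div_pow, ← hw]
  field_simp

end Codes

/-! ### An expression for the statistic -/

namespace NatExpr

instance : Add NatExpr := ⟨add⟩
instance : Sub NatExpr := ⟨sub⟩
instance : Mul NatExpr := ⟨mul⟩
instance : Div NatExpr := ⟨div⟩
instance : HPow NatExpr NatExpr NatExpr := ⟨pow⟩

section
variable (η : Fin 10 → ℕ) (a b : NatExpr)

@[simp] theorem eval_var (x : Fin 10) : (var x).eval η = η x := rfl
@[simp] theorem eval_const (c : ℕ) : (const c).eval η = c := rfl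
@[simp] theorem eval_add : (a + b).eval η = a.eval η + b.eval η := rfl
@[simp] theorem eval_sub : (a - b).eval η = a.eval η - b.eval η := rfl
@[simp] theorem eval_mul : (a * b).eval η = a.eval η * b.eval η := rfl
@[simp] theorem eval_div : (a / b).eval η = a.eval η / b.eval η := rfl
@[simp] theorem eval_pow : (a ^ b).eval η = a.eval η ^ b.eval η := rfl

/-- Remainders. -/
def mod : NatExpr := a - b * (a / b)

@[simp] theorem eval_mod : (a.mod b).eval η = a.eval η % b.eval η := by
  simp [mod, Nat.mod_eq_sub_mul_div]

/-- The `i`-th digit of `c` in base `k`. -/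
def digit (c k i : NatExpr) : NatExpr := (c / k ^ i).mod k

@[simp] theorem eval_digit (c k i : NatExpr) :
    (c.digit k i).eval η = c.eval η / k.eval η ^ i.eval η % k.eval η := by
  simp [digit]

end

/-- The number of path vertices. -/
def pathSize : NatExpr := (var 1 - const 1) * var 2

/-- The number of vertices. -/
def order : NatExpr := pathSize + const 4

/-- The number of edges. -/
def edges : NatExpr := var 1 * (var 1 - const 1) / const 2 * var 2 + var 1 + const 1

/-- The number of pairs of paths. -/
def pairs : NatExpr := (var 1 - const 1) * (var 1 - const 1)

/-- The number of digits of the code of a family of matchings. -/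
def codeLength : NatExpr := pairs * var 2

end NatExpr

/-- Boolean combinations of comparisons. -/
inductive ExprTest : Type
  | lt (a b : NatExpr)
  | eq (a b : NatExpr)
  | and (S T : ExprTest)
  | or (S T : ExprTest)

/-- The truth value of a test. -/
def ExprTest.Holds (η : Fin 10 → ℕ) : ExprTest → Prop
  | lt a b => a.eval η < b.eval η
  | eq a b => a.eval η = b.eval η
  | and S T => S.Holds η ∧ T.Holds η
  | or S T => S.Holds η ∨ T.Holds η

/-- The conditional expression. -/
def ExprTest.branch : ExprTest → RealExpr → RealExpr → RealExpr
  | lt a b, e, f => .iteLt a b e f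
  | eq a b, e, f => .iteEq a b e f
  | and S T, e, f => S.branch (T.branch e f) f
  | or S T, e, f => S.branch e (T.branch e f)

open Classical in
theorem ExprTest.eval_branch {n : ℕ} (G : SimpleGraph (Fin n) × SimpleGraph (Fin n)) (p ρ : ℝ)
    (T : ExprTest) (e f : RealExpr) (η : Fin 10 → ℕ) : (T.branch e f).eval G p ρ η
      = if T.Holds η then e.eval G p ρ η else f.eval G p ρ η := by
  induction T generalizing e f with
  | lt a b => simp only [branch, Holds, RealExpr.eval]; congr
  | eq a b => simp only [branch, Holds, RealExpr.eval]; congr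
  | and S T hS hT => by_cases h : S.Holds η <;> by_cases h' : T.Holds η <;> simp [branch, Holds, *]
  | or S T hS hT => by_cases h : S.Holds η <;> by_cases h' : T.Holds η <;> simp [branch, Holds, *]

/-- The edge relation, for the vertices numbered `a` and `b` and the matchings with code `c`. -/
def relTest (c a b : NatExpr) : ExprTest :=
  let D := NatExpr.pathSize
  let d' := NatExpr.var 1 - .const 1
  let ℓ := NatExpr.var 2
  .or (.and (.eq a D) (.eq b (D + .const 1)))
  (.or (.and (.eq a (D + .const 2)) (.eq b (D + .const 3)))
  (.and (.lt b D)
    (.or (.and (.eq a (D + .const 1)) (.eq (b.mod ℓ) (.const 0)))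
    (.or (.and (.eq a (D + .const 2)) (.eq (b.mod ℓ + .const 1) ℓ))
    (.and (.lt a D)
      (.or (.and (.eq (a / ℓ) (b / ℓ)) (.eq (a.mod ℓ + .const 1) (b.mod ℓ)))
      (.and (.lt (a / ℓ) (b / ℓ))
        (.eq (c.digit ℓ (a.mod ℓ + ℓ * (b / ℓ + d' * (a / ℓ)))) (b.mod ℓ)))))))))

/-- The numbering of the vertices. -/
def vertexEquiv (d ℓ : ℕ) : MotifVertex d ℓ ≃ Fin ((d - 1) * ℓ + 4) :=
  (Equiv.sumComm _ _).trans ((Equiv.sumCongr finProdFinEquiv (Equiv.refl _)).trans finSumFinEquiv)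

theorem vertexEquiv_inl {d ℓ : ℕ} (u : Fin 4) :
    (vertexEquiv d ℓ (Sum.inl u) : ℕ) = (d - 1) * ℓ + u := by
  simp [vertexEquiv]

theorem vertexEquiv_inr {d ℓ : ℕ} (i : Fin (d - 1)) (s : Fin ℓ) :
    (vertexEquiv d ℓ (Sum.inr (i, s)) : ℕ) = s + ℓ * i := by
  simp [vertexEquiv]

theorem add_mul_lt {d ℓ : ℕ} (i : Fin (d - 1)) (s : Fin ℓ) : (s : ℕ) + ℓ * i < (d - 1) * ℓ :=
  (finProdFinEquiv (i, s)).2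

/-- The digit positions of the code of a family of matchings. -/
def codeEquiv (d ℓ : ℕ) : (Fin (d - 1) × Fin (d - 1)) × Fin ℓ ≃ Fin ((d - 1) * (d - 1) * ℓ) :=
  (Equiv.prodCongr finProdFinEquiv (Equiv.refl _)).trans finProdFinEquiv

theorem codeEquiv_apply {d ℓ : ℕ} (q : Fin (d - 1) × Fin (d - 1)) (s : Fin ℓ) :
    (codeEquiv d ℓ (q, s) : ℕ) = s + ℓ * (finProdFinEquiv q : Fin _) := by
  simp [codeEquiv]

section
variable {d ℓ n : ℕ} {η : Fin 10 → ℕ}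

/-- `c` is the code of the family of matchings `z`. -/
def IsCode (d ℓ c : ℕ) (z : Matchings d ℓ) : Prop :=
  ∀ q s, c / ℓ ^ (codeEquiv d ℓ (q, s) : ℕ) % ℓ = z q.1 q.2 s

/-- The path vertices are numbered first, the t-th vertex of path i being t + ℓ i, and the four
special vertices come last. Quotient and remainder by ℓ thus recover path and position. -/
theorem holds_relTest (h1 : η 1 = d) (h2 : η 2 = ℓ) {c a b : NatExpr} {z : Matchings d ℓ}
    {x y : MotifVertex d ℓ} (hc : IsCode d ℓ (c.eval η) z) (ha : a.eval η = vertexEquiv d ℓ x)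
    (hb : b.eval η = vertexEquiv d ℓ y) : (relTest c a b).Holds η ↔ specialRel d ℓ z x y := by
  have hmod : ∀ (i : Fin (d - 1)) (s : Fin ℓ), ((s : ℕ) + ℓ * i) % ℓ = s := fun i s => by
    rw [Nat.add_mul_mod_self_left, Nat.mod_eq_of_lt s.2]
  have hdiv : ∀ (i : Fin (d - 1)) (s : Fin ℓ), ((s : ℕ) + ℓ * i) / ℓ = i := fun i s => by
    rw [Nat.add_mul_div_left _ _ (by have := s.2; omega), Nat.div_eq_of_lt s.2, zero_add]
  have hD : NatExpr.pathSize.eval η = (d - 1) * ℓ := by simp [NatExpr.pathSize, h1, h2]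
  simp only [relTest, ExprTest.Holds, NatExpr.eval_add, NatExpr.eval_const, NatExpr.eval_mod,
    NatExpr.eval_div, NatExpr.eval_var, NatExpr.eval_digit, NatExpr.eval_mul, NatExpr.eval_sub, hD,
    h1, h2, ha, hb]
  rcases x with u | ⟨i, s⟩ <;> rcases y with w | ⟨j, t⟩ <;>
    simp only [vertexEquiv_inl, vertexEquiv_inr, specialRel, Fin.ext_iff, Fin.val_zero, Fin.val_one]
  · have := u.2; have := w.2
    have e2 : ((2 : Fin 4) : ℕ) = 2 := rfl
    have e3 : ((3 : Fin 4) : ℕ) = 3 := rfl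
    rw [e2, e3]; omega
  · have := add_mul_lt j t
    have e2 : ((2 : Fin 4) : ℕ) = 2 := rfl
    rw [e2, hmod]; omega
  · have := add_mul_lt i s
    simp only [iff_false]; omega
  · have h3 := add_mul_lt i s
    have h4 := add_mul_lt j t
    have h5 := hc (i, j) s
    rw [codeEquiv_apply, finProdFinEquiv_apply_val] at h5
    rw [hmod, hmod, hdiv, hdiv, h5]
    simp only [Fin.lt_def]
    omega

end

/-! ### The statistic written as an expression, and its value. -/

namespace RealExpr
open NatExpr

/-- The constant `0`. -/
def zero : RealExpr := ofNat (const 0)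

/-- The constant `1`. -/
def one : RealExpr := ofNat (const 1)

/-- Whether the first `v` digits of `c` in base `k` are distinct, where `v` is the number of
vertices. -/
def distinct (c k : NatExpr) : RealExpr :=
  prod 5 order (prod 6 order (iteEq (var 5) (var 6) one
    (iteEq (c.digit k (var 5)) (c.digit k (var 6)) zero one)))

/-- The product of `w` over the edges `(5, 6)` of the motif with code `c`. -/
def edgeProd (c : NatExpr) (w : RealExpr) : RealExpr :=
  prod 5 order (prod 6 order ((relTest c (var 5) (var 6)).branch w one))

/-- The injective homomorphism number of the motif with code in variable `3`. -/
def injExpr (adj : NatExpr → NatExpr → RealExpr) : RealExpr :=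
  sum 4 (var 0 ^ order) (mul (distinct (var 4) (var 0))
    (edgeProd (var 3) (sub (adj ((var 4).digit (var 0) (var 5)) ((var 4).digit (var 0) (var 6)))
      prob)))

/-- Whether `c` is the code of a family of matchings. -/
def valid (c : NatExpr) : RealExpr :=
  prod 5 pairs (prod 6 (var 2) (prod 8 (var 2) (iteEq (var 6) (var 8) one
    (iteEq (c.digit (var 2) (var 6 + var 2 * var 5)) (c.digit (var 2) (var 8 + var 2 * var 5))
      zero one))))

/-- The number of isomorphisms from the motifs of all families of matchings to the motif with code
in variable `3`. -/
def isoCountExpr : RealExpr :=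
  sum 7 (var 2 ^ codeLength) (mul (valid (var 7)) (sum 9 (order ^ order)
    (mul (distinct (var 9) order) (edgeProd (var 7)
      ((ExprTest.or (relTest (var 3) ((var 9).digit order (var 5)) ((var 9).digit order (var 6)))
        (relTest (var 3) ((var 9).digit order (var 6)) ((var 9).digit order (var 5)))).branch
        one zero)))))

/-- The normalization of the statistic. -/
def scale : RealExpr :=
  div (prod 5 edges (div corr (mul prob (sub one prob)))) (prod 5 order (ofNat (var 0 - var 5)))

/-- The statistic. -/
def statistic : RealExpr :=
  sum 3 (var 2 ^ codeLength) (mul (valid (var 3)) (mul (div scale isoCountExpr)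
    (mul (injExpr adjFst) (injExpr adjSnd))))

section
variable {d ℓ n : ℕ} {G : SimpleGraph (Fin n) × SimpleGraph (Fin n)} {p ρ : ℝ}
  {η : Fin 10 → ℕ}

/-- The input variables. -/
structure IsInput (n d ℓ : ℕ) (η : Fin 10 → ℕ) : Prop where
  eq0 : η 0 = n
  eq1 : η 1 = d
  eq2 : η 2 = ℓ

theorem IsInput.update (h : IsInput n d ℓ η) {x : Fin 10} (hx : 2 < x) (i : ℕ) :
    IsInput n d ℓ (Function.update η x i) := by
  refine ⟨?_, ?_, ?_⟩
  · rw [Function.update_of_ne (by rintro rfl; revert hx; decide), h.eq0]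
  · rw [Function.update_of_ne (by rintro rfl; revert hx; decide), h.eq1]
  · rw [Function.update_of_ne (by rintro rfl; revert hx; decide), h.eq2]

theorem IsInput.eval_order (h : IsInput n d ℓ η) : order.eval η = (d - 1) * ℓ + 4 := by
  simp [order, pathSize, h.eq1, h.eq2]

@[simp] theorem eval_zero : zero.eval G p ρ η = 0 := by simp [zero, eval]

@[simp] theorem eval_one : one.eval G p ρ η = 1 := by simp [one, eval]

theorem eval_distinct (h : IsInput n d ℓ η) {β : Type} [DecidableEq β] {K : ℕ} (e : β ≃ Fin K)
    {w : Fin 10} (hw5 : w ≠ 5) (hw6 : w ≠ 6) {k : NatExpr}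
    (hk : ∀ i j, k.eval (Function.update (Function.update η 5 i) 6 j) = K)
    {g : MotifVertex d ℓ → β} [Decidable (Function.Injective g)]
    (hg : ∀ x, η w / K ^ (vertexEquiv d ℓ x : ℕ) % K = e (g x)) :
    (distinct (var w) k).eval G p ρ η = if Function.Injective g then 1 else 0 := by
  rw [← prod_injective]
  simp only [distinct, eval]
  rw [h.eval_order]
  refine prod_range_equiv (vertexEquiv d ℓ) fun x => ?_
  rw [(h.update (by decide) _).eval_order]
  refine prod_range_equiv (vertexEquiv d ℓ) fun y => ?_
  simp only [eval_var, eval_digit, hk, Function.update_self, Function.update_of_ne hw5,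
    Function.update_of_ne hw6, Function.update_of_ne (show (5 : Fin 10) ≠ 6 by decide), hg,
    Fin.val_inj, EmbeddingLike.apply_eq_iff_eq, eval_one, eval_zero]

open Classical in
theorem eval_edgeProd (h : IsInput n d ℓ η) {c : Fin 10} (hc5 : c ≠ 5) (hc6 : c ≠ 6)
    {z : Matchings d ℓ} (hc : IsCode d ℓ (η c) z) {w : RealExpr}
    {W : MotifVertex d ℓ → MotifVertex d ℓ → ℝ}
    (hw : ∀ x y, w.eval G p ρ (Function.update (Function.update η 5 (vertexEquiv d ℓ x)) 6
      (vertexEquiv d ℓ y)) = W x y) :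
    (edgeProd (var c) w).eval G p ρ η
      = ∏ x, ∏ y, if specialRel d ℓ z x y then W x y else 1 := by
  simp only [edgeProd, eval]
  rw [h.eval_order]
  refine prod_range_equiv (vertexEquiv d ℓ) fun x => ?_
  have h' := h.update (x := 5) (by decide) (vertexEquiv d ℓ x)
  rw [h'.eval_order]
  refine prod_range_equiv (vertexEquiv d ℓ) fun y => ?_
  have h'' := h'.update (x := 6) (by decide) (vertexEquiv d ℓ y)
  rw [ExprTest.eval_branch, hw, eval_one]
  refine if_congr (holds_relTest h''.eq1 h''.eq2 ?_ ?_ ?_) rfl rfl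
  · rw [eval_var, Function.update_of_ne hc6, Function.update_of_ne hc5]; exact hc
  · rw [eval_var, Function.update_of_ne (by decide), Function.update_self]
  · rw [eval_var, Function.update_self]

theorem eval_injExpr (h : IsInput n d ℓ η) {z : Matchings d ℓ} (hc : IsCode d ℓ (η 3) z)
    {adj : NatExpr → NatExpr → RealExpr} {H : SimpleGraph (Fin n)}
    (hadj : ∀ a b η, (adj a b).eval G p ρ η = (adjQuery H (a.eval η) (b.eval η) : ℕ)) :
    (injExpr adj).eval G p ρ η = inj p (specialGraph d ℓ z) H := by
  classical
  unfold inj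
  rw [← sum_embedding fun f : MotifVertex d ℓ → Fin n =>
    ∏ e ∈ (specialGraph d ℓ z).edgeFinset, centeredWeight p H (e.map f)]
  simp only [injExpr, eval, eval_pow, eval_var, h.eq0, h.eval_order]
  refine sum_range_pow (vertexEquiv d ℓ) (Equiv.refl (Fin n)) fun i f hf => ?_
  have h' := h.update (x := 4) (by decide) i
  rw [eval_distinct h' (Equiv.refl (Fin n)) (by decide) (by decide)
    (k := var 0)
    (fun i j => ((h'.update (x := 5) (by decide) i).update (x := 6) (by decide) j).eq0)
    (g := f) (by simpa using hf)]
  rw [eval_edgeProd h' (by decide) (by decide) (z := z)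
    (W := fun x y => centeredWeight p H s(f x, f y)), ← prod_edgeFinset_specialGraph]
  · rfl
  · rwa [Function.update_of_ne (by decide)]
  · intro x y
    simp only [eval, hadj, eval_digit, eval_var, Function.update_self,
      Function.update_of_ne (show (5 : Fin 10) ≠ 6 by decide),
      Function.update_of_ne (show (4 : Fin 10) ≠ 6 by decide),
      Function.update_of_ne (show (4 : Fin 10) ≠ 5 by decide),
      Function.update_of_ne (show (0 : Fin 10) ≠ 6 by decide),
      Function.update_of_ne (show (0 : Fin 10) ≠ 5 by decide),
      Function.update_of_ne (show (0 : Fin 10) ≠ 4 by decide), h.eq0, hf]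
    simp [centeredWeight, adjQuery]

open Classical in
theorem sum_valid (h : IsInput n d ℓ η) {x : Fin 10} (hx : 2 < x) (hx5 : x ≠ 5) (hx6 : x ≠ 6)
    (hx8 : x ≠ 8) {e : RealExpr} {F : Matchings d ℓ → ℝ}
    (hF : ∀ c z, IsCode d ℓ c z → e.eval G p ρ (Function.update η x c) = F z) :
    (sum x (var 2 ^ codeLength) (mul (valid (var x)) e)).eval G p ρ η = ∑ z, F z := by
  have hlen : (var 2 ^ codeLength).eval η = ℓ ^ ((d - 1) * (d - 1) * ℓ) := by
    simp [codeLength, pairs, h.eq1, h.eq2]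
  -- Codes describe arbitrary families of self-maps, so the summand needs a value on all of them.
  -- Off the families of permutations it is irrelevant, because the first factor vanishes there.
  rw [eval, hlen, sum_range_pow (codeEquiv d ℓ) (Equiv.refl (Fin ℓ)) (H' := fun g =>
    (∏ q, if Function.Injective (fun s => g (q, s)) then (1 : ℝ) else 0)
      * if hz : ∃ z : Matchings d ℓ, ∀ q s, g (q, s) = z q.1 q.2 s then F hz.choose else 0)]
  · rw [← Equiv.sum_comp (Equiv.curry _ _ _).symm]
    refine (sum_matchings fun g => if hz : ∃ z : Matchings d ℓ, ∀ q s, g q s = z q.1 q.2 s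
      then F hz.choose else 0).trans (Finset.sum_congr rfl fun z _ => ?_)
    have hz : ∃ z' : Matchings d ℓ, ∀ (q : Fin (d - 1) × Fin (d - 1)) s,
      z q.1 q.2 s = z' q.1 q.2 s := ⟨z, fun _ _ => rfl⟩
    rw [dif_pos hz]
    congr 1
    funext i j
    ext s
    rw [hz.choose_spec (i, j) s]
  · intro c g hg
    have h' := h.update hx c
    have hvalid : (valid (var x)).eval G p ρ (Function.update η x c)
        = ∏ q, if Function.Injective (fun s => g (q, s)) then (1 : ℝ) else 0 := by
      simp only [valid, eval]
      have hpairs : pairs.eval (Function.update η x c) = (d - 1) * (d - 1) := by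
        simp [pairs, h'.eq1]
      rw [hpairs]
      refine prod_range_equiv finProdFinEquiv fun q => ?_
      rw [← prod_injective]
      have h5 := h'.update (x := 5) (by decide) (finProdFinEquiv q : Fin _)
      rw [eval_var, h5.eq2]
      refine prod_range_equiv (Equiv.refl (Fin ℓ)) fun s => ?_
      have h6 := h5.update (x := 6) (by decide) (s : ℕ)
      rw [Equiv.refl_apply, eval_var, h6.eq2]
      refine prod_range_equiv (Equiv.refl (Fin ℓ)) fun t => ?_
      have h8 := h6.update (x := 8) (by decide) (t : ℕ)
      have hs := hg (q, s)
      have ht := hg (q, t)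
      rw [codeEquiv_apply, Equiv.refl_apply] at hs ht
      simp only [eval_var, eval_digit, eval_add, eval_mul, Equiv.refl_apply, h8.eq2, eval_one,
        eval_zero, Function.update_self, Function.update_of_ne hx5, Function.update_of_ne hx6,
        Function.update_of_ne hx8, Function.update_of_ne (show (6 : Fin 10) ≠ 8 by decide),
        Function.update_of_ne (show (5 : Fin 10) ≠ 8 by decide),
        Function.update_of_ne (show (5 : Fin 10) ≠ 6 by decide), hs, ht, Fin.val_inj]
    rw [eval, hvalid, Finset.prod_ite_zero]
    by_cases hinj : ∀ q ∈ Finset.univ, Function.Injective fun s => g (q, s)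
    · have hz : ∃ z : Matchings d ℓ, ∀ q s, g (q, s) = z q.1 q.2 s :=
        ⟨fun i j => Equiv.ofBijective _
          (Finite.injective_iff_bijective.1 (hinj (i, j) (Finset.mem_univ _))), fun q s => rfl⟩
      rw [dif_pos hz, hF c hz.choose]
      intro q s
      rw [hg (q, s), Equiv.refl_apply, hz.choose_spec]
    · rw [if_neg hinj, zero_mul, zero_mul]

theorem eval_isoCountExpr (h : IsInput n d ℓ η) {z : Matchings d ℓ} (hc : IsCode d ℓ (η 3) z) :
    isoCountExpr.eval G p ρ η = isoCount z := by
  classical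
  refine sum_valid h (by decide) (by decide) (by decide) (by decide) fun c' z' hc' => ?_
  rw [← sum_embedding fun τ : MotifVertex d ℓ → MotifVertex d ℓ =>
    if PreservesEdges z' z τ then (1 : ℝ) else 0]
  have h7 := h.update (x := 7) (by decide) c'
  simp only [eval, eval_pow, h7.eval_order]
  refine sum_range_pow (vertexEquiv d ℓ) (vertexEquiv d ℓ) fun i τ hτ => ?_
  have h9 := h7.update (x := 9) (by decide) i
  rw [eval_distinct h9 (vertexEquiv d ℓ) (by decide) (by decide)
    (fun i j => ((h9.update (x := 5) (by decide) i).update (x := 6) (by decide) j).eval_order)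
    (g := τ) (by simpa using hτ)]
  rw [eval_edgeProd h9 (by decide) (by decide) (z := z')
    (W := fun x y => if (specialGraph d ℓ z).Adj (τ x) (τ y) then 1 else 0)]
  · congr 1
    split_ifs with hP
    · refine Finset.prod_eq_one fun x _ => Finset.prod_eq_one fun y _ => ?_
      split_ifs with h1 h2
      · rfl
      · exact absurd (hP x y h1) h2
      · rfl
    · unfold PreservesEdges at hP
      push Not at hP
      obtain ⟨x, y, h1, h2⟩ := hP
      refine Finset.prod_eq_zero (Finset.mem_univ x) (Finset.prod_eq_zero (Finset.mem_univ y) ?_)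
      rw [if_pos h1, if_neg h2]
  · rwa [Function.update_of_ne (by decide), Function.update_self]
  · intro x y
    have h56 := (h9.update (x := 5) (by decide) (vertexEquiv d ℓ x)).update (x := 6) (by decide)
      (vertexEquiv d ℓ y)
    rw [ExprTest.eval_branch, eval_one, eval_zero]
    refine if_congr ?_ rfl rfl
    have hdx : ((var 9).digit order (var 5)).eval (Function.update (Function.update
        (Function.update (Function.update η 7 c') 9 i) 5 (vertexEquiv d ℓ x)) 6
        (vertexEquiv d ℓ y)) = vertexEquiv d ℓ (τ x) := by
      simp [h56.eval_order, hτ]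
    have hdy : ((var 9).digit order (var 6)).eval (Function.update (Function.update
        (Function.update (Function.update η 7 c') 9 i) 5 (vertexEquiv d ℓ x)) 6
        (vertexEquiv d ℓ y)) = vertexEquiv d ℓ (τ y) := by
      simp [h56.eval_order, hτ]
    have hc3 : IsCode d ℓ ((var 3).eval (Function.update (Function.update
        (Function.update (Function.update η 7 c') 9 i) 5 (vertexEquiv d ℓ x)) 6
        (vertexEquiv d ℓ y))) z := by
      simpa using hc
    rw [specialGraph_adj, ExprTest.Holds, holds_relTest h56.eq1 h56.eq2 hc3 hdx hdy,
      holds_relTest h56.eq1 h56.eq2 hc3 hdy hdx]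

theorem eval_scale (h : IsInput n d ℓ η) : scale.eval G p ρ η
    = (ρ / (p * (1 - p))) ^ numEdges d ℓ / (n.descFactorial ((d - 1) * ℓ + 4) : ℝ) := by
  have he : edges.eval η = numEdges d ℓ := by
    simp [edges, h.eq1, h.eq2, numEdges, Nat.choose_two_right]
  simp only [scale, eval, he, h.eval_order, eval_one, Finset.prod_const, Finset.card_range,
    Nat.descFactorial_eq_prod_range, Nat.cast_prod]
  congr 1
  refine Finset.prod_congr rfl fun i _ => ?_
  rw [eval_sub, eval_var, (h.update (x := 5) (by decide) i).eq0, eval_var, Function.update_self]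

theorem eval_statistic (h : IsInput n d ℓ η) (hd : 3 ≤ d) (hℓ : 1 ≤ ℓ)
    (hn : (d - 1) * ℓ + 4 ≤ n) (hp : p * (1 - p) ≠ 0) :
    statistic.eval G p ρ η = specialStatistic d ℓ n p ρ G := by
  rw [specialStatistic_eq_sum hd hℓ hn hp]
  refine sum_valid h (by decide) (by decide) (by decide) (by decide) fun c z hc => ?_
  have h' := h.update (x := 3) (by decide) c
  have hc' : IsCode d ℓ (Function.update η 3 c 3) z := by rwa [Function.update_self]
  simp only [eval]
  rw [eval_scale h', eval_isoCountExpr h' hc', eval_injExpr h' hc' (H := G.1) fun a b η => rfl,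
    eval_injExpr h' hc' (H := G.2) fun a b η => rfl]

end
end RealExpr

/-! ### The running time -/

/-- The variables `η` hold an input whose parameters are controlled by `U`, variable `4` has at
most `U ^ A` binary digits, and the other variables are at most `U ^ A`. -/
structure Admissible (A U : ℕ) (η : Fin 10 → ℕ) : Prop where
  two_le : 2 ≤ U
  pos : 1 ≤ η 0
  size_le : (η 0).size ≤ U
  le1 : η 1 ≤ U
  le2 : η 2 ≤ U
  code_le : η 2 ^ ((η 1 - 1) * (η 1 - 1) * η 2) ≤ U
  order_le : ((η 1 - 1) * η 2 + 4) ^ ((η 1 - 1) * η 2 + 4) ≤ U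
  size4_le : (η 4).size ≤ U ^ A
  le : ∀ x, 2 < x → x ≠ 4 → η x ≤ U ^ A

section
variable {A A' U : ℕ} {η : Fin 10 → ℕ}

theorem Admissible.mono (h : Admissible A U η) (hA : A ≤ A') : Admissible A' U η :=
  have hU := h.two_le
  { h with
    size4_le := h.size4_le.trans (Nat.pow_le_pow_right (by omega) hA)
    le := fun x hx hx' => (h.le x hx hx').trans (Nat.pow_le_pow_right (by omega) hA) }

theorem update_input {x : Fin 10} (hx : 2 < x) (i : ℕ) : Function.update η x i 0 = η 0 ∧
    Function.update η x i 1 = η 1 ∧ Function.update η x i 2 = η 2 := by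
  refine ⟨?_, ?_, ?_⟩ <;>
    exact Function.update_of_ne (by rintro rfl; revert hx; decide) _ _

theorem Admissible.update (h : Admissible A U η) {x : Fin 10} (hx : 2 < x) (hx4 : x ≠ 4) {i : ℕ}
    (hi : i ≤ U ^ A) : Admissible A U (Function.update η x i) := by
  obtain ⟨e0, e1, e2⟩ := update_input (η := η) hx i
  refine ⟨h.two_le, ?_, ?_, ?_, ?_, ?_, ?_, ?_, fun y hy hy4 => ?_⟩
  · rw [e0]; exact h.pos
  · rw [e0]; exact h.size_le
  · rw [e1]; exact h.le1
  · rw [e2]; exact h.le2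
  · rw [e1, e2]; exact h.code_le
  · rw [e1, e2]; exact h.order_le
  · rw [Function.update_of_ne hx4.symm]; exact h.size4_le
  · by_cases hyx : y = x
    · rw [hyx, Function.update_self]; exact hi
    · rw [Function.update_of_ne hyx]; exact h.le y hy hy4

theorem Admissible.update4 (h : Admissible A U η) {i : ℕ} (hi : i.size ≤ U ^ A) :
    Admissible A U (Function.update η 4 i) := by
  obtain ⟨e0, e1, e2⟩ := update_input (η := η) (show (2 : Fin 10) < 4 by decide) i
  refine ⟨h.two_le, ?_, ?_, ?_, ?_, ?_, ?_, ?_, fun y hy hy4 => ?_⟩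
  · rw [e0]; exact h.pos
  · rw [e0]; exact h.size_le
  · rw [e1]; exact h.le1
  · rw [e2]; exact h.le2
  · rw [e1, e2]; exact h.code_le
  · rw [e1, e2]; exact h.order_le
  · rw [Function.update_self]; exact hi
  · rw [Function.update_of_ne hy4]; exact h.le y hy hy4

/-- The number of maps from the vertices to `Fin n`, to the power `j`. -/
def mainFactor (j : ℕ) (η : Fin 10 → ℕ) : ℕ := (η 0 ^ ((η 1 - 1) * η 2 + 4)) ^ j

theorem Admissible.mainFactor_pos (h : Admissible A U η) (j : ℕ) : 0 < mainFactor j η :=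
  pow_pos (pow_pos h.pos _) _

theorem mainFactor_update {x : Fin 10} (hx : 2 < x) (j i : ℕ) :
    mainFactor j (Function.update η x i) = mainFactor j η := by
  obtain ⟨e0, e1, e2⟩ := update_input (η := η) hx i
  rw [mainFactor, mainFactor, e0, e1, e2]

/-- `f` is at most polynomial in the control parameter, up to the main factor. -/
def Bdd (j A : ℕ) (f : (Fin 10 → ℕ) → ℕ) : Prop :=
  ∃ k, ∀ U η, Admissible A U η → f η ≤ mainFactor j η * U ^ k

variable {j : ℕ} {f g : (Fin 10 → ℕ) → ℕ}

theorem Bdd.mono (hg : Bdd j A g) (h : ∀ U η, Admissible A U η → f η ≤ g η) : Bdd j A f := by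
  obtain ⟨k, hk⟩ := hg
  exact ⟨k, fun U η hη => (h U η hη).trans (hk U η hη)⟩

theorem Bdd.const (j A c : ℕ) : Bdd j A fun _ => c := by
  refine ⟨c, fun U η hη => ?_⟩
  calc c ≤ 2 ^ c := Nat.lt_two_pow_self.le
    _ ≤ U ^ c := Nat.pow_le_pow_left hη.two_le c
    _ ≤ mainFactor j η * U ^ c := Nat.le_mul_of_pos_left _ (hη.mainFactor_pos j)

theorem Bdd.add (hf : Bdd j A f) (hg : Bdd j A g) : Bdd j A fun η => f η + g η := by
  obtain ⟨k, hk⟩ := hf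
  obtain ⟨l, hl⟩ := hg
  refine ⟨k + l + 1, fun U η hη => ?_⟩
  have hU := hη.two_le
  have h1 : U ^ k ≤ U ^ (k + l) := Nat.pow_le_pow_right (by omega) (by omega)
  have h2 : U ^ l ≤ U ^ (k + l) := Nat.pow_le_pow_right (by omega) (by omega)
  have h3 : U ^ (k + l) * 2 ≤ U ^ (k + l) * U := Nat.mul_le_mul_left _ hU
  calc f η + g η ≤ mainFactor j η * U ^ k + mainFactor j η * U ^ l :=
        add_le_add (hk U η hη) (hl U η hη)
    _ = mainFactor j η * (U ^ k + U ^ l) := by ring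
    _ ≤ mainFactor j η * U ^ (k + l + 1) := Nat.mul_le_mul_left _ (by rw [pow_succ]; omega)

theorem Bdd.mul (hf : Bdd 0 A f) (hg : Bdd j A g) : Bdd j A fun η => f η * g η := by
  obtain ⟨k, hk⟩ := hf
  obtain ⟨l, hl⟩ := hg
  refine ⟨k + l, fun U η hη => ?_⟩
  calc f η * g η ≤ mainFactor 0 η * U ^ k * (mainFactor j η * U ^ l) :=
        Nat.mul_le_mul (hk U η hη) (hl U η hη)
    _ = mainFactor j η * U ^ (k + l) := by rw [mainFactor, pow_zero]; ring

theorem Bdd.of_zero (hf : Bdd 0 A f) : Bdd j A f := by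
  simpa using hf.mul (Bdd.const j A 1)

/-- Products and quotients cost a polynomial in the number of digits only. Hence operands may be as
large as n^v, provided their digits are controlled. -/
theorem Bdd.quotCost (hf : Bdd 0 A fun η => (f η).size) :
    Bdd 0 A fun η => MotifCounting.quotCost (f η) :=
  (hf.mul (((Bdd.const 0 A 4).mul hf).add (Bdd.const 0 A 8))).add (Bdd.const 0 A 6)

theorem size_le_self (m : ℕ) : m.size ≤ m := Nat.size_le.2 Nat.lt_two_pow_self

theorem Bdd.size (hf : Bdd 0 A f) : Bdd 0 A fun η => (f η).size :=
  hf.mono fun _ _ _ => size_le_self _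

end

/-! ### Bounds on digits and on values of integer expressions. -/

namespace NatExpr
variable {a b c k i : NatExpr}

/-- The cost and the number of digits of the value are polynomially bounded. -/
def Tame (a : NatExpr) : Prop :=
  ∀ A, Bdd 0 A (fun η => a.cost η) ∧ Bdd 0 A fun η => (a.eval η).size

/-- The cost and the value are polynomially bounded. -/
def Small (a : NatExpr) : Prop :=
  ∀ A, Bdd 0 A (fun η => a.cost η) ∧ Bdd 0 A fun η => a.eval η

theorem Small.tame (h : Small a) : Tame a := fun A => ⟨(h A).1, (h A).2.size⟩

theorem tame_var0 : Tame (var 0) := fun A => ⟨Bdd.const 0 A 1, 1, fun U η hη => by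
  simpa [mainFactor] using hη.size_le⟩

theorem tame_var4 : Tame (var 4) := fun A => ⟨Bdd.const 0 A 1, A, fun U η hη => by
  simpa [mainFactor] using hη.size4_le⟩

theorem small_var1 : Small (var 1) := fun A => ⟨Bdd.const 0 A 1, 1, fun U η hη => by
  simpa [mainFactor] using hη.le1⟩

theorem small_var2 : Small (var 2) := fun A => ⟨Bdd.const 0 A 1, 1, fun U η hη => by
  simpa [mainFactor] using hη.le2⟩

theorem small_var {x : Fin 10} (hx : 2 < x) (hx4 : x ≠ 4) : Small (var x) :=
  fun A => ⟨Bdd.const 0 A 1, A, fun U η hη => by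
    simpa [mainFactor] using hη.le x hx hx4⟩

theorem small_const (n : ℕ) : Small (const n) := fun A => ⟨Bdd.const 0 A 1, Bdd.const 0 A n⟩

theorem Small.add (ha : Small a) (hb : Small b) : Small (a + b) := fun A =>
  ⟨((ha A).1.add (hb A).1).add (Bdd.const 0 A 1), (ha A).2.add (hb A).2⟩

theorem Tame.sub (ha : Tame a) (hb : Tame b) : Tame (a - b) := fun A =>
  ⟨((ha A).1.add (hb A).1).add (Bdd.const 0 A 1),
    (ha A).2.mono fun _ _ _ => Nat.size_le_size (Nat.sub_le _ _)⟩

theorem Small.sub (ha : Small a) (hb : Tame b) : Small (a - b) := fun A =>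
  ⟨((ha A).1.add (hb A).1).add (Bdd.const 0 A 1), (ha A).2.mono fun _ _ _ => Nat.sub_le _ _⟩

theorem Tame.bdd_cost_mul (ha : Tame a) (hb : Tame b) (A : ℕ) :
    Bdd 0 A fun η => (a * b).cost η :=
  (((ha A).1.add (hb A).1).add (hb A).2.quotCost).add (Bdd.const 0 A 1)

theorem Tame.mul (ha : Tame a) (hb : Tame b) : Tame (a * b) := fun A =>
  ⟨ha.bdd_cost_mul hb A, ((ha A).2.add (hb A).2).mono fun U η hη => Nat.size_le.2 (by
    rw [eval_mul, pow_add]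
    exact Nat.mul_lt_mul'' (Nat.lt_size_self _) (Nat.lt_size_self _))⟩

theorem Small.mul (ha : Small a) (hb : Small b) : Small (a * b) := fun A =>
  ⟨ha.tame.bdd_cost_mul hb.tame A, (ha A).2.mul (hb A).2⟩

theorem Tame.bdd_cost_div (ha : Tame a) (hb : Tame b) (A : ℕ) :
    Bdd 0 A fun η => (a / b).cost η :=
  (((ha A).1.add (hb A).1).add (ha A).2.quotCost).add (Bdd.const 0 A 2)

theorem Tame.div (ha : Tame a) (hb : Tame b) : Tame (a / b) := fun A =>
  ⟨ha.bdd_cost_div hb A, (ha A).2.mono fun _ _ _ => Nat.size_le_size (Nat.div_le_self _ _)⟩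

theorem Small.div (ha : Small a) (hb : Tame b) : Small (a / b) := fun A =>
  ⟨ha.tame.bdd_cost_div hb A, (ha A).2.mono fun _ _ _ => Nat.div_le_self _ _⟩

/-- The digits of a power are multiplied by the exponent, and the exponent is also a number of loop
rounds, so its value must be bounded and not just its digits. -/
theorem Tame.pow (ha : Tame a) (hb : Small b) : Tame (a ^ b) := fun A =>
  ⟨(((ha A).1.add (hb A).1).add ((hb A).2.mul ((ha A).2.quotCost.add (Bdd.const 0 A 7)))).add
    (Bdd.const 0 A 4),
   (((ha A).2.mul (hb A).2).add (Bdd.const 0 A 1)).mono fun U η hη => Nat.size_le.2 (by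
    rw [eval_pow, pow_succ, pow_mul]
    have h1 := Nat.pow_le_pow_left (Nat.lt_size_self (a.eval η)).le (b.eval η)
    have h2 : 0 < (2 ^ (a.eval η).size) ^ b.eval η := by positivity
    omega)⟩

theorem Tame.mod (ha : Tame a) (hb : Tame b) : Tame (a.mod b) := ha.sub (hb.mul (ha.div hb))

theorem Small.mod (ha : Small a) (hb : Tame b) : Small (a.mod b) :=
  ha.sub (hb.mul (ha.tame.div hb))

theorem Tame.digit (hc : Tame c) (hk : Tame k) (hi : Small i) : Tame (c.digit k i) :=
  (hc.div (hk.pow hi)).mod hk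

theorem Small.digit (hc : Small c) (hk : Tame k) (hi : Small i) : Small (c.digit k i) :=
  (hc.div (hk.pow hi)).mod hk

theorem small_pred : Small (var 1 - const 1) := small_var1.sub (small_const 1).tame

theorem small_pathSize : Small pathSize := small_pred.mul small_var2

theorem small_order : Small order := small_pathSize.add (small_const 4)

theorem small_edges : Small edges :=
  ((((small_var1.mul small_pred).div (small_const 2).tame).mul small_var2).add small_var1).add
    (small_const 1)

theorem small_pairs : Small pairs := small_pred.mul small_pred

/-- A power is not small by general rules. This one is because its value is among the quantities
that the control parameter dominates; likewise for the number of self-maps of the vertices. -/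
theorem small_pow_codeLength : Small (var 2 ^ codeLength) := fun A =>
  ⟨(small_var2.tame.pow (small_pairs.mul small_var2) A).1, 1, fun U η hη => by
    simpa [mainFactor, codeLength, pairs] using hη.code_le⟩

theorem small_pow_order : Small (order ^ order) := fun A =>
  ⟨(small_order.tame.pow small_order A).1, 1, fun U η hη => by
    simpa [mainFactor, order, pathSize] using hη.order_le⟩

end NatExpr

open NatExpr

/-- The numbers compared in the test are tame. -/
def ExprTest.Tame : ExprTest → Prop
  | lt a b => a.Tame ∧ b.Tame
  | eq a b => a.Tame ∧ b.Tame
  | and S T => S.Tame ∧ T.Tame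
  | or S T => S.Tame ∧ T.Tame

theorem tame_relTest {a b c : NatExpr} (hc : c.Tame) (ha : a.Small) (hb : b.Small) :
    (relTest c a b).Tame := by
  have hℓ := small_var2.tame
  have hD := small_pathSize
  have hbm := hb.mod hℓ
  have ham := ha.mod hℓ
  have had := ha.div hℓ
  have hbd := hb.div hℓ
  exact ⟨⟨⟨ha.tame, hD.tame⟩, hb.tame, (hD.add (small_const 1)).tame⟩,
    ⟨⟨ha.tame, (hD.add (small_const 2)).tame⟩, hb.tame, (hD.add (small_const 3)).tame⟩,
    ⟨hb.tame, hD.tame⟩,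
    ⟨⟨ha.tame, (hD.add (small_const 1)).tame⟩, hbm.tame, (small_const 0).tame⟩,
    ⟨⟨ha.tame, (hD.add (small_const 2)).tame⟩, (hbm.add (small_const 1)).tame, hℓ⟩,
    ⟨ha.tame, hD.tame⟩,
    ⟨⟨had.tame, hbd.tame⟩, (ham.add (small_const 1)).tame, hbm.tame⟩,
    ⟨had.tame, hbd.tame⟩,
    hc.digit hℓ (ham.add (small_var2.mul (hbd.add (small_pred.mul had)))), hbm.tame⟩

/-! ### Cost of evaluating the statistic. -/

namespace RealExpr
variable {j : ℕ} {e f : RealExpr} {a b : NatExpr}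

/-- The cost is polynomially bounded, up to the main factor. -/
def Cheap (j : ℕ) (e : RealExpr) : Prop := ∀ A, Bdd j A fun η => e.cost η

theorem Cheap.of_zero (he : Cheap 0 e) : Cheap j e := fun A => (he A).of_zero

theorem cheap_ofNat (ha : a.Tame) : Cheap j (ofNat a) := fun A =>
  ((ha A).1.add (Bdd.const 0 A 1)).of_zero

theorem cheap_prob : Cheap j prob := fun A => Bdd.const j A 1

theorem cheap_corr : Cheap j corr := fun A => Bdd.const j A 1

theorem cheap_adjFst (ha : a.Tame) (hb : b.Tame) : Cheap j (adjFst a b) := fun A =>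
  (((ha A).1.add (hb A).1).add (Bdd.const 0 A 2)).of_zero

theorem cheap_adjSnd (ha : a.Tame) (hb : b.Tame) : Cheap j (adjSnd a b) := fun A =>
  (((ha A).1.add (hb A).1).add (Bdd.const 0 A 2)).of_zero

theorem Cheap.sub (he : Cheap j e) (hf : Cheap j f) : Cheap j (sub e f) := fun A =>
  ((he A).add (hf A)).add (Bdd.const j A 1)

theorem Cheap.mul (he : Cheap j e) (hf : Cheap j f) : Cheap j (mul e f) := fun A =>
  ((he A).add (hf A)).add (Bdd.const j A 1)

theorem Cheap.div (he : Cheap j e) (hf : Cheap j f) : Cheap j (div e f) := fun A =>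
  ((he A).add (hf A)).add (Bdd.const j A 1)

theorem Cheap.iteLt (ha : a.Tame) (hb : b.Tame) (he : Cheap j e) (hf : Cheap j f) :
    Cheap j (iteLt a b e f) := fun A =>
  ((ha A).1.add (hb A).1).of_zero.add (((he A).add (hf A)).add (Bdd.const j A 1))

theorem Cheap.iteEq (ha : a.Tame) (hb : b.Tame) (he : Cheap j e) (hf : Cheap j f) :
    Cheap j (iteEq a b e f) := fun A =>
  ((ha A).1.add (hb A).1).of_zero.add (((he A).add (hf A)).add (Bdd.const j A 1))

theorem Cheap.branch {T : ExprTest} (hT : T.Tame) (he : Cheap j e) (hf : Cheap j f) :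
    Cheap j (T.branch e f) := by
  induction T generalizing e f with
  | lt a b => exact he.iteLt hT.1 hT.2 hf
  | eq a b => exact he.iteEq hT.1 hT.2 hf
  | and S T hS hT' => exact hS hT.1 (hT' hT.2 he hf) hf
  | or S T hS hT' => exact hS hT.1 he (hT' hT.2 he hf)

/-- The bound variable may be as large as the loop bound U^k, so the body is used with a larger
exponent A. This is why cheapness demands a bound for every A. -/
theorem Cheap.bdd_sum {N : NatExpr} (hN : N.Small) {x : Fin 10} (hx : 2 < x) (hx4 : x ≠ 4)
    (he : Cheap j e) (A : ℕ) : Bdd j A fun η => N.cost η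
      + ∑ i ∈ Finset.range (N.eval η), (e.cost (Function.update η x i) + 4) + 6 := by
  refine ((hN A).1.of_zero.add ?_).add (Bdd.const j A 6)
  obtain ⟨k, hk⟩ := (hN A).2
  obtain ⟨l, hl⟩ := (he (max A k)).add (Bdd.const j (max A k) 4)
  refine ⟨k + l, fun U η hη => ?_⟩
  have hNU : N.eval η ≤ U ^ k := by simpa [mainFactor] using hk U η hη
  have hU := hη.two_le
  calc ∑ i ∈ Finset.range (N.eval η), (e.cost (Function.update η x i) + 4)
      ≤ ∑ i ∈ Finset.range (N.eval η), mainFactor j η * U ^ l := by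
        refine Finset.sum_le_sum fun i hi => ?_
        rw [← mainFactor_update hx j i]
        refine hl U _ ((hη.mono (le_max_left A k)).update hx hx4 ?_)
        exact ((Finset.mem_range.1 hi).le.trans hNU).trans
          (Nat.pow_le_pow_right (by omega) (le_max_right A k))
    _ = N.eval η * (mainFactor j η * U ^ l) := by simp
    _ ≤ U ^ k * (mainFactor j η * U ^ l) := Nat.mul_le_mul_right _ hNU
    _ = mainFactor j η * U ^ (k + l) := by ring

theorem Cheap.sum {N : NatExpr} (hN : N.Small) {x : Fin 10} (hx : 2 < x) (hx4 : x ≠ 4)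
    (he : Cheap j e) : Cheap j (sum x N e) := he.bdd_sum hN hx hx4

theorem Cheap.prod {N : NatExpr} (hN : N.Small) {x : Fin 10} (hx : 2 < x) (hx4 : x ≠ 4)
    (he : Cheap j e) : Cheap j (prod x N e) := he.bdd_sum hN hx hx4

/-- The only kind of loop with a large number of rounds. It produces the main factor n^v, while its
variable still has few digits, so each round remains polynomial in the control parameter. -/
theorem Cheap.sum_maps (he : Cheap 0 e) : Cheap 1 (RealExpr.sum 4 (var 0 ^ order) e) := by
  intro A
  have hN := tame_var0.pow small_order
  refine ((hN A).1.of_zero.add ?_).add (Bdd.const 1 A 6)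
  obtain ⟨k, hk⟩ := (hN A).2
  obtain ⟨l, hl⟩ := (he (max A k)).add (Bdd.const 0 (max A k) 4)
  refine ⟨l, fun U η hη => ?_⟩
  have hU := hη.two_le
  calc ∑ i ∈ Finset.range ((var 0 ^ order).eval η), (e.cost (Function.update η 4 i) + 4)
      ≤ ∑ i ∈ Finset.range ((var 0 ^ order).eval η), U ^ l := by
        refine Finset.sum_le_sum fun i hi => ?_
        have hadm : Admissible (max A k) U (Function.update η 4 i) := by
          refine (hη.mono (le_max_left A k)).update4 ?_
          refine (Nat.size_le_size (Finset.mem_range.1 hi).le).trans ((hk U η hη).trans ?_)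
          rw [mainFactor, pow_zero, one_mul]
          exact Nat.pow_le_pow_right (by omega) (le_max_right A k)
        simpa [mainFactor] using hl U _ hadm
    _ = mainFactor 1 η * U ^ l := by
        simp [mainFactor, order, pathSize]

theorem cheap_zero : Cheap j zero := cheap_ofNat (small_const 0).tame

theorem cheap_one : Cheap j one := cheap_ofNat (small_const 1).tame

theorem small_var5 : (var 5).Small := small_var (by decide) (by decide)

theorem small_var6 : (var 6).Small := small_var (by decide) (by decide)

theorem cheap_distinct {c k : NatExpr} (hc : c.Tame) (hk : k.Tame) : Cheap j (distinct c k) :=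
  ((cheap_one.iteEq small_var5.tame small_var6.tame (cheap_zero.iteEq (hc.digit hk small_var5)
    (hc.digit hk small_var6) cheap_one)).prod small_order (by decide) (by decide)).prod small_order
    (by decide) (by decide)

theorem cheap_edgeProd {c : NatExpr} (hc : c.Tame) {w : RealExpr} (hw : Cheap j w) :
    Cheap j (edgeProd c w) :=
  ((hw.branch (tame_relTest hc small_var5 small_var6) cheap_one).prod small_order (by decide)
    (by decide)).prod small_order (by decide) (by decide)

theorem cheap_injExpr {adj : NatExpr → NatExpr → RealExpr}
    (hadj : ∀ a b, a.Tame → b.Tame → Cheap 0 (adj a b)) : Cheap 1 (injExpr adj) :=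
  ((cheap_distinct tame_var4 tame_var0).mul (cheap_edgeProd
    (small_var (by decide) (by decide)).tame ((hadj _ _ (tame_var4.digit tame_var0 small_var5)
      (tame_var4.digit tame_var0 small_var6)).sub cheap_prob))).sum_maps

theorem cheap_valid {c : NatExpr} (hc : c.Tame) : Cheap j (valid c) := by
  have h8 : (var 8).Small := small_var (by decide) (by decide)
  have h : ∀ {a : NatExpr}, a.Small → (c.digit (var 2) (a + var 2 * var 5)).Tame := fun ha =>
    hc.digit small_var2.tame (ha.add (small_var2.mul small_var5))
  exact (((cheap_one.iteEq small_var6.tame h8.tame (cheap_zero.iteEq (h small_var6) (h h8)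
    cheap_one)).prod small_var2 (by decide) (by decide)).prod small_var2 (by decide)
    (by decide)).prod small_pairs (by decide) (by decide)

theorem cheap_isoCountExpr : Cheap j isoCountExpr := by
  have h3 : (var 3).Small := small_var (by decide) (by decide)
  have h7 : (var 7).Small := small_var (by decide) (by decide)
  have h9 : (var 9).Small := small_var (by decide) (by decide)
  have hx := h9.digit small_order.tame small_var5
  have hy := h9.digit small_order.tame small_var6
  exact ((cheap_valid h7.tame).mul (((cheap_distinct h9.tame small_order.tame).mul
    (cheap_edgeProd h7.tame (cheap_one.branch (show ExprTest.Tame (.or _ _) from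
      ⟨tame_relTest h3.tame hx hy, tame_relTest h3.tame hy hx⟩) cheap_zero))).sum small_pow_order
      (by decide) (by decide))).sum small_pow_codeLength (by decide) (by decide)

theorem cheap_scale : Cheap j scale :=
  ((cheap_corr.div (cheap_prob.mul (cheap_one.sub cheap_prob))).prod small_edges (by decide)
    (by decide)).div ((cheap_ofNat (tame_var0.sub small_var5.tame)).prod small_order (by decide)
    (by decide))

/-- The two homomorphism numbers are evaluated one after the other, never nested, so the main factor
appears to the first power only. -/
theorem cheap_statistic : Cheap 1 statistic :=
  ((cheap_valid (small_var (by decide) (by decide)).tame).mul ((cheap_scale.div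
    cheap_isoCountExpr).mul ((cheap_injExpr fun _ _ => cheap_adjFst).mul
    (cheap_injExpr fun _ _ => cheap_adjSnd)))).sum small_pow_codeLength (by decide) (by decide)

end RealExpr

/-- The quantity controlling the running time per map from the vertices to `Fin n`. -/
def control (n d ℓ : ℕ) : ℕ :=
  n.size + ℓ ^ ((d - 1) * (d - 1) * ℓ) + ((d - 1) * ℓ + 4) ^ ((d - 1) * ℓ + 4)

theorem admissible_vars_initialState {n d ℓ : ℕ} (p ρ : ℝ) (hn : 1 ≤ n) (hℓ : 1 ≤ ℓ)
    (hd : 2 ≤ d) : Admissible 0 (control n d ℓ) (initialState n d ℓ p ρ).vars := by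
  have e0 : (initialState n d ℓ p ρ).vars 0 = n := rfl
  have e1 : (initialState n d ℓ p ρ).vars 1 = d := rfl
  have e2 : (initialState n d ℓ p ρ).vars 2 = ℓ := rfl
  have hv : (d - 1) * ℓ + 4 ≤ ((d - 1) * ℓ + 4) ^ ((d - 1) * ℓ + 4) :=
    Nat.le_self_pow (by omega) _
  have h1 : d - 1 ≤ (d - 1) * ℓ := Nat.le_mul_of_pos_right _ hℓ
  have h2 : ℓ ≤ (d - 1) * ℓ := Nat.le_mul_of_pos_left _ (by omega)
  refine ⟨?_, ?_, ?_, ?_, ?_, ?_, ?_, ?_, fun x hx hx4 => ?_⟩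
  · unfold control; omega
  · rw [e0]; exact hn
  · rw [e0]; unfold control; omega
  · rw [e1]; unfold control; omega
  · rw [e2]; unfold control; omega
  · rw [e1, e2]; unfold control; omega
  · rw [e1, e2]; unfold control; omega
  · exact Nat.zero_le _
  · have h : (initialState n d ℓ p ρ).vars x = 0 := by
      simp only [RAMState.vars, initialState]
      have hx' : 2 < (x : ℕ) := hx
      rw [if_neg (by omega), if_neg (by omega), if_neg (by omega)]
    rw [h]; exact Nat.zero_le _

theorem codeLength_le_numEdges (d ℓ : ℕ) : (d - 1) * (d - 1) * ℓ ≤ 2 * numEdges d ℓ := by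
  have h1 : (d - 1) * (d - 1) ≤ 2 * d.choose 2 := by
    rw [Nat.choose_two_right, Nat.mul_div_cancel' (Nat.even_mul_pred_self d).two_dvd]
    exact Nat.mul_le_mul_right _ (Nat.sub_le _ _)
  have h2 := Nat.mul_le_mul_right ℓ h1
  rw [numEdges]
  nlinarith

/-- The number of binary digits of n is of order log n, and the other two summands are at most
N^(2N), which is n^(o(1)) by slow growth. -/
theorem SlowlyGrowing.control_pow_le {d : ℕ} (hd : 3 ≤ d) {ρ : ℕ → ℝ} {ℓ : ℕ → ℕ}
    (hℓ : ∀ᶠ n in atTop, 1 ≤ ℓ n) (h : SlowlyGrowing (fun n => numEdges d (ℓ n)) ρ) (k : ℕ) :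
    ∀ᶠ n : ℕ in atTop, control n d (ℓ n) ^ k ≤ n := by
  -- Each of the three summands will be at most n^c; half of the exponent 1 is kept to absorb 3^k.
  obtain ⟨c, hc, hck⟩ : ∃ c : ℝ, 0 < c ∧ c * k ≤ 1 / 2 := by
    refine ⟨1 / (2 * (k + 1)), by positivity, ?_⟩
    rw [div_mul_eq_mul_div, div_le_div_iff₀ (by positivity) (by norm_num)]
    linarith
  have hlog : Tendsto (fun n : ℕ => Real.log n) atTop atTop :=
    Real.tendsto_log_atTop.comp tendsto_natCast_atTop_atTop
  have hsize : ∀ᶠ x : ℝ in atTop, 2 * x + 1 ≤ Real.exp (c * x) := by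
    have h1 := (isLittleO_pow_exp_pos_mul_atTop 1 hc).bound (c := 1 / 3) (by norm_num)
    filter_upwards [h1, eventually_ge_atTop (1 : ℝ)] with x h1 h2
    rw [pow_one, Real.norm_of_nonneg (by linarith), Real.norm_of_nonneg (Real.exp_pos _).le] at h1
    linarith
  filter_upwards [hℓ, h.eventually_le (half_pos hc), hlog.eventually hsize, eventually_ge_atTop 1,
    hlog.eventually_ge_atTop (2 * (k * Real.log 3))] with n hℓ hslow hsize hn hlogn
  obtain ⟨-, -, -, hs⟩ := hslow
  have hcard := card_motifVertex_add_le_numEdges (ℓ := ℓ n) hd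
  rw [card_motifVertex] at hcard
  have hn0 : (0 : ℝ) < n := by exact_mod_cast hn
  set N := numEdges d (ℓ n) with hN
  have hN1 : 1 ≤ N := by omega
  have hN0 : (0 : ℝ) < N := by exact_mod_cast hN1
  have key : ∀ a b : ℕ, a ≤ N → b ≤ 2 * N → ((a ^ b : ℕ) : ℝ) ≤ Real.exp (c * Real.log n) := by
    intro a b ha hb
    calc ((a ^ b : ℕ) : ℝ) ≤ ((N ^ (2 * N) : ℕ) : ℝ) := by
          exact_mod_cast (Nat.pow_le_pow_left ha b).trans (Nat.pow_le_pow_right hN1 hb)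
      _ = Real.exp (2 * (N * Real.log N)) := by
          rw [Nat.cast_pow, ← Real.rpow_natCast, Real.rpow_def_of_pos hN0]
          congr 1
          push_cast
          ring
      _ ≤ Real.exp (c * Real.log n) := by
          rw [Real.exp_le_exp]
          linarith
  have hsz : (n.size : ℝ) ≤ Real.exp (c * Real.log n) := by
    refine le_trans ?_ hsize
    have h1 : 2 ^ (n.size - 1) ≤ n := Nat.lt_size.1 (by have := Nat.size_pos.2 hn; omega)
    have h2 : ((n.size - 1 : ℕ) : ℝ) * Real.log 2 ≤ Real.log n := by
      rw [← Real.log_pow]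
      exact Real.log_le_log (by positivity) (by exact_mod_cast h1)
    have h3 : (1 / 2 : ℝ) ≤ Real.log 2 := by have := Real.log_two_gt_d9; linarith
    have h4 : (n.size : ℝ) ≤ ((n.size - 1 : ℕ) : ℝ) + 1 := by
      exact_mod_cast (by omega : n.size ≤ n.size - 1 + 1)
    have h5 : (0 : ℝ) ≤ ((n.size - 1 : ℕ) : ℝ) := Nat.cast_nonneg _
    nlinarith
  have hcontrol : (control n d (ℓ n) : ℝ) ≤ 3 * Real.exp (c * Real.log n) := by
    have h1 := key (ℓ n) ((d - 1) * (d - 1) * ℓ n) (by omega) (codeLength_le_numEdges d (ℓ n))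
    have h2 := key ((d - 1) * ℓ n + 4) ((d - 1) * ℓ n + 4) (by omega) (by omega)
    rw [control, Nat.cast_add, Nat.cast_add]
    linarith
  have hfinal : ((control n d (ℓ n) ^ k : ℕ) : ℝ) ≤ n := by
    have hl : 0 ≤ Real.log n := Real.log_nonneg (by exact_mod_cast hn)
    calc ((control n d (ℓ n) ^ k : ℕ) : ℝ) = (control n d (ℓ n) : ℝ) ^ k := by push_cast; ring
      _ ≤ (3 * Real.exp (c * Real.log n)) ^ k := pow_le_pow_left₀ (Nat.cast_nonneg _) hcontrol k
      _ = Real.exp (k * Real.log 3 + c * k * Real.log n) := by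
          rw [mul_pow, Real.exp_add, ← Real.exp_nat_mul, ← Real.log_pow,
            Real.exp_log (by positivity)]
          congr 2
          ring
      _ ≤ Real.exp (Real.log n) := by
          rw [Real.exp_le_exp]
          nlinarith
      _ = n := Real.exp_log hn0
  exact_mod_cast hfinal

/-- The statistic can be computed in time `n ^ N`. -/
theorem exists_program : ∃ (P : RAMProgram) (K : ℝ), 0 < K ∧ ∀ d : ℕ, 3 ≤ d →
    ∀ (p : ℕ → I) (ρ : ℕ → ℝ) (ℓ : ℕ → ℕ),
      (∀ᶠ n in atTop, 0 < (p n : ℝ) ∧ (p n : ℝ) < 1) →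
      (∀ᶠ n in atTop, 0 < ρ n ∧ ρ n ≤ 1) →
      (∀ᶠ n in atTop, 1 ≤ ℓ n) →
      SlowlyGrowing (fun n => numEdges d (ℓ n)) ρ →
      ∀ᶠ n in atTop, ∀ G : SimpleGraph (Fin n) × SimpleGraph (Fin n),
        OutputsWithin P d (ℓ n) (p n) (ρ n) G
          (specialStatistic d (ℓ n) n (p n) (ρ n) G)
          (K * (n : ℝ) ^ numEdges d (ℓ n)) := by
  -- Initially all variables other than the inputs are 0, so the exponent A = 0 is enough.
  obtain ⟨k, hk⟩ := RealExpr.cheap_statistic 0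
  refine ⟨.seq (RealExpr.statistic.compile 10 2) (.instr (.realCopy 0 2)), 1, one_pos,
    fun d hd p ρ ℓ hp hρ hℓ hslow => ?_⟩
  filter_upwards [hp, hℓ, hslow.control_pow_le hd hℓ (k + 1), eventually_ge_atTop 1]
    with n hp hℓ hcontrol hn G
  set U := control n d (ℓ n) with hU
  have hadm := admissible_vars_initialState (p n : ℝ) (ρ n) hn hℓ (by omega : 2 ≤ d)
  have hU2 : 2 ≤ U := hadm.two_le
  have hcard := card_motifVertex_add_le_numEdges (ℓ := ℓ n) hd
  rw [card_motifVertex] at hcard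
  have hvn : (d - 1) * ℓ n + 4 ≤ n := by
    calc (d - 1) * ℓ n + 4 ≤ ((d - 1) * ℓ n + 4) ^ ((d - 1) * ℓ n + 4) :=
          Nat.le_self_pow (by omega) _
      _ ≤ U := hadm.order_le
      _ ≤ U ^ (k + 1) := Nat.le_self_pow (by omega) _
      _ ≤ n := hcontrol
  have hinput : RealExpr.IsInput n d (ℓ n) (initialState n d (ℓ n) (p n) (ρ n)).vars :=
    ⟨rfl, rfl, rfl⟩
  have hcost : RealExpr.statistic.cost (initialState n d (ℓ n) (p n) (ρ n)).vars
      ≤ n ^ ((d - 1) * ℓ n + 4) * U ^ k := by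
    simpa [mainFactor, hinput.eq0, hinput.eq1, hinput.eq2] using hk U _ hadm
  have hrun := (RealExpr.statistic.correct (G := G) 10 2
    (initialState n d (ℓ n) (p n) (ρ n)) le_rfl le_rfl).seq (R := .instr (.realCopy 0 2)) (B' := 1)
    (Q' := fun s => s.real 0 = specialStatistic d (ℓ n) n (p n) (ρ n) G) fun s hs => by
      refine Runs.instr ?_
      have h : s.real 2 = specialStatistic d (ℓ n) n (p n) (ρ n) G := by
        rw [hs.2]
        exact RealExpr.eval_statistic (p := (p n : ℝ)) (ρ := ρ n) hinput hd hℓ hvn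
          (mul_pos hp.1 (by linarith [hp.2])).ne'
      simpa [RAMInstr.run] using h
  obtain ⟨t, s, h1, h2, h3⟩ := hrun
  refine ⟨t, s, h1, h3, ?_⟩
  have hpow : 1 ≤ n ^ ((d - 1) * ℓ n + 4) * U ^ k :=
    Nat.mul_pos (pow_pos hn _) (pow_pos (by omega) _)
  -- One factor U absorbs the final copy instruction, and U^(k+1) ≤ n is paid by the spare factor n,
  -- available because e ≥ v + ℓ ≥ v + 1.
  have ht : t ≤ n ^ numEdges d (ℓ n) := by
    calc t ≤ n ^ ((d - 1) * ℓ n + 4) * U ^ k * 2 := by omega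
      _ ≤ n ^ ((d - 1) * ℓ n + 4) * U ^ k * U := Nat.mul_le_mul_left _ hU2
      _ = n ^ ((d - 1) * ℓ n + 4) * U ^ (k + 1) := by ring
      _ ≤ n ^ ((d - 1) * ℓ n + 4) * n := Nat.mul_le_mul_left _ hcontrol
      _ = n ^ ((d - 1) * ℓ n + 4 + 1) := (pow_succ _ _).symm
      _ ≤ n ^ numEdges d (ℓ n) := Nat.pow_le_pow_right hn (by omega)
  rw [one_mul]
  exact_mod_cast ht

end MotifCounting

/-! ### The main theorem. -/

open MotifCounting in
theorem mainTheorem3 :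
    -- Sparse regime
    (∀ d : ℕ, ∃ C₁ : ℝ, 0 < C₁ ∧ ∀ a : ℝ, 0 < a → a ≤ 2 / 3 → d = ⌊2 / a⌋₊ →
      ∀ (p : ℕ → I) (ρ : ℕ → ℝ) (ℓ : ℕ → ℕ),
        (∀ᶠ n : ℕ in atTop, (p n : ℝ) = (n : ℝ) ^ (-a)) →
        (∀ᶠ n in atTop, 0 < ρ n ∧ ρ n ≤ 1) →
        (∀ᶠ n in atTop, 1 ≤ ℓ n) →
        SlowlyGrowing (fun n => numEdges d (ℓ n)) ρ →
        (∀ᶠ n in atTop,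
          C₁ / ρ n ^ (2 * (d : ℝ) / ((d : ℝ) - 2)) ≤ (numEdges d (ℓ n) : ℝ)) →
        ∀ᶠ n in atTop, totalError d (ℓ n) n (p n) (ρ n) ≤ 0.05) ∧
    -- Dense regime
    (∀ ε : ℝ, 0 < ε → ∃ C₂ : ℝ, 0 < C₂ ∧ ∀ d : ℕ, d = ⌊4 / ε⌋₊ + 3 →
      ∀ (p : ℕ → I) (ρ : ℕ → ℝ) (ℓ : ℕ → ℕ),
        (∀ᶠ n in atTop, 0 < (p n : ℝ) ∧ (p n : ℝ) < 1) →
        ((fun n => Real.log (p n)) =o[atTop] fun n : ℕ => Real.log n) →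
        ((fun n => Real.log (1 - p n)) =o[atTop] fun n : ℕ => Real.log n) →
        (∀ᶠ n in atTop, 0 < ρ n ∧ ρ n ≤ 1) →
        (∀ᶠ n in atTop, 1 ≤ ℓ n) →
        SlowlyGrowing (fun n => numEdges d (ℓ n)) ρ →
        (∀ᶠ n in atTop, C₂ / ρ n ^ (2 + ε) ≤ (numEdges d (ℓ n) : ℝ)) →
        ∀ᶠ n in atTop, totalError d (ℓ n) n (p n) (ρ n) ≤ 0.05) ∧
    -- Running time
    (∃ (P : RAMProgram) (K : ℝ), 0 < K ∧ ∀ d : ℕ, 3 ≤ d →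
      ∀ (p : ℕ → I) (ρ : ℕ → ℝ) (ℓ : ℕ → ℕ),
        (∀ᶠ n in atTop, 0 < (p n : ℝ) ∧ (p n : ℝ) < 1) →
        (∀ᶠ n in atTop, 0 < ρ n ∧ ρ n ≤ 1) →
        (∀ᶠ n in atTop, 1 ≤ ℓ n) →
        SlowlyGrowing (fun n => numEdges d (ℓ n)) ρ →
        ∀ᶠ n in atTop, ∀ G : SimpleGraph (Fin n) × SimpleGraph (Fin n),
          OutputsWithin P d (ℓ n) (p n) (ρ n) G
            (specialStatistic d (ℓ n) n (p n) (ρ n) G)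
            (K * (n : ℝ) ^ numEdges d (ℓ n))) := by
  -- The sparse statement asks for a positive constant for every d, including d = 0, where
  -- `edgeConstant` vanishes; hence the added 1.
  refine ⟨fun d => ⟨edgeConstant d + 1, by unfold edgeConstant; positivity, ?_⟩,
    fun ε hε => ⟨edgeConstant (⌊4 / ε⌋₊ + 3) + 1,
      by unfold edgeConstant; positivity, ?_⟩, ?_⟩
  · intro a ha ha' hda p ρ ℓ hp hρ hℓ hslow hN
    refine sparse_regime d ha ha' hda hp hρ hℓ hslow ?_
    filter_upwards [hN, hρ] with n h1 h2
    have := Real.rpow_nonneg h2.1.le (2 * (d : ℝ) / ((d : ℝ) - 2))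
    exact le_trans (by gcongr; linarith) h1
  · rintro d hdε p ρ ℓ hp hp1 hp2 hρ hℓ hslow hN
    refine dense_regime hε hdε hp hp1 hp2 hρ hℓ hslow ?_
    filter_upwards [hN, hρ] with n h1 h2
    have := Real.rpow_nonneg h2.1.le (2 + ε)
    rw [← hdε] at h1
    exact le_trans (by gcongr; linarith) h1
  · exact exists_program
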